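/- Let $\mathbb T=\mathbb R/2\pi\mathbb Z$ and let $\phi\in L^\infty(\mathbb T)$ be an even (radial) kernel, not necessarily of one sign, with positive total mass $\int_{\mathbb T}\phi>0$. Consider on $\mathbb T$ the Cucker–Smale hydrodynamics $$\rho_t+(\rho u)_x=0,\qquad (\rho u)_t+(\rho u^2)_x=\rho\,F[\rho,u],\qquad F[\rho,u](x,t):=\int_{\mathbb T}\phi(x-y)\,\bigl(u(y,t)-u(x,t)\bigr)\rho(y,t)\,dy ,$$ with initial data $\rho_0\in L^1(\mathbb T)$, $\rho_0\ge 0$ a.e., and $u_0\in W^{1,\infty}(\mathbb T)$. Suppose that the data are subcritical: $$u_0'(x)+(\phi*\rho_0)(x)>0\qquad\text{for a.e. }x\in\mathbb T .$$ Then there is a global solution $(\rho,u)$ on $[0,\infty)\times\mathbb T$ which keeps the regularity of the data: (i) $\rho\in C([0,\infty);L^1(\mathbb T))$ with $\rho(\cdot,t)\ge0$ a.e., $u\in C([0,\infty)\times\mathbb T)\cap L^\infty_{\rm loc}([0,\infty);W^{1,\infty}(\mathbb T))$, $(\rho,u)(\cdot,0)=(\rho_0,u_0)$ a.e., and the two equations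 above, as well as the velocity equation $u_t+uu_x=F[\rho,u]$ (also where $\rho=0$), hold in the sense of distributions with these initial data; (ii) if in addition $\rho_0,u_0\in C^\infty(\mathbb T)$, then $\rho,u\in C^\infty([0,\infty)\times\mathbb T)$, $\rho\ge 0$, and these equations and the initial conditions hold pointwise. -/

import Mathlib

open scoped ContDiff

noncomputable section

namespace CuckerSmale

open MeasureTheory Set Filter Topology

/-- Functions on the torus `𝕋 = ℝ / 2πℤ` are `2π`-periodic functions on `ℝ`; integrals and
almost-everywhere statements over `𝕋` are taken over the fundamental domain `(0, 2π]`. -/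
abbrev torus : Measure ℝ := volume.restrict (Ioc 0 (2 * Real.pi))

/-- A `2π`-periodic function on `ℝ`. -/
abbrev IsPeriodic (f : ℝ → ℝ) : Prop := Function.Periodic f (2 * Real.pi)

/-- Bounded radial kernels on the torus with positive total mass; no sign condition. -/
structure IsBoundedKernel (φ : ℝ → ℝ) : Prop where
  periodic : IsPeriodic φ
  even : ∀ z, φ (-z) = φ z
  bounded : MemLp φ ⊤ torus
  mass_pos : 0 < ∫ z, φ z ∂torus

/-- The class `L¹₊(𝕋)`. -/
structure MemL1Plus (f : ℝ → ℝ) : Prop where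
  periodic : IsPeriodic f
  integrable : Integrable f torus
  nonneg : ∀ᵐ x ∂torus, 0 ≤ f x

/-- `g` is the weak derivative of `f` on the torus. -/
def HasWeakDeriv (f g : ℝ → ℝ) : Prop :=
  ∀ ψ : ℝ → ℝ, ContDiff ℝ ∞ ψ → IsPeriodic ψ →
    ∫ x, f x * deriv ψ x ∂torus = -∫ x, g x * ψ x ∂torus

/-- `f ∈ W^{1,∞}(𝕋)` with weak derivative `f'`. -/
structure MemW1Infty (f f' : ℝ → ℝ) : Prop where
  periodic : IsPeriodic f
  memLp : MemLp f ⊤ torus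
  memLp_deriv : MemLp f' ⊤ torus
  weakDeriv : HasWeakDeriv f f'

/-- Convolution on the torus. -/
def conv (φ ρ : ℝ → ℝ) (x : ℝ) : ℝ := ∫ y, φ (x - y) * ρ y ∂torus

/-- The alignment force `∫ φ(x - y) (u(y) - u(x)) ρ(y) dy`, per unit mass. -/
def force (φ ρ u : ℝ → ℝ) (x : ℝ) : ℝ := ∫ y, φ (x - y) * (u y - u x) * ρ y ∂torus

/-- Space-time test functions: smooth and periodic in space. They need not vanish at time `0`, nor
have compact support in time, since the weak formulations below are on the intervals `[0, t]`. -/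
structure IsTest (ψ : ℝ → ℝ → ℝ) : Prop where
  smooth : ContDiff ℝ ∞ (fun p : ℝ × ℝ => ψ p.1 p.2)
  periodic : ∀ t, IsPeriodic (ψ t)

/-- `(ρ, u)`, as functions of time and space, is a global strong solution of
`ρ_t + (ρ u)_x = 0`, `(ρ u)_t + (ρ u²)_x = ρ(x) ∫ φ(x - y) (u(y) - u(x)) ρ(y) dy`
with data `(ρ₀, u₀)`, in the class `ρ ∈ C([0, ∞); L¹₊)`, `u ∈ C([0, ∞) × 𝕋)`,
`u ∈ L^∞_loc([0, ∞); W^{1,∞})`. The velocity equation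
`u_t + u u_x = ∫ φ(x - y) (u(y) - u(x)) ρ(y) dy` is required too, also where `ρ` vanishes. -/
structure IsGlobalSolution (φ ρ₀ u₀ : ℝ → ℝ) (ρ u : ℝ → ℝ → ℝ) : Prop where
  density_mem : ∀ t, 0 ≤ t → MemL1Plus (ρ t)
  density_continuous : ∀ t, 0 ≤ t →
    Tendsto (fun s => ∫ x, |ρ s x - ρ t x| ∂torus) (𝓝[Ici 0] t) (𝓝 0)
  velocity_continuous : ContinuousOn (fun p : ℝ × ℝ => u p.1 p.2) (Ici 0 ×ˢ univ)
  velocity_mem : ∀ T : ℝ, ∃ C : ℝ, ∀ t, 0 ≤ t → t ≤ T → ∃ v : ℝ → ℝ,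
    MemW1Infty (u t) v ∧ (∀ᵐ x ∂torus, |u t x| ≤ C) ∧ (∀ᵐ x ∂torus, |v x| ≤ C)
  initial_density : ρ 0 =ᵐ[torus] ρ₀
  initial_velocity : u 0 =ᵐ[torus] u₀
  mass : ∀ ψ, IsTest ψ → ∀ t, 0 ≤ t →
    (∫ x, ρ t x * ψ t x ∂torus) - ∫ x, ρ₀ x * ψ 0 x ∂torus =
      ∫ s in (0 : ℝ)..t, ∫ x,
        (ρ s x * deriv (fun r => ψ r x) s + ρ s x * u s x * deriv (ψ s) x) ∂torus
  momentum : ∀ ψ, IsTest ψ → ∀ t, 0 ≤ t →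
    (∫ x, ρ t x * u t x * ψ t x ∂torus) - ∫ x, ρ₀ x * u₀ x * ψ 0 x ∂torus =
      ∫ s in (0 : ℝ)..t, ∫ x,
        (ρ s x * u s x * deriv (fun r => ψ r x) s + ρ s x * u s x ^ 2 * deriv (ψ s) x
          + ρ s x * force φ (ρ s) (u s) x * ψ s x) ∂torus
  velocity : ∀ ψ, IsTest ψ → ∀ t, 0 ≤ t →
    (∫ x, u t x * ψ t x ∂torus) - ∫ x, u₀ x * ψ 0 x ∂torus =
      ∫ s in (0 : ℝ)..t, ∫ x,
        (u s x * deriv (fun r => ψ r x) s + u s x ^ 2 / 2 * deriv (ψ s) x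
          + force φ (ρ s) (u s) x * ψ s x) ∂torus

/-- `(ρ, u)` is a classical `C^∞` solution on `[0, ∞) × 𝕋`, up to the initial time. -/
structure IsSmoothSolution (φ ρ₀ u₀ : ℝ → ℝ) (ρ u : ℝ → ℝ → ℝ) : Prop where
  periodic : ∀ t, 0 ≤ t → IsPeriodic (ρ t) ∧ IsPeriodic (u t)
  density_smooth : ContDiffOn ℝ ∞ (fun p : ℝ × ℝ => ρ p.1 p.2) (Ici 0 ×ˢ univ)
  velocity_smooth : ContDiffOn ℝ ∞ (fun p : ℝ × ℝ => u p.1 p.2) (Ici 0 ×ˢ univ)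
  density_nonneg : ∀ t, 0 ≤ t → ∀ x, 0 ≤ ρ t x
  initial : ∀ x, ρ 0 x = ρ₀ x ∧ u 0 x = u₀ x
  mass : ∀ t, 0 ≤ t → ∀ x,
    derivWithin (fun s => ρ s x) (Ici 0) t + deriv (fun y => ρ t y * u t y) x = 0
  momentum : ∀ t, 0 ≤ t → ∀ x,
    derivWithin (fun s => ρ s x * u s x) (Ici 0) t + deriv (fun y => ρ t y * u t y ^ 2) x =
      ρ t x * force φ (ρ t) (u t) x
  velocity : ∀ t, 0 ≤ t → ∀ x,
    derivWithin (fun s => u s x) (Ici 0) t + u t x * deriv (u t) x = force φ (ρ t) (u t) x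

end CuckerSmale

end

open scoped ContDiff

noncomputable section

namespace CuckerSmale

open MeasureTheory Set Filter Topology

/-! ### Ordinary differential equations -/

section ODE

variable {E : Type*} [NormedAddCommGroup E] [NormedSpace ℝ E]

/-! Let Φ be the primitive of φ. In labels, mass is transported unchanged: `ρ dy` is the image of
`ρ₀ db` under the flow X. The force felt by the particle a is therefore −d/dt ∫ Φ(X(a) − X(b)) ρ₀(b)
db, so u + Φ∗ρ is constant along characteristics. The second-order dynamics reduces to the
first-order equation Ẋ(a) = u₀(a) + (Φ∗ρ₀)(a) − ∫ Φ(X(a) − X(b)) ρ₀(b) db, whose right-hand side is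
`configVel`. Since φ is bounded, Φ is Lipschitz; the equation for the displacement X − id is then a
globally Lipschitz ODE in the bounded continuous functions, and the flow exists for all times
(`exists_flow`).

Subcriticality says that u₀ + Φ∗ρ₀ has slope e₀ ≥ 0, that is, it is nondecreasing. Hence gaps
between particles close at most exponentially (`lower_bound`), whatever the sign of φ. Each X(t, ·)
is a bi-Lipschitz homeomorphism with Jacobian solving J' = e₀ − (φ∗ρ)J, which stays positive. The
solution is ρ = ρ₀/J and u = Ẋ, both read at the inverse flow.

As φ is only bounded, Φ(X(a) − X(b)) cannot be differentiated pointwise. Instead φ is replaced by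
Steklov averages φₙ. The flow pushes Lebesgue measure to measures of bounded density
(`map_torus_le`), so φₙ∗ρ → φ∗ρ uniformly on bounded times (`eventually_flowConv_steklov_sub_le`).
It follows that φ∗ρ is continuous and that the velocity equation holds along characteristics
(`hasDerivWithinAt_vel`). The weak formulations come from changing variables to labels, and strong
L¹ continuity from comparing densities in labels.

For smooth data the kernel is still rough, so all derivatives must fall on the solution. The state f
= (ρ, e, u, ρu) with e = u_x + φ∗ρ solves a closed system f_t + u f_x = F(f, φ∗f), in which u_x = e
− φ∗ρ is again a function of f and φ∗f. A solution of such a system is Lipschitz in space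
(`exists_lipschitz`), then φ∗f is C¹ in space, then f is, and (f, f_x) solves a system of the same
kind (`exists_prolongation`). Induction gives every order of differentiability. -/

/-- Integration from 0 has norm at most 1/μ for the weight `exp(μ|t|)`; this makes Picard iteration
contract on the whole line at once. -/
theorem norm_intervalIntegral_le_exp {w : ℝ → E} {C μ : ℝ} (hμ : 0 < μ)
    (hC : 0 ≤ C) (hw : ∀ s, ‖w s‖ ≤ C * Real.exp (μ * |s|)) (t : ℝ) :
    ‖∫ s in (0 : ℝ)..t, w s‖ ≤ C / μ * Real.exp (μ * |t|) := by
  have key : ∀ (w : ℝ → E), (∀ s, ‖w s‖ ≤ C * Real.exp (μ * |s|)) → ∀ t, 0 ≤ t →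
      ‖∫ s in (0 : ℝ)..t, w s‖ ≤ C / μ * Real.exp (μ * |t|) := by
    intro w hw t ht
    have h1 : ‖∫ s in (0 : ℝ)..t, w s‖ ≤ ∫ s in (0 : ℝ)..t, C * Real.exp (μ * s) := by
      apply intervalIntegral.norm_integral_le_of_norm_le ht
      · refine Eventually.of_forall fun s hs => ?_
        simpa [abs_of_pos hs.1] using hw s
      · exact Continuous.intervalIntegrable (by fun_prop) _ _
    have h2 : ∫ s in (0 : ℝ)..t, C * Real.exp (μ * s) = C / μ * Real.exp (μ * t) - C / μ := by
      have := intervalIntegral.integral_eq_sub_of_hasDerivAt (a := 0) (b := t)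
        (f := fun s => C / μ * Real.exp (μ * s)) (f' := fun s => C * Real.exp (μ * s))
        (fun s _ => by
          have h := (((hasDerivAt_id s).const_mul μ).exp).const_mul (C / μ)
          refine h.congr_deriv ?_
          simp only [id]
          field_simp)
        (Continuous.intervalIntegrable (by fun_prop) _ _)
      rw [this]; simp
    rw [abs_of_nonneg ht]
    have : 0 ≤ C / μ := by positivity
    linarith
  rcases le_total 0 t with ht | ht
  · exact key w hw t ht
  · have h := key (fun s => w (-s)) (fun s => by simpa using hw (-s)) (-t) (by linarith)
    rw [intervalIntegral.integral_comp_neg] at h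
    rw [intervalIntegral.integral_symm, norm_neg]
    simpa using h

theorem exists_forall_hasDerivAt_of_lipschitz [CompleteSpace E] (v : ℝ → E → E)
    (hv : Continuous (Function.uncurry v)) {K : ℝ} (hK : 0 ≤ K)
    (hL : ∀ t x y, ‖v t x - v t y‖ ≤ K * ‖x - y‖) {B : ℝ} (hB : ∀ t, ‖v t 0‖ ≤ B) (x₀ : E) :
    ∃ x : ℝ → E, x 0 = x₀ ∧ ∀ t, HasDerivAt x (v t (x t)) t := by
  -- Any rate above `K` gives the contraction ratio `K / μ < 1`; adding 1 also covers `K = 0`.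
  set μ : ℝ := K + 1 with hμ
  have hμ0 : 0 < μ := by positivity
  have hB0 : 0 ≤ B := (norm_nonneg _).trans (hB 0)
  have hexp : ∀ s : ℝ, 1 ≤ Real.exp (μ * |s|) := fun s =>
    Real.one_le_exp (by positivity)
  have hcont : ∀ η : BoundedContinuousFunction ℝ E,
      Continuous fun s => v s (Real.exp (μ * |s|) • η s) := fun η =>
    hv.comp (continuous_id.prodMk (by fun_prop))
  have hint : ∀ η : BoundedContinuousFunction ℝ E,
      Continuous fun t => ∫ s in (0 : ℝ)..t, v s (Real.exp (μ * |s|) • η s) := fun η =>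
    intervalIntegral.continuous_primitive (fun a b => (hcont η).intervalIntegrable a b) 0
  have hbd : ∀ (η : BoundedContinuousFunction ℝ E) (s : ℝ),
      ‖v s (Real.exp (μ * |s|) • η s)‖ ≤ (B + K * ‖η‖) * Real.exp (μ * |s|) := by
    intro η s
    have h1 := hL s (Real.exp (μ * |s|) • η s) 0
    have h2 := hB s
    have h3 : ‖Real.exp (μ * |s|) • η s - 0‖ ≤ Real.exp (μ * |s|) * ‖η‖ := by
      rw [sub_zero, norm_smul, Real.norm_eq_abs, abs_of_pos (Real.exp_pos _)]
      gcongr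
      exact η.norm_coe_le_norm s
    have h4 := norm_le_norm_sub_add (v s (Real.exp (μ * |s|) • η s)) (v s 0)
    have h5 := hexp s
    have h6 : K * ‖Real.exp (μ * |s|) • η s - 0‖ ≤ K * (Real.exp (μ * |s|) * ‖η‖) := by gcongr
    have h7 : B ≤ B * Real.exp (μ * |s|) := by nlinarith
    linarith
  -- The Picard map conjugated by the weight: `η` stands for `exp(-μ|t|) x(t)`, so the solution is
  -- sought among bounded functions.
  let P : BoundedContinuousFunction ℝ E → BoundedContinuousFunction ℝ E := fun η =>
    BoundedContinuousFunction.ofNormedAddCommGroup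
      (fun t => Real.exp (-(μ * |t|)) • (x₀ + ∫ s in (0 : ℝ)..t, v s (Real.exp (μ * |s|) • η s)))
      ((by fun_prop : Continuous fun t : ℝ => Real.exp (-(μ * |t|))).smul
        (continuous_const.add (hint η)))
      (‖x₀‖ + (B + K * ‖η‖) / μ) (by
        intro t
        rw [norm_smul, Real.norm_eq_abs, abs_of_pos (Real.exp_pos _)]
        have h1 := norm_intervalIntegral_le_exp hμ0 (by positivity) (hbd η) t
        have h2 := norm_add_le x₀ (∫ s in (0 : ℝ)..t, v s (Real.exp (μ * |s|) • η s))
        have h3 : Real.exp (-(μ * |t|)) * Real.exp (μ * |t|) = 1 := by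
          rw [← Real.exp_add]; simp
        have h4 : Real.exp (-(μ * |t|)) ≤ 1 := Real.exp_le_one_iff.2 (by
          have : 0 ≤ μ * |t| := by positivity
          linarith)
        calc _ ≤ Real.exp (-(μ * |t|)) *
              (‖x₀‖ + (B + K * ‖η‖) / μ * Real.exp (μ * |t|)) := by gcongr; linarith
          _ = Real.exp (-(μ * |t|)) * ‖x₀‖ + (B + K * ‖η‖) / μ *
              (Real.exp (-(μ * |t|)) * Real.exp (μ * |t|)) := by ring
          _ ≤ _ := by
            rw [h3, mul_one]
            have := mul_le_mul_of_nonneg_right h4 (norm_nonneg x₀)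
            linarith)
  have hP : ContractingWith (K / μ).toNNReal P := by
    refine ⟨?_, LipschitzWith.of_dist_le_mul fun η ζ => ?_⟩
    · rw [← NNReal.coe_lt_coe, Real.coe_toNNReal _ (by positivity), NNReal.coe_one,
        div_lt_one hμ0]
      linarith
    · rw [Real.coe_toNNReal _ (by positivity)]
      refine (BoundedContinuousFunction.dist_le (by positivity)).2 fun t => ?_
      change dist
        (Real.exp (-(μ * |t|)) • (x₀ + ∫ s in (0 : ℝ)..t, v s (Real.exp (μ * |s|) • η s)))
        (Real.exp (-(μ * |t|)) • (x₀ + ∫ s in (0 : ℝ)..t, v s (Real.exp (μ * |s|) • ζ s))) ≤ _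
      rw [dist_eq_norm, ← smul_sub, norm_smul, Real.norm_eq_abs, abs_of_pos (Real.exp_pos _),
        add_sub_add_left_eq_sub, ← intervalIntegral.integral_sub
          ((hcont η).intervalIntegrable _ _) ((hcont ζ).intervalIntegrable _ _)]
      have h1 := norm_intervalIntegral_le_exp (C := K * dist η ζ) hμ0 (by positivity)
        (w := fun s => v s (Real.exp (μ * |s|) • η s) - v s (Real.exp (μ * |s|) • ζ s))
        (fun s => by
          refine (hL s _ _).trans ?_
          rw [← smul_sub, norm_smul, Real.norm_eq_abs, abs_of_pos (Real.exp_pos _), mul_assoc,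
            mul_comm (dist η ζ)]
          gcongr
          rw [← dist_eq_norm]
          exact BoundedContinuousFunction.dist_coe_le_dist s) t
      have h3 : Real.exp (-(μ * |t|)) * Real.exp (μ * |t|) = 1 := by
        rw [← Real.exp_add]; simp
      calc _ ≤ Real.exp (-(μ * |t|)) * (K * dist η ζ / μ * Real.exp (μ * |t|)) := by gcongr
        _ = (Real.exp (-(μ * |t|)) * Real.exp (μ * |t|)) * (K / μ * dist η ζ) := by ring
        _ = _ := by rw [h3, one_mul]
  obtain ⟨η, hη⟩ : ∃ η, P η = η := ⟨hP.fixedPoint, hP.fixedPoint_isFixedPt⟩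
  have hfix : ∀ t, Real.exp (μ * |t|) • η t =
      x₀ + ∫ s in (0 : ℝ)..t, v s (Real.exp (μ * |s|) • η s) := by
    intro t
    have h : P η t = η t := by rw [hη]
    rw [← h]
    change Real.exp (μ * |t|) • (Real.exp (-(μ * |t|)) •
      (x₀ + ∫ s in (0 : ℝ)..t, v s (Real.exp (μ * |s|) • η s))) = _
    rw [smul_smul, ← Real.exp_add]; simp
  refine ⟨fun t => Real.exp (μ * |t|) • η t, ?_, fun t => ?_⟩
  · simpa using hfix 0
  · have h := ((hcont η).integral_hasStrictDerivAt 0 t).hasDerivAt.const_add x₀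
    exact h.congr_of_eventuallyEq (Eventually.of_forall hfix)

/-- Grönwall, with `(exp(Kt) - 1)/K` replaced by the larger `t exp(Kt)` so that one formula also
covers `K = 0`. -/
theorem norm_le_exp_of_norm_derivWithin_le {f f' : ℝ → E} {δ K ε T : ℝ} (hK : 0 ≤ K)
    (hε : 0 ≤ ε) (hf : ∀ t ∈ Icc 0 T, HasDerivWithinAt f (f' t) (Ici 0) t) (h0 : ‖f 0‖ ≤ δ)
    (hb : ∀ t ∈ Icc 0 T, ‖f' t‖ ≤ K * ‖f t‖ + ε) :
    ∀ t ∈ Icc 0 T, ‖f t‖ ≤ (δ + ε * t) * Real.exp (K * t) := by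
  intro t ht
  have h := norm_le_gronwallBound_of_norm_deriv_right_le (f := f) (f' := f') (a := 0) (b := T)
    (δ := δ) (K := K) (ε := ε)
    (fun s hs => ((hf s hs).continuousWithinAt).mono Icc_subset_Ici_self)
    (fun s hs => (hf s ⟨hs.1, hs.2.le⟩).mono (Ici_subset_Ici.2 hs.1)) h0
    (fun s hs => hb s ⟨hs.1, hs.2.le⟩) t ht
  refine h.trans ?_
  rw [sub_zero]
  rcases hK.eq_or_lt with rfl | hK
  · simp [gronwallBound_K0]
  · rw [gronwallBound_of_K_ne_0 hK.ne']
    have h1 : Real.exp (K * t) - 1 ≤ K * t * Real.exp (K * t) := by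
      have h2 := Real.add_one_le_exp (-(K * t))
      have h3 : Real.exp (-(K * t)) * Real.exp (K * t) = 1 := by rw [← Real.exp_add]; simp
      nlinarith [Real.exp_pos (K * t)]
    have h4 : ε / K * (Real.exp (K * t) - 1) ≤ ε / K * (K * t * Real.exp (K * t)) := by gcongr
    have h5 : ε / K * (K * t * Real.exp (K * t)) = ε * t * Real.exp (K * t) := by field_simp
    linarith

/-- Differentiability of the solution of an ODE with respect to a parameter. -/
theorem hasDerivAt_param_of_linearized {x v : ℝ → ℝ → E} {k : ℝ → E} (A : ℝ → E →L[ℝ] E)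
    (b : ℝ → E) {a₀ T M : ℝ}
    (hx : ∀ a, ∀ t ∈ Icc 0 T, HasDerivWithinAt (fun s => x s a) (v t a) (Ici 0) t)
    (hk : ∀ t ∈ Icc 0 T, HasDerivWithinAt k (A t (k t) + b t) (Ici 0) t)
    (hA : ∀ t ∈ Icc 0 T, ‖A t‖ ≤ M) (h0 : HasDerivAt (x 0) (k 0) a₀)
    (hv : ∀ ε > 0, ∀ᶠ a in 𝓝 a₀, ∀ t ∈ Icc 0 T,
      ‖v t a - v t a₀ - A t (x t a - x t a₀) - (a - a₀) • b t‖ ≤ ε * |a - a₀|) :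
    ∀ t ∈ Icc 0 T, HasDerivAt (x t) (k t) a₀ := by
  intro t ht
  have hM : 0 ≤ M := (norm_nonneg _).trans (hA t ht)
  rw [hasDerivAt_iff_isLittleO, Asymptotics.isLittleO_iff]
  intro c hc
  have hT0 : 0 ≤ t := ht.1
  -- Chosen so that the Grönwall factor `(1 + t) exp(Mt)` turns the error back into `c`.
  set ε := c / ((1 + t) * Real.exp (M * t)) with hεdef
  have hε : 0 < ε := by positivity
  rw [hasDerivAt_iff_isLittleO, Asymptotics.isLittleO_iff] at h0
  filter_upwards [hv ε hε, h0 hε] with a ha ha0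
  -- The remainder of the first-order expansion satisfies the linear equation up to `ε |a - a₀|`,
  -- and is that small initially.
  have h := norm_le_exp_of_norm_derivWithin_le (E := E)
    (f := fun s => x s a - x s a₀ - (a - a₀) • k s)
    (f' := fun s => v s a - v s a₀ - (a - a₀) • (A s (k s) + b s))
    (δ := ε * |a - a₀|) (K := M) (ε := ε * |a - a₀|) (T := T) hM (by positivity)
    (fun s hs => ((hx a s hs).sub (hx a₀ s hs)).sub ((hk s hs).const_smul _))
    (by simpa using ha0)
    (fun s hs => by
      have h1 := ha s hs
      have h2 : v s a - v s a₀ - (a - a₀) • (A s (k s) + b s) =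
          (v s a - v s a₀ - A s (x s a - x s a₀) - (a - a₀) • b s) +
            A s (x s a - x s a₀ - (a - a₀) • k s) := by
        simp only [map_sub, map_smul, smul_add]; abel
      rw [h2]
      refine (norm_add_le _ _).trans ?_
      have h3 := (A s).le_opNorm (x s a - x s a₀ - (a - a₀) • k s)
      have h4 : ‖A s‖ * ‖x s a - x s a₀ - (a - a₀) • k s‖ ≤
        M * ‖x s a - x s a₀ - (a - a₀) • k s‖ := by
        gcongr; exact hA s hs
      linarith) t ht
  refine h.trans (le_of_eq ?_)
  rw [Real.norm_eq_abs, hεdef]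
  field_simp

end ODE

/-! ### Functions of time and space -/

section SpaceTime

variable {E : Type*} [NormedAddCommGroup E] [NormedSpace ℝ E]

/-- The space-time domain `[0, ∞) × ℝ`. -/
abbrev spaceTime : Set (ℝ × ℝ) := Ici 0 ×ˢ univ

theorem uniqueDiffOn_spaceTime : UniqueDiffOn ℝ spaceTime :=
  (uniqueDiffOn_Ici 0).prod uniqueDiffOn_univ

/-- Mean value inequality for `f t` minus its linear part at the base point; joint continuity of
`fx` makes δ independent of t. -/
theorem exists_slice_estimate {f fx : ℝ → ℝ → E}
    (hx : ∀ t, 0 ≤ t → ∀ x, HasDerivAt (f t) (fx t x) x)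
    (cx : ContinuousOn (Function.uncurry fx) spaceTime) {t₀ x₀ : ℝ} (ht₀ : 0 ≤ t₀) {ε : ℝ}
    (hε : 0 < ε) :
    ∃ δ > 0, ∀ t, 0 ≤ t → |t - t₀| < δ → ∀ x y, |x - x₀| < δ → |y - x₀| < δ →
      ‖f t y - f t x - (y - x) • fx t₀ x₀‖ ≤ ε * |y - x| := by
  have h := cx (t₀, x₀) ⟨ht₀, trivial⟩
  obtain ⟨δ, hδ, hδ'⟩ := Metric.continuousWithinAt_iff.1 h ε hε
  refine ⟨δ, hδ, fun t ht htd x y hxd hyd => ?_⟩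
  have h2 := Convex.norm_image_sub_le_of_norm_hasDerivWithin_le (𝕜 := ℝ)
    (f := fun z => f t z - z • fx t₀ x₀) (f' := fun z => fx t z - (1 : ℝ) • fx t₀ x₀) (C := ε)
    (s := Metric.ball x₀ δ) (x := x) (y := y)
    (fun z _ => ((hx t ht z).sub ((hasDerivAt_id z).smul_const _)).hasDerivWithinAt)
    (fun z hz => by
      rw [one_smul, ← dist_eq_norm]
      refine (hδ' (x := (t, z)) ⟨ht, trivial⟩ ?_).le
      rw [Prod.dist_eq]
      exact max_lt (by simpa [Real.dist_eq] using htd) hz)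
    (convex_ball _ _) (by simpa [Real.dist_eq] using hxd) (by simpa [Real.dist_eq] using hyd)
  rw [Real.norm_eq_abs] at h2
  convert h2 using 2
  rw [sub_smul]; abel

/-- The increment is split at `(t, x₀)`. In space the expansion is uniform in t; in time only the
derivative at the base point enters, so continuity of one partial derivative suffices. -/
theorem hasFDerivWithinAt_of_partial {f ft fx : ℝ → ℝ → E}
    (ht : ∀ t, 0 ≤ t → ∀ x, HasDerivWithinAt (fun s => f s x) (ft t x) (Ici 0) t)
    (hx : ∀ t, 0 ≤ t → ∀ x, HasDerivAt (f t) (fx t x) x)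
    (cx : ContinuousOn (Function.uncurry fx) spaceTime) {p : ℝ × ℝ} (hp : p ∈ spaceTime) :
    HasFDerivWithinAt (Function.uncurry f)
      ((ContinuousLinearMap.fst ℝ ℝ ℝ).smulRight (ft p.1 p.2) +
        (ContinuousLinearMap.snd ℝ ℝ ℝ).smulRight (fx p.1 p.2)) spaceTime p := by
  obtain ⟨t₀, x₀⟩ := p
  have ht₀ : 0 ≤ t₀ := hp.1
  rw [hasFDerivWithinAt_iff_isLittleO, Asymptotics.isLittleO_iff]
  intro c hc
  obtain ⟨δ, hδ, hest⟩ := exists_slice_estimate hx cx (x₀ := x₀) ht₀ (half_pos hc)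
  have h1 := (hasDerivWithinAt_iff_isLittleO.1 (ht t₀ ht₀ x₀))
  have h2 := (Asymptotics.isLittleO_iff.1 h1) (half_pos hc)
  have h3 : Tendsto Prod.fst (𝓝[spaceTime] (t₀, x₀)) (𝓝[Ici 0] t₀) :=
    tendsto_nhdsWithin_iff.2 ⟨(continuous_fst.tendsto _).mono_left nhdsWithin_le_nhds,
      eventually_nhdsWithin_of_forall fun q hq => hq.1⟩
  filter_upwards [h3.eventually h2, self_mem_nhdsWithin,
    mem_nhdsWithin_of_mem_nhds (Metric.ball_mem_nhds (t₀, x₀) hδ)] with q hq hqS hqb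
  obtain ⟨t, x⟩ := q
  have hqd : dist (t, x) (t₀, x₀) < δ := hqb
  rw [Prod.dist_eq, max_lt_iff, Real.dist_eq, Real.dist_eq] at hqd
  have h4 := hest t hqS.1 hqd.1 x₀ x (by simpa using hδ) hqd.2
  have e : Function.uncurry f (t, x) - Function.uncurry f (t₀, x₀) -
      ((ContinuousLinearMap.fst ℝ ℝ ℝ).smulRight (ft t₀ x₀) +
        (ContinuousLinearMap.snd ℝ ℝ ℝ).smulRight (fx t₀ x₀)) ((t, x) - (t₀, x₀)) =
      (f t x - f t x₀ - (x - x₀) • fx t₀ x₀) + (f t x₀ - f t₀ x₀ - (t - t₀) • ft t₀ x₀) := by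
    simp [Function.uncurry]; abel
  rw [e]
  refine (norm_add_le _ _).trans ?_
  have h5 : |x - x₀| ≤ ‖((t, x) : ℝ × ℝ) - (t₀, x₀)‖ := by
    simp
  have h6 : |t - t₀| ≤ ‖((t, x) : ℝ × ℝ) - (t₀, x₀)‖ := by
    simp
  have h7 : ‖f t x₀ - f t₀ x₀ - (t - t₀) • ft t₀ x₀‖ ≤ c / 2 * |t - t₀| := by
    simpa using hq
  nlinarith

theorem contDiffOn_succ_of_partial {f ft fx : ℝ → ℝ → E} {n : ℕ}
    (ht : ∀ t, 0 ≤ t → ∀ x, HasDerivWithinAt (fun s => f s x) (ft t x) (Ici 0) t)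
    (hx : ∀ t, 0 ≤ t → ∀ x, HasDerivAt (f t) (fx t x) x)
    (ct : ContDiffOn ℝ n (Function.uncurry ft) spaceTime)
    (cx : ContDiffOn ℝ n (Function.uncurry fx) spaceTime) :
    ContDiffOn ℝ (n + 1 : ℕ) (Function.uncurry f) spaceTime := by
  push_cast
  refine (contDiffOn_succ_iff_hasFDerivWithinAt_of_uniqueDiffOn uniqueDiffOn_spaceTime).2
    ⟨by simp, _, ?_, fun p hp => hasFDerivWithinAt_of_partial ht hx cx.continuousOn hp⟩
  exact (contDiffOn_const.smulRight ct).add (contDiffOn_const.smulRight cx)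

/-- Only the spatial displacement along the path is differentiated, so f needs no time derivative.
Subtracting this from a derivative along the path will produce the time derivative at a fixed point.
-/
theorem hasDerivWithinAt_slice_path {f fx : ℝ → ℝ → E}
    (hx : ∀ t, 0 ≤ t → ∀ x, HasDerivAt (f t) (fx t x) x)
    (cx : ContinuousOn (Function.uncurry fx) spaceTime) {t : ℝ} (ht : 0 ≤ t) {X : ℝ → ℝ} {w : ℝ}
    (hX : HasDerivWithinAt X w (Ici 0) t) :
    HasDerivWithinAt (fun s => f s (X s) - f s (X t)) (w • fx t (X t)) (Ici 0) t := by
  rw [hasDerivWithinAt_iff_isLittleO, Asymptotics.isLittleO_iff]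
  intro c hc
  set ε := c / (2 * (|w| + 1)) with hεd
  have hε : 0 < ε := by positivity
  obtain ⟨δ, hδ, hest⟩ := exists_slice_estimate hx cx (x₀ := X t) ht hε
  set ε' := min 1 (c / (2 * (‖fx t (X t)‖ + 1))) with hε'd
  have hε' : 0 < ε' := by positivity
  have h1 := Asymptotics.isLittleO_iff.1 (hasDerivWithinAt_iff_isLittleO.1 hX) hε'
  have h2 : ∀ᶠ s in 𝓝[Ici 0] t, X s ∈ Metric.ball (X t) δ :=
    hX.continuousWithinAt.eventually (Metric.ball_mem_nhds _ hδ)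
  filter_upwards [h1, h2, self_mem_nhdsWithin,
    mem_nhdsWithin_of_mem_nhds (Metric.ball_mem_nhds t hδ)] with s hs hsX hs0 hsb
  have h3 := hest s hs0 hsb (X t) (X s) (by simpa using hδ) hsX
  have h4 : |X s - X t - (s - t) * w| ≤ ε' * |s - t| := by simpa using hs
  have h5 : |X s - X t| ≤ (|w| + 1) * |s - t| := by
    have h6 : |X s - X t| ≤ |X s - X t - (s - t) * w| + |(s - t) * w| := by
      simpa using abs_add_le (X s - X t - (s - t) * w) ((s - t) * w)
    rw [abs_mul] at h6
    have h7 : ε' * |s - t| ≤ 1 * |s - t| := by gcongr; exact min_le_left _ _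
    linarith
  have e : f s (X s) - f s (X t) - (f t (X t) - f t (X t)) - (s - t) • w • fx t (X t) =
      (f s (X s) - f s (X t) - (X s - X t) • fx t (X t)) +
        (X s - X t - (s - t) * w) • fx t (X t) := by
    rw [sub_smul (X s - X t), mul_smul]; simp
  rw [e]
  refine (norm_add_le _ _).trans ?_
  rw [norm_smul, Real.norm_eq_abs, Real.norm_eq_abs]
  have h8 : ε * |X s - X t| ≤ c / 2 * |s - t| := by
    calc _ ≤ ε * ((|w| + 1) * |s - t|) := by gcongr
      _ = c / 2 * |s - t| := by rw [hεd]; field_simp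
  have h9 : |X s - X t - (s - t) * w| * ‖fx t (X t)‖ ≤ c / 2 * |s - t| := by
    calc _ ≤ (c / (2 * (‖fx t (X t)‖ + 1)) * |s - t|) * (‖fx t (X t)‖ + 1) := by
          have := norm_nonneg (fx t (X t))
          have h10 : ε' * |s - t| ≤ c / (2 * (‖fx t (X t)‖ + 1)) * |s - t| := by
            gcongr; exact min_le_right _ _
          gcongr
          · linarith
          · linarith
      _ = c / 2 * |s - t| := by field_simp
  linarith

end SpaceTime

/-! ### Integrals over the torus -/

section Torus

variable {E : Type*} [NormedAddCommGroup E]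

theorem two_pi_pos : 0 < 2 * Real.pi := Real.two_pi_pos

theorem integral_torus_eq_intervalIntegral [NormedSpace ℝ E] (f : ℝ → E) :
    ∫ x, f x ∂torus = ∫ x in (0 : ℝ)..(2 * Real.pi), f x := by
  rw [intervalIntegral.integral_of_le two_pi_pos.le]

theorem integral_torus_eq_shift [NormedSpace ℝ E] {f : ℝ → E}
    (hf : Function.Periodic f (2 * Real.pi)) (c : ℝ) :
    ∫ x, f x ∂torus = ∫ x in c..(c + 2 * Real.pi), f x := by
  rw [integral_torus_eq_intervalIntegral]
  simpa using hf.intervalIntegral_add_eq 0 c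

theorem integrable_torus_iff {f : ℝ → E} :
    Integrable f torus ↔ IntervalIntegrable f volume 0 (2 * Real.pi) := by
  rw [intervalIntegrable_iff_integrableOn_Ioc_of_le two_pi_pos.le, IntegrableOn]

theorem integrable_torus_of_continuousOn {f : ℝ → E} (hf : ContinuousOn f (Icc 0 (2 * Real.pi))) :
    Integrable f torus := by
  rw [integrable_torus_iff]
  exact ContinuousOn.intervalIntegrable (by rwa [uIcc_of_le two_pi_pos.le])

theorem integrable_continuousOn_mul {w r : ℝ → ℝ} (hw : ContinuousOn w (Icc 0 (2 * Real.pi)))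
    (hr : Integrable r torus) : Integrable (fun x => w x * r x) torus := by
  have h : IntegrableOn r (Icc 0 (2 * Real.pi)) := (integrableOn_Icc_iff_integrableOn_Ioc).2 hr
  exact (h.continuousOn_mul hw isCompact_Icc).mono_set Ioc_subset_Icc_self

/-- The exceptional set is the countable union of translates of its part in one period. -/
theorem ae_torus_iff {p : ℝ → Prop} (hp : ∀ x, p (x + 2 * Real.pi) ↔ p x) :
    (∀ᵐ x ∂torus, p x) ↔ ∀ᵐ x, p x := by
  refine ⟨fun h => ?_, fun h => ae_restrict_of_ae h⟩
  have hz : ∀ (n : ℤ) x, p (x + n • (2 * Real.pi)) ↔ p x := by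
    intro n x
    have : Function.Periodic p (2 * Real.pi) := fun y => propext (hp y)
    rw [this.zsmul n x]
  have h1 : ∀ n : ℤ, volume ({x | ¬ p x} ∩ Ioc (n • (2 * Real.pi)) ((n + 1) • (2 * Real.pi))) = 0 := by
    intro n
    have h2 : volume ({x | ¬ p x} ∩ Ioc 0 (2 * Real.pi)) = 0 := by
      have := (ae_restrict_iff' measurableSet_Ioc).1 h
      rw [ae_iff] at this
      convert this using 2
      ext x; simp; tauto
    have h3 := measure_preimage_add_right volume (-(n • (2 * Real.pi)))
      ({x | ¬ p x} ∩ Ioc 0 (2 * Real.pi))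
    rw [h2] at h3
    rw [← h3]
    congr 1
    ext x
    have := hz n (x + -(n • (2 * Real.pi)))
    rw [neg_add_cancel_right] at this
    simp only [mem_inter_iff, mem_ofPred_eq, mem_Ioc, mem_preimage, add_smul, one_smul, this]
    constructor
    · rintro ⟨a, b, c⟩; exact ⟨a, by linarith, by linarith⟩
    · rintro ⟨a, b, c⟩; exact ⟨a, by linarith, by linarith⟩
  rw [ae_iff]
  have h4 : {x | ¬ p x} =
      ⋃ n : ℤ, {x | ¬ p x} ∩ Ioc (n • (2 * Real.pi)) ((n + 1) • (2 * Real.pi)) := by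
    rw [← inter_iUnion, iUnion_Ioc_zsmul two_pi_pos, inter_univ]
  rw [h4]
  exact measure_iUnion_null h1

end Torus

/-! ### The primitive of the kernel -/

/-- The primitive of the kernel that vanishes at the origin. -/
def prim (φ : ℝ → ℝ) (z : ℝ) : ℝ := ∫ s in (0 : ℝ)..z, φ s

/-- The potential at `x` of the mass `ρ₀`, the particle labelled `b` sitting at `Z b`. -/
def potential (φ ρ₀ Z : ℝ → ℝ) (x : ℝ) : ℝ := ∫ b, prim φ (x - Z b) * ρ₀ b ∂torus

/-- Subcritical data in normal form: everywhere defined bounded representatives, with `e₀` the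
derivative of `u₀ + prim φ * ρ₀`. -/
structure NormalData (φ ρ₀ u₀ e₀ : ℝ → ℝ) (K : ℝ) : Prop where
  kernel_measurable : Measurable φ
  kernel_periodic : IsPeriodic φ
  kernel_le : ∀ z, |φ z| ≤ K
  density_measurable : Measurable ρ₀
  density_periodic : IsPeriodic ρ₀
  density_nonneg : ∀ x, 0 ≤ ρ₀ x
  density_integrable : Integrable ρ₀ torus
  velocity_continuous : Continuous u₀
  velocity_periodic : IsPeriodic u₀
  slope_measurable : Measurable e₀
  slope_periodic : IsPeriodic e₀
  slope_nonneg : ∀ x, 0 ≤ e₀ x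
  slope_le : ∀ x, e₀ x ≤ K
  slope_eq : ∀ a b, (u₀ b + potential φ ρ₀ id b) - (u₀ a + potential φ ρ₀ id a) =
    ∫ x in a..b, e₀ x

theorem intervalIntegrable_of_measurable_of_le {f : ℝ → ℝ} {K : ℝ} (hf : Measurable f)
    (hK : ∀ z, |f z| ≤ K) (a b : ℝ) : IntervalIntegrable f volume a b := by
  rw [intervalIntegrable_iff]
  exact Measure.integrableOn_of_bounded (M := K) (by simp) hf.aestronglyMeasurable
    (Eventually.of_forall fun x => by simpa using hK x)

theorem prim_sub_prim {φ : ℝ → ℝ} (hφ : ∀ a b, IntervalIntegrable φ volume a b) (x y : ℝ) :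
    prim φ y - prim φ x = ∫ s in x..y, φ s :=
  intervalIntegral.integral_interval_sub_left (hφ _ _) (hφ _ _)

namespace NormalData

variable {φ ρ₀ u₀ e₀ : ℝ → ℝ} {K : ℝ} (D : NormalData φ ρ₀ u₀ e₀ K)

include D

theorem K_nonneg : 0 ≤ K := (abs_nonneg _).trans (D.kernel_le 0)

theorem kernel_intervalIntegrable (a b : ℝ) : IntervalIntegrable φ volume a b :=
  intervalIntegrable_of_measurable_of_le D.kernel_measurable D.kernel_le a b

theorem slope_intervalIntegrable (a b : ℝ) : IntervalIntegrable e₀ volume a b :=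
  intervalIntegrable_of_measurable_of_le D.slope_measurable
    (fun z => by rw [abs_of_nonneg (D.slope_nonneg z)]; exact D.slope_le z) a b

theorem abs_prim_sub_le (x y : ℝ) : |prim φ y - prim φ x| ≤ K * |y - x| := by
  rw [prim_sub_prim D.kernel_intervalIntegrable]
  exact intervalIntegral.norm_integral_le_of_norm_le_const (f := φ) fun z _ => D.kernel_le z

theorem continuous_prim : Continuous (prim φ) :=
  intervalIntegral.continuous_primitive D.kernel_intervalIntegrable 0

/-- The primitive is not periodic when φ has nonzero mean; its constant increment over a period will
cancel between the two potentials in `configVel`. -/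
theorem prim_add_two_pi (x : ℝ) : prim φ (x + 2 * Real.pi) = prim φ x + prim φ (2 * Real.pi) := by
  have h := prim_sub_prim D.kernel_intervalIntegrable x (x + 2 * Real.pi)
  rw [D.kernel_periodic.intervalIntegral_add_eq x 0, zero_add] at h
  unfold prim at *
  linarith

theorem mass_nonneg : 0 ≤ ∫ b, ρ₀ b ∂torus := integral_nonneg D.density_nonneg

theorem integrable_prim_mul {Z : ℝ → ℝ} (hZ : Continuous Z) (x : ℝ) :
    Integrable (fun b => prim φ (x - Z b) * ρ₀ b) torus :=
  integrable_continuousOn_mul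
    (D.continuous_prim.comp (continuous_const.sub hZ)).continuousOn D.density_integrable

/-- `prim φ` is K-Lipschitz, and only relative positions matter. This allows unbounded
configurations whose relative displacements are bounded. -/
theorem abs_potential_sub_le {Z Z' : ℝ → ℝ} (hZ : Continuous Z) (hZ' : Continuous Z') {x y c : ℝ}
    (hc : ∀ b, |(x - Z b) - (y - Z' b)| ≤ c) :
    |potential φ ρ₀ Z x - potential φ ρ₀ Z' y| ≤ K * c * ∫ b, ρ₀ b ∂torus := by
  unfold potential
  rw [← integral_sub (D.integrable_prim_mul hZ x) (D.integrable_prim_mul hZ' y),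
    ← integral_const_mul, ← Real.norm_eq_abs]
  refine norm_integral_le_of_norm_le (D.density_integrable.const_mul _)
    (Eventually.of_forall fun b => ?_)
  rw [← sub_mul, norm_mul, Real.norm_eq_abs, Real.norm_eq_abs, abs_of_nonneg (D.density_nonneg b)]
  have := D.abs_prim_sub_le (y - Z' b) (x - Z b)
  have h2 := mul_le_mul_of_nonneg_left (hc b) D.K_nonneg
  exact mul_le_mul_of_nonneg_right (this.trans h2) (D.density_nonneg b)

theorem abs_potential_sub_le_mul {Z : ℝ → ℝ} (hZ : Continuous Z) (x y : ℝ) :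
    |potential φ ρ₀ Z x - potential φ ρ₀ Z y| ≤ K * (∫ b, ρ₀ b ∂torus) * |x - y| := by
  have := D.abs_potential_sub_le hZ hZ (x := x) (y := y) (c := |x - y|) (fun b => by
    rw [sub_sub_sub_cancel_right])
  linarith

theorem potential_add_two_pi {Z : ℝ → ℝ} (hZ : Continuous Z) (x : ℝ) :
    potential φ ρ₀ Z (x + 2 * Real.pi) =
      potential φ ρ₀ Z x + prim φ (2 * Real.pi) * ∫ b, ρ₀ b ∂torus := by
  unfold potential
  rw [← integral_const_mul, ← integral_add (D.integrable_prim_mul hZ x)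
    (D.density_integrable.const_mul _)]
  congr 1 with b
  rw [add_sub_right_comm, D.prim_add_two_pi, add_mul]

end NormalData

/-! ### The flow -/

/-- The velocity of the particle labelled `a`, as a function of the configuration `Z`. -/
def configVel (φ ρ₀ u₀ Z : ℝ → ℝ) (a : ℝ) : ℝ :=
  u₀ a + potential φ ρ₀ id a - potential φ ρ₀ Z (Z a)

/-- The flow of characteristics, written as a first order equation. -/
structure IsFlow (φ ρ₀ u₀ : ℝ → ℝ) (X : ℝ → ℝ → ℝ) : Prop where
  init : ∀ a, X 0 a = a
  cont : Continuous (Function.uncurry X)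
  hasDerivAt : ∀ t a, HasDerivAt (fun s => X s a) (configVel φ ρ₀ u₀ (X t) a) t

namespace NormalData

variable {φ ρ₀ u₀ e₀ : ℝ → ℝ} {K : ℝ} (D : NormalData φ ρ₀ u₀ e₀ K)

include D

theorem continuous_potential {Z : ℝ → ℝ} (hZ : Continuous Z) :
    Continuous (potential φ ρ₀ Z) := by
  have : LipschitzWith (K * ∫ b, ρ₀ b ∂torus).toNNReal (potential φ ρ₀ Z) :=
    LipschitzWith.of_dist_le_mul fun x y => by
      rw [Real.coe_toNNReal _ (mul_nonneg D.K_nonneg D.mass_nonneg)]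
      exact D.abs_potential_sub_le_mul hZ x y
  exact this.continuous

theorem continuous_configVel {Z : ℝ → ℝ} (hZ : Continuous Z) :
    Continuous (configVel φ ρ₀ u₀ Z) :=
  (D.velocity_continuous.add (D.continuous_potential continuous_id)).sub
    ((D.continuous_potential hZ).comp hZ)

theorem exists_velocity_bound : ∃ M, ∀ x, |u₀ x| ≤ M := by
  obtain ⟨M, hM⟩ := isCompact_Icc.exists_bound_of_continuousOn (s := Icc 0 (2 * Real.pi))
    D.velocity_continuous.continuousOn
  refine ⟨M, fun x => ?_⟩
  obtain ⟨y, hy, hxy⟩ := D.velocity_periodic.exists_mem_Ico₀ two_pi_pos x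
  rw [hxy]
  exact hM y ⟨hy.1, hy.2.le⟩

/-- The unknown is the displacement `ξ = X - id`, which is bounded and continuous although X is not
bounded. The field is Lipschitz in ξ with constant `2 K m`, the factor 2 coming from the
displacements of the observer and of the source. -/
theorem exists_flow : ∃ X, IsFlow φ ρ₀ u₀ X := by
  obtain ⟨M, hM⟩ := D.exists_velocity_bound
  have hK := D.K_nonneg
  have hm := D.mass_nonneg
  set m := ∫ b, ρ₀ b ∂torus with hmd
  have hbd : ∀ (ξ : BoundedContinuousFunction ℝ ℝ) (a : ℝ),
      ‖configVel φ ρ₀ u₀ (fun b => b + ξ b) a‖ ≤ M + K * (2 * ‖ξ‖) * m := by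
    intro ξ a
    -- The labels cancel in the relative positions; only `ξ b - ξ a` is left, of size at most
    -- `2‖ξ‖`.
    have h1 := D.abs_potential_sub_le (Z := id) (Z' := fun b => b + ξ b) continuous_id
      (by fun_prop) (x := a) (y := a + ξ a) (c := 2 * ‖ξ‖) (fun b => by
        have e : a - id b - (a + ξ a - (b + ξ b)) = ξ b - ξ a := by simp only [id]; ring
        rw [e]
        have h2 := ξ.norm_coe_le_norm a
        have h3 := ξ.norm_coe_le_norm b
        rw [Real.norm_eq_abs] at h2 h3
        have := abs_sub (ξ b) (ξ a)
        linarith)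
    have h4 := hM a
    unfold configVel
    rw [Real.norm_eq_abs, add_sub_assoc]
    exact (abs_add_le _ _).trans (add_le_add h4 h1)
  let N : BoundedContinuousFunction ℝ ℝ → BoundedContinuousFunction ℝ ℝ := fun ξ =>
    BoundedContinuousFunction.ofNormedAddCommGroup (configVel φ ρ₀ u₀ (fun b => b + ξ b))
      (D.continuous_configVel (by fun_prop)) _ (hbd ξ)
  have hN : ∀ ξ η, ‖N ξ - N η‖ ≤ 2 * K * m * ‖ξ - η‖ := by
    intro ξ η
    refine (BoundedContinuousFunction.norm_le (by positivity)).2 fun a => ?_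
    change ‖configVel φ ρ₀ u₀ (fun b => b + ξ b) a - configVel φ ρ₀ u₀ (fun b => b + η b) a‖ ≤ _
    have h1 := D.abs_potential_sub_le (Z := fun b => b + ξ b) (Z' := fun b => b + η b)
      (by fun_prop) (by fun_prop) (x := a + ξ a) (y := a + η a) (c := 2 * ‖ξ - η‖) (fun b => by
        have e : a + ξ a - (b + ξ b) - (a + η a - (b + η b)) = (ξ - η) a - (ξ - η) b := by
          simp; ring
        rw [e]
        have h2 := (ξ - η).norm_coe_le_norm a
        have h3 := (ξ - η).norm_coe_le_norm b
        rw [Real.norm_eq_abs] at h2 h3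
        have := abs_sub ((ξ - η) a) ((ξ - η) b)
        linarith)
    unfold configVel
    rw [sub_sub_sub_cancel_left, Real.norm_eq_abs, abs_sub_comm]
    linarith
  have hNc : Continuous N := by
    have : LipschitzWith (2 * K * m).toNNReal N := LipschitzWith.of_dist_le_mul fun x y => by
      rw [Real.coe_toNNReal _ (by positivity), dist_eq_norm, dist_eq_norm]
      exact hN x y
    exact this.continuous
  obtain ⟨ξ, hξ0, hξ⟩ := exists_forall_hasDerivAt_of_lipschitz (fun _ => N)
    (hNc.comp continuous_snd) (K := 2 * K * m) (by positivity) (fun _ => hN) (B := ‖N 0‖)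
    (fun _ => le_rfl) 0
  have hξc : Continuous ξ := continuous_iff_continuousAt.2 fun t => (hξ t).continuousAt
  refine ⟨fun t a => a + ξ t a, fun a => by simp [hξ0], ?_, fun t a => ?_⟩
  · have h : Continuous fun p : ℝ × ℝ => ξ p.1 p.2 := by fun_prop
    exact continuous_snd.add h
  · have h := ((BoundedContinuousFunction.evalCLM ℝ a).hasFDerivAt.comp_hasDerivAt t (hξ t))
    exact h.const_add a

end NormalData

/-! ### Absence of collisions, bi-Lipschitz bounds and periodicity of the flow -/

namespace IsFlow

variable {φ ρ₀ u₀ e₀ : ℝ → ℝ} {K : ℝ} {X : ℝ → ℝ → ℝ} (hX : IsFlow φ ρ₀ u₀ X)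

include hX

theorem continuous_slice (t : ℝ) : Continuous (X t) :=
  hX.cont.comp (continuous_const.prodMk continuous_id)

theorem continuous_path (a : ℝ) : Continuous fun t => X t a :=
  hX.cont.comp (continuous_id.prodMk continuous_const)

variable (D : NormalData φ ρ₀ u₀ e₀ K)

include D

/-- The term `u₀ + prim φ * ρ₀` in the velocity is nondecreasing in the label, so only the
κ-Lipschitz potential can bring particles together, at rate at most κ. The rate `κ + 1` gives the
strict inequality that the comparison principle needs at a first contact. -/
theorem lower_bound {t : ℝ} (ht : 0 ≤ t) {a b : ℝ} (hab : a ≤ b) :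
    Real.exp (-((K * (∫ x, ρ₀ x ∂torus) + 1) * t)) * (b - a) ≤ X t b - X t a := by
  rcases hab.eq_or_lt with rfl | hab
  · simp
  have hK := D.K_nonneg
  have hm := D.mass_nonneg
  set κ := K * ∫ x, ρ₀ x ∂torus with hκ
  have hκ0 : 0 ≤ κ := by positivity
  have h := image_le_of_deriv_right_lt_deriv_boundary (a := 0) (b := t)
    (f := fun s => X s a - X s b)
    (f' := fun s => configVel φ ρ₀ u₀ (X s) a - configVel φ ρ₀ u₀ (X s) b)
    (B := fun s => -(Real.exp (-((κ + 1) * s)) * (b - a)))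
    (B' := fun s => (κ + 1) * (Real.exp (-((κ + 1) * s)) * (b - a)))
    ((hX.continuous_path a).sub (hX.continuous_path b)).continuousOn
    (fun s _ => ((hX.hasDerivAt s a).sub (hX.hasDerivAt s b)).hasDerivWithinAt)
    (by simp [hX.init])
    (fun s => by
      have h := (((((hasDerivAt_id s).const_mul (κ + 1)).neg).exp).mul_const (b - a)).neg
      refine h.congr_deriv ?_
      simp only [id, Pi.neg_apply]
      ring)
    (fun s _ hs => by
      have h1 := D.abs_potential_sub_le_mul (hX.continuous_slice s) (X s a) (X s b)
      rw [hs, ← hκ, abs_neg, abs_mul, Real.abs_exp, abs_of_pos (sub_pos.2 hab)] at h1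
      have h2 := D.slope_eq a b
      have h3 : 0 ≤ ∫ x in a..b, e₀ x :=
        intervalIntegral.integral_nonneg hab.le fun x _ => D.slope_nonneg x
      have h4 : 0 < Real.exp (-((κ + 1) * s)) * (b - a) :=
        mul_pos (Real.exp_pos _) (sub_pos.2 hab)
      have h5 := neg_abs_le (potential φ ρ₀ (X s) (X s a) - potential φ ρ₀ (X s) (X s b))
      unfold configVel
      linarith) ⟨ht, le_rfl⟩
  linarith

theorem strictMono {t : ℝ} (ht : 0 ≤ t) : StrictMono (X t) := fun a b hab => by
  have h := hX.lower_bound D ht hab.le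
  have := mul_pos (Real.exp_pos (-((K * (∫ x, ρ₀ x ∂torus) + 1) * t))) (sub_pos.2 hab)
  linarith

/-- The same comparison from above: the initial slope adds at most `K (b - a)`, which is absorbed
because the barrier never falls below `b - a`. -/
theorem upper_bound {t : ℝ} (ht : 0 ≤ t) {a b : ℝ} (hab : a ≤ b) :
    X t b - X t a ≤ Real.exp ((K * (∫ x, ρ₀ x ∂torus) + K + 1) * t) * (b - a) := by
  rcases hab.eq_or_lt with rfl | hab
  · simp
  have hK := D.K_nonneg
  have hm := D.mass_nonneg
  set κ := K * ∫ x, ρ₀ x ∂torus with hκ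
  have hκ0 : 0 ≤ κ := by positivity
  have h := image_le_of_deriv_right_lt_deriv_boundary (a := 0) (b := t)
    (f := fun s => X s b - X s a)
    (f' := fun s => configVel φ ρ₀ u₀ (X s) b - configVel φ ρ₀ u₀ (X s) a)
    (B := fun s => Real.exp ((κ + K + 1) * s) * (b - a))
    (B' := fun s => (κ + K + 1) * (Real.exp ((κ + K + 1) * s) * (b - a)))
    ((hX.continuous_path b).sub (hX.continuous_path a)).continuousOn
    (fun s _ => ((hX.hasDerivAt s b).sub (hX.hasDerivAt s a)).hasDerivWithinAt)
    (by simp [hX.init])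
    (fun s => by
      have h := (((((hasDerivAt_id s).const_mul (κ + K + 1))).exp).mul_const (b - a))
      refine h.congr_deriv ?_
      simp only [id]
      ring)
    (fun s hs0 hs => by
      have h1 := D.abs_potential_sub_le_mul (hX.continuous_slice s) (X s b) (X s a)
      have hba := sub_pos.2 hab
      rw [hs, ← hκ, abs_mul, Real.abs_exp, abs_of_pos hba] at h1
      have h2 := D.slope_eq a b
      have h3 : ∫ x in a..b, e₀ x ≤ K * (b - a) := by
        have := intervalIntegral.integral_mono_on hab.le (D.slope_intervalIntegrable a b)
          (g := fun _ => K) (by simp) (fun x _ => D.slope_le x)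
        simp at this
        linarith
      have h4 : 1 ≤ Real.exp ((κ + K + 1) * s) := Real.one_le_exp (by
        have := hs0.1
        positivity)
      have h5 := neg_abs_le (potential φ ρ₀ (X s) (X s b) - potential φ ρ₀ (X s) (X s a))
      have h6 : K * (b - a) ≤ K * (Real.exp ((κ + K + 1) * s) * (b - a)) := by
        gcongr
        nlinarith
      have h7 : 0 < Real.exp ((κ + K + 1) * s) * (b - a) := by positivity
      unfold configVel
      linarith) ⟨ht, le_rfl⟩
  simpa using h

/-- Uniqueness: the defect vanishes at time 0 and obeys a Grönwall inequality without source, since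
the increments of the two potentials over a period cancel. -/
theorem shift {t : ℝ} (ht : 0 ≤ t) (a : ℝ) : X t (a + 2 * Real.pi) = X t a + 2 * Real.pi := by
  have hK := D.K_nonneg
  have hm := D.mass_nonneg
  have h := norm_le_exp_of_norm_derivWithin_le (E := ℝ) (T := t)
    (f := fun s => X s (a + 2 * Real.pi) - (X s a + 2 * Real.pi))
    (f' := fun s => configVel φ ρ₀ u₀ (X s) (a + 2 * Real.pi) - configVel φ ρ₀ u₀ (X s) a)
    (δ := 0) (K := K * ∫ x, ρ₀ x ∂torus) (ε := 0) (by positivity) le_rfl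
    (fun s _ => ((hX.hasDerivAt s (a + 2 * Real.pi)).sub
      ((hX.hasDerivAt s a).add_const _)).hasDerivWithinAt)
    (by simp [hX.init])
    (fun s _ => by
      have h1 := D.abs_potential_sub_le_mul (hX.continuous_slice s)
        (X s (a + 2 * Real.pi)) (X s a + 2 * Real.pi)
      rw [D.potential_add_two_pi (hX.continuous_slice s)] at h1
      unfold configVel
      rw [D.velocity_periodic a, D.potential_add_two_pi continuous_id, Real.norm_eq_abs,
        Real.norm_eq_abs, add_zero, ← abs_neg]
      refine le_trans (le_of_eq ?_) h1
      congr 1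
      ring) t ⟨ht, le_rfl⟩
  simp only [zero_mul, add_zero, norm_le_zero_iff, sub_eq_zero] at h
  exact h

theorem tendsto_atTop {t : ℝ} (ht : 0 ≤ t) : Tendsto (X t) atTop atTop := by
  have h1 : Tendsto (fun a => Real.exp (-((K * (∫ x, ρ₀ x ∂torus) + 1) * t)) * a + X t 0)
      atTop atTop :=
    tendsto_atTop_add_const_right _ _ (tendsto_id.const_mul_atTop (Real.exp_pos _))
  refine tendsto_atTop_mono' _ ?_ h1
  filter_upwards [eventually_ge_atTop 0] with a ha
  have := hX.lower_bound D ht ha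
  rw [sub_zero] at this
  linarith

theorem tendsto_atBot {t : ℝ} (ht : 0 ≤ t) : Tendsto (X t) atBot atBot := by
  have h1 : Tendsto (fun a => Real.exp (-((K * (∫ x, ρ₀ x ∂torus) + 1) * t)) * a + X t 0)
      atBot atBot :=
    tendsto_atBot_add_const_right _ _ (tendsto_id.const_mul_atBot (Real.exp_pos _))
  refine tendsto_atBot_mono' _ ?_ h1
  filter_upwards [eventually_le_atBot 0] with a ha
  have := hX.lower_bound D ht ha
  rw [zero_sub] at this
  linarith

theorem surjective {t : ℝ} (ht : 0 ≤ t) : Function.Surjective (X t) :=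
  (hX.continuous_slice t).surjective (hX.tendsto_atTop D ht) (hX.tendsto_atBot D ht)

end IsFlow

/-! ### Parametric integrals -/

section Parametric

variable {E : Type*} [NormedAddCommGroup E] [NormedSpace ℝ E]

theorem integrable_smul_continuousOn {r : ℝ → ℝ} {w : ℝ → E} (hr : Integrable r torus)
    (hw : ContinuousOn w (Icc 0 (2 * Real.pi))) : Integrable (fun x => r x • w x) torus := by
  have h : IntegrableOn r (Icc 0 (2 * Real.pi)) := (integrableOn_Icc_iff_integrableOn_Ioc).2 hr
  exact (h.smul_continuousOn hw isCompact_Icc).mono_set Ioc_subset_Icc_self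

/-- Compactness of the period makes `F` vary uniformly in b near each parameter, so an integrable
weight suffices and no dominating function is needed. -/
theorem continuousOn_integral_smul {P : Type*} [TopologicalSpace P] {S : Set P} {r : ℝ → ℝ}
    (hr : Integrable r torus) {F : P → ℝ → E}
    (hF : ContinuousOn (Function.uncurry F) (S ×ˢ Icc 0 (2 * Real.pi))) :
    ContinuousOn (fun p => ∫ b, r b • F p b ∂torus) S := by
  intro p hp
  rw [Metric.continuousWithinAt_iff']
  intro ε hε
  have hC : 0 ≤ ∫ b, |r b| ∂torus := integral_nonneg fun _ => abs_nonneg _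
  set C := ∫ b, |r b| ∂torus with hCd
  have hint : ∀ q ∈ S, Integrable (fun b => r b • F q b) torus := fun q hq =>
    integrable_smul_continuousOn hr (hF.comp (f := fun b => (q, b)) (by fun_prop) fun b hb => ⟨hq, hb⟩)
  obtain ⟨v, hv, hvF⟩ := isCompact_Icc.mem_uniformity_of_prod hF hp
    (Metric.dist_mem_uniformity (show 0 < ε / (C + 1) by positivity))
  filter_upwards [hv, self_mem_nhdsWithin] with q hq hqS
  rw [dist_eq_norm, ← integral_sub (hint q hqS) (hint p hp)]
  have h1 : ‖∫ b, (r b • F q b - r b • F p b) ∂torus‖ ≤ ∫ b, |r b| * (ε / (C + 1)) ∂torus := by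
    refine norm_integral_le_of_norm_le (hr.abs.mul_const _) ?_
    refine (ae_restrict_iff' measurableSet_Ioc).2 (Eventually.of_forall fun b hb => ?_)
    rw [← smul_sub, norm_smul, Real.norm_eq_abs, ← dist_eq_norm]
    gcongr
    exact le_of_lt (hvF q hq b ⟨hb.1.le, hb.2⟩)
  rw [integral_mul_const, ← hCd] at h1
  refine h1.trans_lt ?_
  have : C * (ε / (C + 1)) = ε * (C / (C + 1)) := by ring
  rw [this]
  have h2 : C / (C + 1) < 1 := (div_lt_one (by linarith)).2 (by linarith)
  nlinarith

/-- The integrand is frozen at its initial value for negative times, which makes it continuous on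
the line and leaves the integrals from 0 to `t ≥ 0` unchanged. -/
theorem hasDerivWithinAt_integral_Ici {w : ℝ → E} [CompleteSpace E] (hw : ContinuousOn w (Ici 0))
    {t : ℝ} (ht : 0 ≤ t) :
    HasDerivWithinAt (fun t => ∫ s in (0 : ℝ)..t, w s) (w t) (Ici 0) t := by
  have hc : Continuous fun s => w (max s 0) :=
    hw.comp_continuous (by fun_prop) fun s => mem_Ici.2 (le_max_right _ _)
  have h := (hc.integral_hasStrictDerivAt 0 t).hasDerivAt.hasDerivWithinAt (s := Ici 0)
  simp only [max_eq_left ht] at h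
  refine h.congr_of_mem (fun r hr => ?_) ht
  refine intervalIntegral.integral_congr fun s hs => ?_
  rw [uIcc_of_le hr] at hs
  simp only [max_eq_left hs.1]

theorem continuousOn_integral_spaceTime {w : ℝ → ℝ → E}
    (hw : ContinuousOn (Function.uncurry w) spaceTime) :
    ContinuousOn (fun p : ℝ × ℝ => ∫ s in (0 : ℝ)..p.1, w s p.2) spaceTime := by
  have hc : Continuous (Function.uncurry fun (a s : ℝ) => w (max s 0) a) :=
    hw.comp_continuous (f := fun q : ℝ × ℝ => (max q.2 0, q.1)) (by fun_prop)
      fun q => ⟨mem_Ici.2 (le_max_right _ _), trivial⟩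
  have h := intervalIntegral.continuous_parametric_primitive_of_continuous (μ := volume)
    (a₀ := 0) hc
  have h2 : Continuous fun p : ℝ × ℝ => ∫ s in (0 : ℝ)..p.1, w (max s 0) p.2 :=
    h.comp continuous_swap
  refine h2.continuousOn.congr fun p hp => ?_
  refine intervalIntegral.integral_congr fun s hs => ?_
  rw [uIcc_of_le hp.1] at hs
  simp only [max_eq_left hs.1]

omit [NormedSpace ℝ E] in
theorem continuousOn_slice_right {w : ℝ → ℝ → E}
    (hw : ContinuousOn (Function.uncurry w) spaceTime) {t : ℝ} (ht : 0 ≤ t) :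
    Continuous (w t) :=
  hw.comp_continuous (f := fun x => (t, x)) (by fun_prop) fun _ => ⟨ht, trivial⟩

omit [NormedSpace ℝ E] in
theorem continuousOn_slice_left {w : ℝ → ℝ → E}
    (hw : ContinuousOn (Function.uncurry w) spaceTime) (a : ℝ) :
    ContinuousOn (fun t => w t a) (Ici 0) :=
  hw.comp (f := fun t => (t, a)) (by fun_prop) fun _ ht => ⟨ht, trivial⟩

omit [NormedSpace ℝ E] in
theorem exists_bound_spaceTime {w : ℝ → ℝ → E}
    (hw : ContinuousOn (Function.uncurry w) spaceTime) (T a b : ℝ) :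
    ∃ M, 0 ≤ M ∧ ∀ t ∈ Icc 0 T, ∀ x ∈ Icc a b, ‖w t x‖ ≤ M := by
  obtain ⟨M, hM⟩ := (isCompact_Icc.prod isCompact_Icc).exists_bound_of_continuousOn
    (s := Icc 0 T ×ˢ Icc a b) (hw.mono fun p hp => ⟨hp.1.1, trivial⟩)
  exact ⟨max M 0, le_max_right _ _, fun t ht x hx => (hM (t, x) ⟨ht, hx⟩).trans (le_max_left _ _)⟩

end Parametric

/-! ### Approximation of the kernel -/

/-- Steklov averages of the kernel. -/
def steklov (φ : ℝ → ℝ) (n : ℕ) (z : ℝ) : ℝ :=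
  ((n : ℝ) + 1) * (prim φ (z + ((n : ℝ) + 1)⁻¹) - prim φ z)

namespace NormalData

variable {φ ρ₀ u₀ e₀ : ℝ → ℝ} {K : ℝ} (D : NormalData φ ρ₀ u₀ e₀ K)

include D

theorem continuous_steklov (n : ℕ) : Continuous (steklov φ n) := by
  have := D.continuous_prim
  unfold steklov
  fun_prop

theorem abs_steklov_le (n : ℕ) (z : ℝ) : |steklov φ n z| ≤ K := by
  have h := D.abs_prim_sub_le z (z + ((n : ℝ) + 1)⁻¹)
  have hn : (0 : ℝ) < (n : ℝ) + 1 := by positivity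
  rw [add_sub_cancel_left, abs_of_pos (inv_pos.2 hn)] at h
  unfold steklov
  rw [abs_mul, abs_of_pos hn]
  calc _ ≤ ((n : ℝ) + 1) * (K * ((n : ℝ) + 1)⁻¹) := by gcongr
    _ = K := by field_simp

theorem steklov_periodic (n : ℕ) : IsPeriodic (steklov φ n) := fun z => by
  unfold steklov
  rw [add_right_comm, D.prim_add_two_pi, D.prim_add_two_pi]
  ring

theorem kernel_locallyIntegrable : LocallyIntegrable φ volume :=
  (locallyIntegrable_const K).mono D.kernel_measurable.aestronglyMeasurable
    (Eventually.of_forall fun x => (D.kernel_le x).trans (le_abs_self K))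

theorem ae_tendsto_steklov : ∀ᵐ z, Tendsto (fun n => steklov φ n z) atTop (𝓝 (φ z)) := by
  filter_upwards [LocallyIntegrable.ae_hasDerivAt_integral D.kernel_locallyIntegrable] with z hz
  have h := (hasDerivAt_iff_tendsto_slope_zero.1 (hz 0))
  have h1 : Tendsto (fun n : ℕ => ((n : ℝ) + 1)⁻¹) atTop (𝓝[≠] 0) := by
    refine tendsto_nhdsWithin_iff.2 ⟨?_, Eventually.of_forall fun n => ?_⟩
    · simpa using tendsto_one_div_add_atTop_nhds_zero_nat (𝕜 := ℝ)
    · have : (0 : ℝ) < (n : ℝ) + 1 := by positivity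
      exact (inv_pos.2 this).ne'
  refine (h.comp h1).congr fun n => ?_
  simp [steklov, prim]

theorem integrable_steklov_sub (n : ℕ) : Integrable (fun z => |steklov φ n z - φ z|) torus :=
  ((integrable_torus_of_continuousOn (D.continuous_steklov n).continuousOn).sub
    (integrable_torus_iff.2 (D.kernel_intervalIntegrable _ _))).abs

theorem tendsto_integral_steklov :
    Tendsto (fun n => ∫ z, |steklov φ n z - φ z| ∂torus) atTop (𝓝 0) := by
  have h := tendsto_integral_of_dominated_convergence (μ := torus)
    (F := fun n z => |steklov φ n z - φ z|) (f := fun _ => 0) (fun _ => 2 * K)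
    (fun n => (D.integrable_steklov_sub n).aestronglyMeasurable) (integrable_const _)
    (fun n => Eventually.of_forall fun z => by
      rw [Real.norm_eq_abs, abs_abs]
      have := abs_sub (steklov φ n z) (φ z)
      linarith [D.abs_steklov_le n z, D.kernel_le z])
    (ae_restrict_of_ae <| D.ae_tendsto_steklov.mono fun z hz => by
      have := (hz.sub_const (φ z)).abs
      simpa using this)
  simpa using h

theorem tendsto_prim_steklov (z : ℝ) :
    Tendsto (fun n => prim (steklov φ n) z) atTop (𝓝 (prim φ z)) :=
  intervalIntegral.tendsto_integral_filter_of_dominated_convergence (fun _ => K)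
    (Eventually.of_forall fun n => (D.continuous_steklov n).aestronglyMeasurable)
    (Eventually.of_forall fun n => Eventually.of_forall fun z _ => D.abs_steklov_le n z)
    (by simp) (D.ae_tendsto_steklov.mono fun z hz _ => hz)

/-- Used to split an integrable density into a bounded part and a part of small mass. -/
theorem tendsto_density_tail :
    Tendsto (fun n : ℕ => ∫ b, max (ρ₀ b - n) 0 ∂torus) atTop (𝓝 0) := by
  have h := tendsto_integral_of_dominated_convergence (μ := torus)
    (F := fun (n : ℕ) b => max (ρ₀ b - n) 0) (f := fun _ => 0) ρ₀
    (fun n => ((D.density_measurable.sub_const _).max measurable_const).aestronglyMeasurable)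
    D.density_integrable
    (fun n => Eventually.of_forall fun b => by
      rw [Real.norm_eq_abs, abs_of_nonneg (le_max_right _ _)]
      refine max_le ?_ (D.density_nonneg b)
      have : (0 : ℝ) ≤ n := by positivity
      linarith)
    (Eventually.of_forall fun b => by
      refine tendsto_const_nhds.congr' ?_
      obtain ⟨N, hN⟩ := exists_nat_ge (ρ₀ b)
      filter_upwards [eventually_ge_atTop N] with n hn
      rw [max_eq_right]
      have : (N : ℝ) ≤ n := by exact_mod_cast hn
      linarith)
  simpa using h

end NormalData

/-! ### Image of Lebesgue measure under the flow, and uniform approximation of the kernel -/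

namespace IsFlow

variable {φ ρ₀ u₀ e₀ : ℝ → ℝ} {K : ℝ} {X : ℝ → ℝ → ℝ} (hX : IsFlow φ ρ₀ u₀ X)
  (D : NormalData φ ρ₀ u₀ e₀ K)

include hX D

theorem antilipschitz {t : ℝ} (ht : 0 ≤ t) :
    AntilipschitzWith (Real.exp ((K * (∫ x, ρ₀ x ∂torus) + 1) * t)).toNNReal (X t) := by
  refine AntilipschitzWith.of_le_mul_dist fun a b => ?_
  rw [Real.coe_toNNReal _ (Real.exp_pos _).le]
  have key : ∀ a b, a ≤ b → b - a ≤
      Real.exp ((K * (∫ x, ρ₀ x ∂torus) + 1) * t) * (X t b - X t a) := by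
    intro a b hab
    have h := hX.lower_bound D ht hab
    rw [Real.exp_neg] at h
    have hp := Real.exp_pos ((K * (∫ x, ρ₀ x ∂torus) + 1) * t)
    calc b - a = Real.exp ((K * (∫ x, ρ₀ x ∂torus) + 1) * t) *
          ((Real.exp ((K * (∫ x, ρ₀ x ∂torus) + 1) * t))⁻¹ * (b - a)) := by field_simp
      _ ≤ _ := by gcongr
  rw [Real.dist_eq, Real.dist_eq]
  rcases le_total a b with hab | hab
  · rw [abs_sub_comm a, abs_sub_comm (X t a), abs_of_nonneg (sub_nonneg.2 hab),
      abs_of_nonneg (sub_nonneg.2 ((hX.strictMono D ht).monotone hab))]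
    exact key a b hab
  · rw [abs_of_nonneg (sub_nonneg.2 hab),
      abs_of_nonneg (sub_nonneg.2 ((hX.strictMono D ht).monotone hab))]
    exact key b a hab

theorem lipschitz {t : ℝ} (ht : 0 ≤ t) :
    LipschitzWith (Real.exp ((K * (∫ x, ρ₀ x ∂torus) + K + 1) * t)).toNNReal (X t) := by
  refine LipschitzWith.of_dist_le_mul fun a b => ?_
  rw [Real.coe_toNNReal _ (Real.exp_pos _).le, Real.dist_eq, Real.dist_eq]
  rcases le_total a b with hab | hab
  · rw [abs_sub_comm a, abs_sub_comm (X t a), abs_of_nonneg (sub_nonneg.2 hab),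
      abs_of_nonneg (sub_nonneg.2 ((hX.strictMono D ht).monotone hab))]
    exact hX.upper_bound D ht hab
  · rw [abs_of_nonneg (sub_nonneg.2 hab),
      abs_of_nonneg (sub_nonneg.2 ((hX.strictMono D ht).monotone hab))]
    exact hX.upper_bound D ht hab

/-- An expansion bound from below shrinks preimages: this is the Hausdorff measure estimate for
antilipschitz maps in dimension one. It bounds the density of the image measure before any
differentiability of the flow is known. -/
theorem map_torus_le {t : ℝ} (ht : 0 ≤ t) :
    Measure.map (X t) torus ≤
      ENNReal.ofReal (Real.exp ((K * (∫ x, ρ₀ x ∂torus) + 1) * t)) •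
        volume.restrict (Ioc (X t 0) (X t 0 + 2 * Real.pi)) := by
  refine Measure.le_iff.2 fun s hs => ?_
  rw [Measure.map_apply (hX.continuous_slice t).measurable hs, Measure.smul_apply,
    Measure.restrict_apply hs,
    Measure.restrict_apply ((hX.continuous_slice t).measurable hs), smul_eq_mul]
  have h1 : X t ⁻¹' s ∩ Ioc 0 (2 * Real.pi) ⊆
      X t ⁻¹' (s ∩ Ioc (X t 0) (X t 0 + 2 * Real.pi)) := by
    rintro b ⟨hb, hb'⟩
    refine ⟨hb, hX.strictMono D ht hb'.1, ?_⟩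
    rw [← hX.shift D ht, zero_add]
    exact (hX.strictMono D ht).monotone hb'.2
  refine (measure_mono h1).trans ?_
  have h2 := (hX.antilipschitz D ht).hausdorffMeasure_preimage_le (d := 1) zero_le_one
    (s ∩ Ioc (X t 0) (X t 0 + 2 * Real.pi))
  rw [hausdorffMeasure_real, ENNReal.rpow_one] at h2
  exact h2

theorem integral_comp_le {t : ℝ} (ht : 0 ≤ t) {g : ℝ → ℝ} (hg : Measurable g)
    (hg0 : ∀ x, 0 ≤ g x) (hgi : Integrable g torus) (hgp : IsPeriodic g) :
    ∫ b, g (X t b) ∂torus ≤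
      Real.exp ((K * (∫ x, ρ₀ x ∂torus) + 1) * t) * ∫ x, g x ∂torus := by
  have hi : IntegrableOn g (Ioc (X t 0) (X t 0 + 2 * Real.pi)) := by
    have := hgp.intervalIntegrable₀ two_pi_pos.ne' (integrable_torus_iff.1 hgi)
      (X t 0) (X t 0 + 2 * Real.pi)
    rwa [intervalIntegrable_iff_integrableOn_Ioc_of_le (by linarith [two_pi_pos])] at this
  rw [← integral_map (hX.continuous_slice t).aemeasurable hg.aestronglyMeasurable]
  refine (integral_mono_measure (hX.map_torus_le D ht) (Eventually.of_forall hg0)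
    (hi.smul_measure ENNReal.ofReal_ne_top)).trans ?_
  rw [integral_smul_measure, ENNReal.toReal_ofReal (Real.exp_pos _).le,
    integral_torus_eq_shift hgp (X t 0),
    intervalIntegral.integral_of_le (by linarith [two_pi_pos]), smul_eq_mul]

theorem integral_steklov_sub_comp_le {t : ℝ} (ht : 0 ≤ t) (n : ℕ) (x : ℝ) :
    ∫ b, |steklov φ n (x - X t b) - φ (x - X t b)| ∂torus ≤
      Real.exp ((K * (∫ x, ρ₀ x ∂torus) + 1) * t) * ∫ z, |steklov φ n z - φ z| ∂torus := by
  have hm : Measurable fun z => |steklov φ n z - φ z| :=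
    ((D.continuous_steklov n).measurable.sub D.kernel_measurable).norm
  have hp : IsPeriodic fun z => |steklov φ n z - φ z| := fun z => by
    simp only [D.steklov_periodic n z, D.kernel_periodic z]
  have hpx : IsPeriodic fun z => |steklov φ n (x - z) - φ (x - z)| := fun z => by
    have := hp.sub_eq (x - z)
    rwa [sub_sub] at this
  have hii : ∀ a b, IntervalIntegrable (fun z => |steklov φ n z - φ z|) volume a b :=
    hp.intervalIntegrable₀ two_pi_pos.ne' (integrable_torus_iff.1 (D.integrable_steklov_sub n))
  have hi : Integrable (fun z => |steklov φ n (x - z) - φ (x - z)|) torus := by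
    rw [integrable_torus_iff]
    have := (hii x (x - 2 * Real.pi)).comp_sub_left x
    simpa using this
  refine (hX.integral_comp_le D ht (g := fun z => |steklov φ n (x - z) - φ (x - z)|)
    (hm.comp (measurable_const.sub measurable_id)) (fun _ => abs_nonneg _) hi hpx).trans ?_
  refine le_of_eq ?_
  congr 1
  rw [integral_torus_eq_intervalIntegral,
    intervalIntegral.integral_comp_sub_left (fun z => |steklov φ n z - φ z|),
    integral_torus_eq_shift hp (x - 2 * Real.pi)]
  simp

/-- Split `ρ₀ ≤ N + (ρ₀ - N)⁺`. Against the tail, `|φₙ - φ| ≤ 2K` is enough; against the constant N,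
the image measure has bounded density and the integral reduces to the L¹ distance of the kernels,
independent of x. -/
theorem eventually_integral_steklov_mul_le (T : ℝ) {ε : ℝ} (hε : 0 < ε) :
    ∀ᶠ n in atTop, ∀ t ∈ Icc 0 T, ∀ x,
      ∫ b, |steklov φ n (x - X t b) - φ (x - X t b)| * ρ₀ b ∂torus ≤ ε := by
  have hK := D.K_nonneg
  have hm := D.mass_nonneg
  obtain ⟨N, hN⟩ := ((D.tendsto_density_tail.const_mul (2 * K)).eventually
    (gt_mem_nhds (show 2 * K * 0 < ε / 2 by simpa using hε))).exists
  set C := (N : ℝ) * Real.exp ((K * (∫ x, ρ₀ x ∂torus) + 1) * T) with hC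
  have hC0 : 0 ≤ C := by positivity
  filter_upwards [(D.tendsto_integral_steklov.const_mul C).eventually
    (gt_mem_nhds (show C * 0 < ε / 2 by simpa using hε))] with n hn t ht x
  have hmeas : Measurable fun b => |steklov φ n (x - X t b) - φ (x - X t b)| :=
    (((D.continuous_steklov n).measurable.sub D.kernel_measurable).comp
      (measurable_const.sub (hX.continuous_slice t).measurable)).norm
  have hle : ∀ b, |steklov φ n (x - X t b) - φ (x - X t b)| ≤ 2 * K := fun b => by
    have := abs_sub (steklov φ n (x - X t b)) (φ (x - X t b))
    linarith [D.abs_steklov_le n (x - X t b), D.kernel_le (x - X t b)]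
  have hi1 : Integrable (fun b => |steklov φ n (x - X t b) - φ (x - X t b)|) torus :=
    (integrable_const (2 * K)).mono' hmeas.aestronglyMeasurable
      (Eventually.of_forall fun b => by rw [Real.norm_eq_abs, abs_abs]; exact hle b)
  have hi2 : Integrable (fun b => max (ρ₀ b - N) 0) torus :=
    D.density_integrable.mono'
      ((D.density_measurable.sub_const _).max measurable_const).aestronglyMeasurable
      (Eventually.of_forall fun b => by
        rw [Real.norm_eq_abs, abs_of_nonneg (le_max_right _ _)]
        refine max_le ?_ (D.density_nonneg b)
        have : (0 : ℝ) ≤ N := by positivity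
        linarith)
  have h1 : ∫ b, |steklov φ n (x - X t b) - φ (x - X t b)| * ρ₀ b ∂torus ≤
      ∫ b, (2 * K * max (ρ₀ b - N) 0 +
        N * |steklov φ n (x - X t b) - φ (x - X t b)|) ∂torus := by
    refine integral_mono_of_nonneg
      (Eventually.of_forall fun b => mul_nonneg (abs_nonneg _) (D.density_nonneg b))
      ((hi2.const_mul _).add (hi1.const_mul _)) (Eventually.of_forall fun b => ?_)
    have h2 : ρ₀ b ≤ max (ρ₀ b - N) 0 + N := by
      have := le_max_left (ρ₀ b - N) 0
      linarith
    have h3 := hle b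
    have h4 := abs_nonneg (steklov φ n (x - X t b) - φ (x - X t b))
    have h5 : 0 ≤ max (ρ₀ b - N) 0 := le_max_right _ _
    have h6 := mul_le_mul_of_nonneg_left h2 h4
    have h7 := mul_le_mul_of_nonneg_right h3 h5
    simp only
    linarith
  rw [integral_add (hi2.const_mul _) (hi1.const_mul _), integral_const_mul,
    integral_const_mul] at h1
  have h8 := hX.integral_steklov_sub_comp_le D ht.1 n x
  have h9 : (N : ℝ) * ∫ b, |steklov φ n (x - X t b) - φ (x - X t b)| ∂torus ≤
      C * ∫ z, |steklov φ n z - φ z| ∂torus := by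
    rw [hC, mul_assoc]
    gcongr
    refine h8.trans ?_
    have : 0 ≤ ∫ z, |steklov φ n z - φ z| ∂torus := integral_nonneg fun _ => abs_nonneg _
    gcongr
    exact ht.2
  linarith

end IsFlow

/-! ### Integration in time under an integral over labels -/

theorem integral_eq_sub_of_hasDerivWithinAt_Ici {E : Type*} [NormedAddCommGroup E]
    [NormedSpace ℝ E] [CompleteSpace E] {f f' : ℝ → E}
    (hf : ∀ t, 0 ≤ t → HasDerivWithinAt f (f' t) (Ici 0) t) (hf' : ContinuousOn f' (Ici 0))
    {t : ℝ} (ht : 0 ≤ t) : ∫ s in (0 : ℝ)..t, f' s = f t - f 0 := by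
  refine intervalIntegral.integral_eq_sub_of_hasDeriv_right_of_le ht
    (fun s hs => ((hf s hs.1).continuousWithinAt).mono Icc_subset_Ici_self)
    (fun s hs => (hf s hs.1.le).mono fun r hr => hs.1.le.trans (le_of_lt hr)) ?_
  refine (hf'.mono ?_).intervalIntegrable
  rw [uIcc_of_le ht]
  exact Icc_subset_Ici_self

theorem integrable_prod_of_bound {r : ℝ → ℝ} (hr : Integrable r torus) {q : ℝ → ℝ → ℝ} {t C : ℝ}
    (hq : AEStronglyMeasurable (Function.uncurry q) ((volume.restrict (uIoc 0 t)).prod torus))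
    (hC : ∀ s ∈ uIoc 0 t, ∀ a ∈ Ioc 0 (2 * Real.pi), |q s a| ≤ C) :
    Integrable (Function.uncurry fun s a => q s a * r a)
      ((volume.restrict (uIoc 0 t)).prod torus) := by
  have : IsFiniteMeasure (volume.restrict (uIoc 0 t)) := by
    unfold uIoc
    infer_instance
  have h1 : Integrable (fun z : ℝ × ℝ => C * r z.2)
      ((volume.restrict (uIoc 0 t)).prod torus) :=
    (integrable_const C).mul_prod hr
  have hr2 : AEStronglyMeasurable (fun z : ℝ × ℝ => r z.2)
      ((volume.restrict (uIoc 0 t)).prod torus) := hr.aestronglyMeasurable.comp_snd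
  refine h1.mono (hq.mul hr2) ?_
  rw [Measure.prod_restrict]
  refine (ae_restrict_iff' (measurableSet_uIoc.prod measurableSet_Ioc)).2
    (Eventually.of_forall fun z hz => ?_)
  simp only [Function.uncurry, norm_mul, Real.norm_eq_abs]
  exact mul_le_mul_of_nonneg_right ((hC z.1 hz.1 z.2 hz.2).trans (le_abs_self C)) (abs_nonneg _)

/-- Fubini and the fundamental theorem of calculus. This is the template of the weak formulations:
in labels the weight r does not depend on time. -/
theorem integral_mul_sub_eq {r : ℝ → ℝ} (hr : Integrable r torus) {p p' : ℝ → ℝ → ℝ}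
    (hp : ∀ t, 0 ≤ t → Continuous (p t))
    (hd : ∀ a t, 0 ≤ t → HasDerivWithinAt (fun s => p s a) (p' t a) (Ici 0) t)
    (hp' : ContinuousOn (Function.uncurry p') spaceTime) {t : ℝ} (ht : 0 ≤ t) :
    (∫ a, p t a * r a ∂torus) - ∫ a, p 0 a * r a ∂torus =
      ∫ s in (0 : ℝ)..t, ∫ a, p' s a * r a ∂torus := by
  obtain ⟨M, -, hM⟩ := exists_bound_spaceTime hp' t 0 (2 * Real.pi)
  have hmeas : AEStronglyMeasurable (Function.uncurry p')
      ((volume.restrict (uIoc 0 t)).prod torus) := by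
    rw [Measure.prod_restrict]
    refine (hp'.mono fun z hz => ?_).aestronglyMeasurable
      (measurableSet_uIoc.prod measurableSet_Ioc)
    rw [uIoc_of_le ht] at hz
    exact ⟨mem_Ici.2 hz.1.1.le, trivial⟩
  rw [intervalIntegral_integral_swap (integrable_prod_of_bound hr (C := M) hmeas
    (fun s hs a ha => by
      rw [uIoc_of_le ht] at hs
      exact hM s ⟨hs.1.le, hs.2⟩ a ⟨ha.1.le, ha.2⟩)),
    ← integral_sub (integrable_continuousOn_mul (hp t ht).continuousOn hr)
      (integrable_continuousOn_mul (hp 0 le_rfl).continuousOn hr)]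
  congr 1 with a
  rw [intervalIntegral.integral_mul_const,
    integral_eq_sub_of_hasDerivWithinAt_Ici (hd a) (continuousOn_slice_left hp' a) ht, sub_mul]

/-- The convolution of the kernel with the image of the measure `w ρ₀` under the flow. -/
def flowConv (φ ρ₀ : ℝ → ℝ) (X w : ℝ → ℝ → ℝ) (t x : ℝ) : ℝ :=
  ∫ b, φ (x - X t b) * (w t b * ρ₀ b) ∂torus

/-! ### Continuity of convolutions along the flow -/

namespace IsFlow

variable {φ ρ₀ u₀ e₀ : ℝ → ℝ} {K : ℝ} {X : ℝ → ℝ → ℝ} (hX : IsFlow φ ρ₀ u₀ X)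
  (D : NormalData φ ρ₀ u₀ e₀ K)

include hX D

theorem integrable_kernel_mul {ψ : ℝ → ℝ} (hψ : Measurable ψ) (hψK : ∀ z, |ψ z| ≤ K)
    {w : ℝ → ℝ} (hw : Continuous w) (t x : ℝ) :
    Integrable (fun b => ψ (x - X t b) * (w b * ρ₀ b)) torus := by
  refine (integrable_continuousOn_mul hw.continuousOn D.density_integrable).bdd_mul (c := K)
    (hψ.comp (measurable_const.sub (hX.continuous_slice t).measurable)).aestronglyMeasurable
    (Eventually.of_forall fun b => hψK _)

theorem eventually_flowConv_steklov_sub_le {w : ℝ → ℝ → ℝ}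
    (hw : ContinuousOn (Function.uncurry w) spaceTime) (T : ℝ) {ε : ℝ} (hε : 0 < ε) :
    ∀ᶠ n in atTop, ∀ t ∈ Icc 0 T, ∀ x,
      |flowConv φ ρ₀ X w t x - flowConv (steklov φ n) ρ₀ X w t x| ≤ ε := by
  obtain ⟨M, hM0, hM⟩ := exists_bound_spaceTime hw T 0 (2 * Real.pi)
  have hε' : 0 < ε / (M + 1) := by positivity
  filter_upwards [hX.eventually_integral_steklov_mul_le D T hε'] with n hn t ht x
  have hwc := continuousOn_slice_right hw ht.1
  have hi := D.density_integrable.bdd_mul (c := 2 * K)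
    (f := fun b => |steklov φ n (x - X t b) - φ (x - X t b)|)
    ((((D.continuous_steklov n).measurable.sub D.kernel_measurable).comp
      (measurable_const.sub (hX.continuous_slice t).measurable)).norm.aestronglyMeasurable)
    (Eventually.of_forall fun b => by
      rw [Real.norm_eq_abs, abs_abs]
      have := abs_sub (steklov φ n (x - X t b)) (φ (x - X t b))
      linarith [D.abs_steklov_le n (x - X t b), D.kernel_le (x - X t b)])
  unfold flowConv
  rw [← integral_sub (hX.integrable_kernel_mul D D.kernel_measurable D.kernel_le hwc t x)
    (hX.integrable_kernel_mul D (D.continuous_steklov n).measurable (D.abs_steklov_le n) hwc t x),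
    ← Real.norm_eq_abs]
  refine (norm_integral_le_of_norm_le (hi.const_mul M) ?_).trans ?_
  · refine (ae_restrict_iff' measurableSet_Ioc).2 (Eventually.of_forall fun b hb => ?_)
    rw [← sub_mul, norm_mul, norm_mul, Real.norm_eq_abs, Real.norm_eq_abs (ρ₀ b),
      abs_of_nonneg (D.density_nonneg b), abs_sub_comm, mul_left_comm M]
    have h1 := hM t ht b ⟨hb.1.le, hb.2⟩
    have h2 := D.density_nonneg b
    gcongr
  · rw [integral_const_mul]
    calc _ ≤ M * (ε / (M + 1)) := by
          gcongr
          exact hn t ht x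
      _ = ε * (M / (M + 1)) := by ring
      _ ≤ ε * 1 := by
          gcongr
          rw [div_le_one (by linarith)]
          linarith
      _ = ε := mul_one ε

theorem continuousOn_flowConv_of_continuous {ψ : ℝ → ℝ} (hψ : Continuous ψ) {w : ℝ → ℝ → ℝ}
    (hw : ContinuousOn (Function.uncurry w) spaceTime) :
    ContinuousOn (Function.uncurry (flowConv ψ ρ₀ X w)) spaceTime := by
  have h := continuousOn_integral_smul (S := spaceTime) D.density_integrable
    (F := fun (p : ℝ × ℝ) b => ψ (p.2 - X p.1 b) * w p.1 b) (by
      have hXc : Continuous fun z : (ℝ × ℝ) × ℝ => ψ (z.1.2 - X z.1.1 z.2) :=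
        hψ.comp ((continuous_snd.comp continuous_fst).sub
          (hX.cont.comp ((continuous_fst.comp continuous_fst).prodMk continuous_snd)))
      refine hXc.continuousOn.mul (hw.comp (f := fun z : (ℝ × ℝ) × ℝ => (z.1.1, z.2))
        (by fun_prop) fun z hz => ⟨hz.1.1, trivial⟩))
  refine h.congr fun p _ => ?_
  simp only [Function.uncurry, flowConv]
  congr 1 with b
  rw [smul_eq_mul]
  ring

/-- With φ discontinuous the integrand is not continuous, but the convolution is a locally uniform
limit of those with the continuous Steklov kernels. -/
theorem continuousOn_flowConv {w : ℝ → ℝ → ℝ}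
    (hw : ContinuousOn (Function.uncurry w) spaceTime) :
    ContinuousOn (Function.uncurry (flowConv φ ρ₀ X w)) spaceTime := by
  refine continuousOn_of_locally_uniform_approx_of_continuousWithinAt fun p hp U hU => ?_
  obtain ⟨ε, hε, hεU⟩ := Metric.mem_uniformity_dist.1 hU
  obtain ⟨n, hn⟩ :=
    (hX.eventually_flowConv_steklov_sub_le D hw (p.1 + 1) (half_pos hε)).exists
  -- The approximation is uniform only on bounded times, hence the cut-off one unit after the base
  -- time.
  refine ⟨spaceTime ∩ {q | q.1 < p.1 + 1}, inter_mem_nhdsWithin _ ?_, _,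
    hX.continuousOn_flowConv_of_continuous D (D.continuous_steklov n) hw p hp, fun q hq => ?_⟩
  · exact (isOpen_lt continuous_fst continuous_const).mem_nhds (by simp)
  · refine hεU ?_
    rw [Real.dist_eq]
    exact (hn q.1 ⟨hq.1.1, le_of_lt hq.2⟩ q.2).trans_lt (half_lt_self hε)

omit hX in
theorem flowConv_add_two_pi {w : ℝ → ℝ → ℝ} (t x : ℝ) :
    flowConv φ ρ₀ X w t (x + 2 * Real.pi) = flowConv φ ρ₀ X w t x := by
  unfold flowConv
  congr 1 with b
  rw [add_sub_right_comm, D.kernel_periodic]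

/-- By Fubini the potential is a primitive of the convolution of φ with the transported density,
which is continuous; so it is differentiable everywhere although `prim φ` need not be. -/
theorem hasDerivAt_potential {t : ℝ} (ht : 0 ≤ t) (x : ℝ) :
    HasDerivAt (potential φ ρ₀ (X t)) (flowConv φ ρ₀ X (fun _ _ => 1) t x) x := by
  have hc : Continuous (flowConv φ ρ₀ X (fun _ _ => 1) t) :=
    continuousOn_slice_right (hX.continuousOn_flowConv D continuousOn_const) ht
  have key : ∀ y, potential φ ρ₀ (X t) y =
      potential φ ρ₀ (X t) 0 + ∫ z in (0 : ℝ)..y, flowConv φ ρ₀ X (fun _ _ => 1) t z := by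
    intro y
    have hm : Measurable (Function.uncurry fun s b => φ (s - X t b)) :=
      D.kernel_measurable.comp
        (measurable_fst.sub ((hX.continuous_slice t).measurable.comp measurable_snd))
    have h := intervalIntegral_integral_swap (integrable_prod_of_bound
      D.density_integrable (t := y) (C := K) hm.aestronglyMeasurable
      (fun s _ b _ => D.kernel_le _))
    unfold flowConv
    simp only [one_mul]
    rw [h]
    unfold potential
    rw [← sub_eq_iff_eq_add', ← integral_sub
      (D.integrable_prim_mul (hX.continuous_slice t) y)
      (D.integrable_prim_mul (hX.continuous_slice t) 0)]
    congr 1 with b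
    rw [← sub_mul, intervalIntegral.integral_mul_const,
      intervalIntegral.integral_comp_sub_right (fun z => φ z),
      prim_sub_prim D.kernel_intervalIntegrable]
  have h := ((hc.integral_hasStrictDerivAt 0 x).hasDerivAt).const_add (potential φ ρ₀ (X t) 0)
  exact h.congr_of_eventuallyEq (Eventually.of_forall key)

theorem continuous_vel :
    Continuous (Function.uncurry fun t a => configVel φ ρ₀ u₀ (X t) a) := by
  have h : Continuous fun p : ℝ × ℝ => potential φ ρ₀ (X p.1) (X p.1 p.2) := by
    rw [← continuousOn_univ]
    have h := continuousOn_integral_smul (S := univ) D.density_integrable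
      (F := fun (p : ℝ × ℝ) b => prim φ (X p.1 p.2 - X p.1 b)) (by
        have h1 : Continuous fun z : (ℝ × ℝ) × ℝ => X z.1.1 z.1.2 :=
          hX.cont.comp continuous_fst
        have h2 : Continuous fun z : (ℝ × ℝ) × ℝ => X z.1.1 z.2 :=
          hX.cont.comp ((continuous_fst.comp continuous_fst).prodMk continuous_snd)
        exact (D.continuous_prim.comp (h1.sub h2)).continuousOn)
    refine h.congr fun p _ => ?_
    simp only [potential]
    congr 1 with b
    rw [smul_eq_mul, mul_comm]
  exact ((D.velocity_continuous.comp continuous_snd).add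
    ((D.continuous_potential continuous_id).comp continuous_snd)).sub h

end IsFlow

/-- The alignment force felt by the particle labelled `a`. -/
def flowForce (φ ρ₀ u₀ : ℝ → ℝ) (X : ℝ → ℝ → ℝ) (t a : ℝ) : ℝ :=
  flowConv φ ρ₀ X (fun t a => configVel φ ρ₀ u₀ (X t) a) t (X t a) -
    configVel φ ρ₀ u₀ (X t) a * flowConv φ ρ₀ X (fun _ _ => 1) t (X t a)

/-! ### The velocity equation along characteristics -/

namespace IsFlow

variable {φ ρ₀ u₀ e₀ : ℝ → ℝ} {K : ℝ} {X : ℝ → ℝ → ℝ} (hX : IsFlow φ ρ₀ u₀ X)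
  (D : NormalData φ ρ₀ u₀ e₀ K)

include hX D

omit D in
theorem continuousOn_comp_flow {w : ℝ → ℝ → ℝ}
    (hw : ContinuousOn (Function.uncurry w) spaceTime) :
    ContinuousOn (Function.uncurry fun t a => w t (X t a)) spaceTime :=
  hw.comp (f := fun p : ℝ × ℝ => (p.1, X p.1 p.2))
    (continuous_fst.prodMk hX.cont).continuousOn fun _ hp => ⟨hp.1, trivial⟩

theorem continuousOn_flowForce :
    ContinuousOn (Function.uncurry (flowForce φ ρ₀ u₀ X)) spaceTime :=
  (hX.continuousOn_comp_flow
    (hX.continuousOn_flowConv D (hX.continuous_vel D).continuousOn)).sub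
    ((hX.continuous_vel D).continuousOn.mul
      (hX.continuousOn_comp_flow (hX.continuousOn_flowConv D (w := fun _ _ => 1) continuousOn_const)))

/-- For a continuous kernel the primitive is C¹, so the chain rule applies to each pair of particles
and can be integrated over labels. -/
theorem potential_steklov_sub (n : ℕ) (a : ℝ) {t : ℝ} (ht : 0 ≤ t) :
    potential (steklov φ n) ρ₀ (X t) (X t a) - potential (steklov φ n) ρ₀ (X 0) (X 0 a) =
      ∫ s in (0 : ℝ)..t, (configVel φ ρ₀ u₀ (X s) a *
        flowConv (steklov φ n) ρ₀ X (fun _ _ => 1) s (X s a) -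
        flowConv (steklov φ n) ρ₀ X (fun t a => configVel φ ρ₀ u₀ (X t) a) s (X s a)) := by
  have hpc : Continuous (prim (steklov φ n)) := by
    refine intervalIntegral.continuous_primitive (fun a b => ?_) 0
    exact (D.continuous_steklov n).intervalIntegrable a b
  have hXa : Continuous fun z : ℝ × ℝ => X z.1 a - X z.1 z.2 :=
    ((hX.continuous_path a).comp continuous_fst).sub hX.cont
  have h := integral_mul_sub_eq D.density_integrable
    (p := fun t b => prim (steklov φ n) (X t a - X t b))
    (p' := fun t b => steklov φ n (X t a - X t b) *
      (configVel φ ρ₀ u₀ (X t) a - configVel φ ρ₀ u₀ (X t) b))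
    (fun t _ => hpc.comp (continuous_const.sub (hX.continuous_slice t)))
    (fun b t _ => by
      have h1 : HasDerivAt (prim (steklov φ n)) (steklov φ n (X t a - X t b)) (X t a - X t b) :=
        ((D.continuous_steklov n).integral_hasStrictDerivAt 0 _).hasDerivAt
      exact (h1.comp t ((hX.hasDerivAt t a).sub (hX.hasDerivAt t b))).hasDerivWithinAt)
    (by
      have hv : Continuous fun z : ℝ × ℝ =>
          configVel φ ρ₀ u₀ (X z.1) a - configVel φ ρ₀ u₀ (X z.1) z.2 :=
        ((hX.continuous_vel D).comp (continuous_fst.prodMk continuous_const)).sub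
          (hX.continuous_vel D)
      exact (((D.continuous_steklov n).comp hXa).mul hv).continuousOn) ht
  refine h.trans ?_
  refine intervalIntegral.integral_congr fun s _ => ?_
  have hv : Continuous (configVel φ ρ₀ u₀ (X s)) := D.continuous_configVel (hX.continuous_slice s)
  simp only [flowConv]
  rw [← integral_const_mul, ← integral_sub
    ((hX.integrable_kernel_mul D (D.continuous_steklov n).measurable (D.abs_steklov_le n)
      continuous_const s (X s a)).const_mul _)
    (hX.integrable_kernel_mul D (D.continuous_steklov n).measurable (D.abs_steklov_le n)
      hv s (X s a))]
  congr 1 with b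
  ring

omit hX in
theorem tendsto_potential_steklov {Z : ℝ → ℝ} (hZ : Continuous Z) (x : ℝ) :
    Tendsto (fun n => potential (steklov φ n) ρ₀ Z x) atTop (𝓝 (potential φ ρ₀ Z x)) := by
  obtain ⟨M, hM⟩ := isCompact_Icc.exists_bound_of_continuousOn (s := Icc 0 (2 * Real.pi))
    (f := fun b => x - Z b) (by fun_prop)
  refine tendsto_integral_of_dominated_convergence (fun b => K * M * ρ₀ b)
    (fun n => ?_) (D.density_integrable.const_mul _) (fun n => ?_)
    (Eventually.of_forall fun b => (D.tendsto_prim_steklov (x - Z b)).mul_const _)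
  · have hpc : Continuous (prim (steklov φ n)) := by
      refine intervalIntegral.continuous_primitive (fun a b => ?_) 0
      exact (D.continuous_steklov n).intervalIntegrable a b
    exact (integrable_continuousOn_mul (hpc.comp (continuous_const.sub hZ)).continuousOn
      D.density_integrable).aestronglyMeasurable
  · refine (ae_restrict_iff' measurableSet_Ioc).2 (Eventually.of_forall fun b hb => ?_)
    rw [norm_mul, Real.norm_eq_abs (ρ₀ b), abs_of_nonneg (D.density_nonneg b)]
    have h1 : ‖prim (steklov φ n) (x - Z b)‖ ≤ K * |x - Z b - 0| :=
      intervalIntegral.norm_integral_le_of_norm_le_const fun z _ => D.abs_steklov_le n z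
    rw [sub_zero] at h1
    have h2 := mul_le_mul_of_nonneg_left (hM b ⟨hb.1.le, hb.2⟩) D.K_nonneg
    exact mul_le_mul_of_nonneg_right (h1.trans h2) (D.density_nonneg b)

/-- The chain rule for `prim φ` along `X t a - X t b` is not available for a rough kernel. The
identity for Steklov kernels passes to the limit because the convolutions converge uniformly on `[0,
t]`. -/
theorem potential_sub (a : ℝ) {t : ℝ} (ht : 0 ≤ t) :
    potential φ ρ₀ (X t) (X t a) - potential φ ρ₀ (X 0) (X 0 a) =
      ∫ s in (0 : ℝ)..t, -flowForce φ ρ₀ u₀ X s a := by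
  have h1 := (tendsto_potential_steklov D (hX.continuous_slice t) (X t a)).sub
    (tendsto_potential_steklov D (hX.continuous_slice 0) (X 0 a))
  simp only [fun n => hX.potential_steklov_sub D n a ht] at h1
  refine tendsto_nhds_unique h1 ?_
  set v : ℝ → ℝ → ℝ := fun t a => configVel φ ρ₀ u₀ (X t) a with hv
  have hvc : ContinuousOn (Function.uncurry v) spaceTime := (hX.continuous_vel D).continuousOn
  have hc1 : ContinuousOn (Function.uncurry fun _ _ : ℝ => (1 : ℝ)) spaceTime := continuousOn_const
  have e1 : ∀ ε > 0, ∀ᶠ n in atTop, ∀ s ∈ Icc 0 t,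
      |flowForce φ ρ₀ u₀ X s a + (v s a * flowConv (steklov φ n) ρ₀ X (fun _ _ => 1) s (X s a) -
        flowConv (steklov φ n) ρ₀ X v s (X s a))| ≤ ε := by
    intro ε hε
    obtain ⟨M, hM0, hM⟩ := exists_bound_spaceTime hvc t a a
    have hε1 : 0 < ε / (2 * (M + 1)) := by positivity
    filter_upwards [hX.eventually_flowConv_steklov_sub_le D hvc t (half_pos hε),
      hX.eventually_flowConv_steklov_sub_le D hc1 t hε1] with n hn1 hn2 s hs
    have h2 := hn1 s hs (X s a)
    have h3 := hn2 s hs (X s a)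
    have h4 : |v s a| ≤ M := hM s hs a ⟨le_rfl, le_rfl⟩
    have e : flowForce φ ρ₀ u₀ X s a +
        (v s a * flowConv (steklov φ n) ρ₀ X (fun _ _ => 1) s (X s a) -
          flowConv (steklov φ n) ρ₀ X v s (X s a)) =
        (flowConv φ ρ₀ X v s (X s a) - flowConv (steklov φ n) ρ₀ X v s (X s a)) -
        v s a * (flowConv φ ρ₀ X (fun _ _ => 1) s (X s a) -
          flowConv (steklov φ n) ρ₀ X (fun _ _ => 1) s (X s a)) := by
      simp only [flowForce, hv]; ring
    rw [e]
    refine (abs_sub _ _).trans ?_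
    rw [abs_mul]
    have h5 : |v s a| * |flowConv φ ρ₀ X (fun _ _ => 1) s (X s a) -
          flowConv (steklov φ n) ρ₀ X (fun _ _ => 1) s (X s a)| ≤
        (M + 1) * (ε / (2 * (M + 1))) := by
      gcongr
      linarith
    have h6 : (M + 1) * (ε / (2 * (M + 1))) = ε / 2 := by field_simp
    linarith
  obtain ⟨M, hM0, hM⟩ := exists_bound_spaceTime (hX.continuousOn_flowForce D) t a a
  -- The limit is bounded by M, hence the approximations eventually by `M + 1`, by the uniform
  -- estimate with `ε = 1`.
  refine intervalIntegral.tendsto_integral_filter_of_dominated_convergence (fun _ => M + 1)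
    (Eventually.of_forall fun n => ?_) ?_ (by simp) ?_
  · refine ContinuousOn.aestronglyMeasurable ?_ measurableSet_uIoc
    have hs := D.continuous_steklov n
    have h2 := continuousOn_slice_left (hX.continuousOn_comp_flow
      (hX.continuousOn_flowConv_of_continuous D hs hc1)) a
    have h3 := continuousOn_slice_left (hX.continuousOn_comp_flow
      (hX.continuousOn_flowConv_of_continuous D hs hvc)) a
    have h4 := continuousOn_slice_left hvc a
    refine ((h4.mul h2).sub h3).mono ?_
    rw [uIoc_of_le ht]
    exact fun s hs => mem_Ici.2 hs.1.le
  · filter_upwards [e1 1 one_pos] with n hn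
    refine Eventually.of_forall fun s hs => ?_
    rw [uIoc_of_le ht] at hs
    have h2 := hn s ⟨hs.1.le, hs.2⟩
    have h3 : |flowForce φ ρ₀ u₀ X s a| ≤ M := hM s ⟨hs.1.le, hs.2⟩ a ⟨le_rfl, le_rfl⟩
    rw [Real.norm_eq_abs, abs_le] at *
    constructor <;> linarith [h2.1, h2.2, h3.1, h3.2]
  · refine Eventually.of_forall fun s hs => ?_
    rw [uIoc_of_le ht] at hs
    rw [Metric.tendsto_atTop']
    intro ε hε
    obtain ⟨N, hN⟩ := eventually_atTop.1 (e1 (ε / 2) (half_pos hε))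
    refine ⟨N, fun n hn => ?_⟩
    rw [Real.dist_eq, sub_neg_eq_add, add_comm]
    exact (hN n hn.le s ⟨hs.1.le, hs.2⟩).trans_lt (half_lt_self hε)

/-- The velocity equation along characteristics. -/
theorem hasDerivWithinAt_vel (a : ℝ) {t : ℝ} (ht : 0 ≤ t) :
    HasDerivWithinAt (fun s => configVel φ ρ₀ u₀ (X s) a) (flowForce φ ρ₀ u₀ X t a) (Ici 0) t := by
  have hc := continuousOn_slice_left (hX.continuousOn_flowForce D) a
  have h := (hasDerivWithinAt_integral_Ici hc ht).const_add (configVel φ ρ₀ u₀ (X 0) a)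
  refine h.congr_of_mem (fun s hs => ?_) ht
  have h2 := hX.potential_sub D a (mem_Ici.1 hs)
  rw [intervalIntegral.integral_neg] at h2
  simp only [configVel]
  linarith

end IsFlow

/-- The convolution of the kernel with the density, along characteristics. -/
def flowSlope (φ ρ₀ : ℝ → ℝ) (X : ℝ → ℝ → ℝ) (t a : ℝ) : ℝ :=
  flowConv φ ρ₀ X (fun _ _ => 1) t (X t a)

/-- The homogeneous part of the Jacobian of the flow. -/
def jacHom (φ ρ₀ : ℝ → ℝ) (X : ℝ → ℝ → ℝ) (t a : ℝ) : ℝ :=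
  Real.exp (-∫ s in (0 : ℝ)..t, flowSlope φ ρ₀ X s a)

/-- The coefficient of the initial slope in the Jacobian of the flow. -/
def jacSrc (φ ρ₀ : ℝ → ℝ) (X : ℝ → ℝ → ℝ) (t a : ℝ) : ℝ :=
  jacHom φ ρ₀ X t a * ∫ r in (0 : ℝ)..t, Real.exp (∫ s in (0 : ℝ)..r, flowSlope φ ρ₀ X s a)

/-- The Jacobian of the flow. -/
def jac (φ ρ₀ e₀ : ℝ → ℝ) (X : ℝ → ℝ → ℝ) (t a : ℝ) : ℝ :=
  jacHom φ ρ₀ X t a + e₀ a * jacSrc φ ρ₀ X t a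

/-- The inverse of the flow at a given time. -/
def flowInv (X : ℝ → ℝ → ℝ) (t x : ℝ) : ℝ := Function.invFun (X t) x

namespace IsFlow

variable {φ ρ₀ u₀ e₀ : ℝ → ℝ} {K : ℝ} {X : ℝ → ℝ → ℝ} (hX : IsFlow φ ρ₀ u₀ X)
  (D : NormalData φ ρ₀ u₀ e₀ K)

include hX D

/-! ### The Jacobian -/

theorem continuousOn_flowSlope : ContinuousOn (Function.uncurry (flowSlope φ ρ₀ X)) spaceTime :=
  hX.continuousOn_comp_flow (hX.continuousOn_flowConv D (w := fun _ _ => 1) continuousOn_const)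

theorem continuousOn_jacHom : ContinuousOn (Function.uncurry (jacHom φ ρ₀ X)) spaceTime :=
  Real.continuous_exp.comp_continuousOn
    (continuousOn_integral_spaceTime (hX.continuousOn_flowSlope D)).neg

theorem continuousOn_jacSrc : ContinuousOn (Function.uncurry (jacSrc φ ρ₀ X)) spaceTime :=
  (hX.continuousOn_jacHom D).mul
    (continuousOn_integral_spaceTime
      (w := fun r a => Real.exp (∫ s in (0 : ℝ)..r, flowSlope φ ρ₀ X s a))
      (Real.continuous_exp.comp_continuousOn
        (continuousOn_integral_spaceTime (hX.continuousOn_flowSlope D))))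

omit hX D in
theorem jacHom_pos (t a : ℝ) : 0 < jacHom φ ρ₀ X t a := Real.exp_pos _

omit hX D in
theorem jacSrc_nonneg {t : ℝ} (ht : 0 ≤ t) (a : ℝ) : 0 ≤ jacSrc φ ρ₀ X t a :=
  mul_nonneg (jacHom_pos t a).le
    (intervalIntegral.integral_nonneg ht fun _ _ => (Real.exp_pos _).le)

omit hX in
theorem jacHom_le_jac {t : ℝ} (ht : 0 ≤ t) (a : ℝ) :
    jacHom φ ρ₀ X t a ≤ jac φ ρ₀ e₀ X t a :=
  le_add_of_nonneg_right (mul_nonneg (D.slope_nonneg a) (jacSrc_nonneg ht a))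

omit hX in
theorem jac_pos {t : ℝ} (ht : 0 ≤ t) (a : ℝ) : 0 < jac φ ρ₀ e₀ X t a :=
  (jacHom_pos t a).trans_le (jacHom_le_jac D ht a)

omit hX D in
theorem jac_zero (a : ℝ) : jac φ ρ₀ e₀ X 0 a = 1 := by simp [jac, jacHom, jacSrc]

/-- Variation of constants. The linear equation is the formal label derivative of the flow equation:
`e₀` differentiates `u₀ + prim φ * ρ₀`, and `flowSlope` the potential at the moving point. -/
theorem hasDerivWithinAt_jac (a : ℝ) {t : ℝ} (ht : 0 ≤ t) :
    HasDerivWithinAt (fun s => jac φ ρ₀ e₀ X s a)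
      (e₀ a - flowSlope φ ρ₀ X t a * jac φ ρ₀ e₀ X t a) (Ici 0) t := by
  have hc := continuousOn_slice_left (hX.continuousOn_flowSlope D) a
  have h1 := hasDerivWithinAt_integral_Ici hc ht
  have hc2 : ContinuousOn (fun r => Real.exp (∫ s in (0 : ℝ)..r, flowSlope φ ρ₀ X s a)) (Ici 0) :=
    fun s hs => (hasDerivWithinAt_integral_Ici hc hs).continuousWithinAt.rexp
  have h2 := hasDerivWithinAt_integral_Ici hc2 ht
  have h3 := h1.fun_neg.exp
  have h4 := h3.add ((h3.mul h2).const_mul (e₀ a))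
  refine h4.congr_deriv ?_
  have e : Real.exp (-∫ s in (0 : ℝ)..t, flowSlope φ ρ₀ X s a) *
      Real.exp (∫ s in (0 : ℝ)..t, flowSlope φ ρ₀ X s a) = 1 := by
    rw [← Real.exp_add]; simp
  rw [e]
  simp only [jac, jacSrc, jacHom]
  ring

theorem flowSlope_add_two_pi {t : ℝ} (ht : 0 ≤ t) (a : ℝ) :
    flowSlope φ ρ₀ X t (a + 2 * Real.pi) = flowSlope φ ρ₀ X t a := by
  unfold flowSlope
  rw [hX.shift D ht, flowConv_add_two_pi D]

theorem jacHom_add_two_pi {t : ℝ} (ht : 0 ≤ t) (a : ℝ) :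
    jacHom φ ρ₀ X t (a + 2 * Real.pi) = jacHom φ ρ₀ X t a := by
  unfold jacHom
  congr 2
  refine intervalIntegral.integral_congr fun s hs => ?_
  rw [uIcc_of_le ht] at hs
  exact hX.flowSlope_add_two_pi D hs.1 a

theorem jacSrc_add_two_pi {t : ℝ} (ht : 0 ≤ t) (a : ℝ) :
    jacSrc φ ρ₀ X t (a + 2 * Real.pi) = jacSrc φ ρ₀ X t a := by
  unfold jacSrc
  rw [hX.jacHom_add_two_pi D ht]
  congr 1
  refine intervalIntegral.integral_congr fun r hr => ?_
  rw [uIcc_of_le ht] at hr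
  refine congrArg Real.exp ?_
  refine intervalIntegral.integral_congr fun s hs => ?_
  rw [uIcc_of_le hr.1] at hs
  exact hX.flowSlope_add_two_pi D hs.1 a

theorem jac_add_two_pi {t : ℝ} (ht : 0 ≤ t) (a : ℝ) :
    jac φ ρ₀ e₀ X t (a + 2 * Real.pi) = jac φ ρ₀ e₀ X t a := by
  unfold jac
  rw [hX.jacHom_add_two_pi D ht, hX.jacSrc_add_two_pi D ht, D.slope_periodic]

/-- The flow is differentiable in the label wherever the initial slope is a derivative. -/
theorem hasDerivAt_flow {a : ℝ}
    (ha : HasDerivAt (fun b => u₀ b + potential φ ρ₀ id b) (e₀ a) a) {t : ℝ} (ht : 0 ≤ t) :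
    HasDerivAt (X t) (jac φ ρ₀ e₀ X t a) a := by
  obtain ⟨M, hM0, hM⟩ := exists_bound_spaceTime (hX.continuousOn_flowSlope D) t a a
  have hconv : ContinuousOn (Function.uncurry (flowConv φ ρ₀ X fun _ _ => 1)) spaceTime :=
    hX.continuousOn_flowConv D continuousOn_const
  refine hasDerivAt_param_of_linearized (x := X) (v := fun s b => configVel φ ρ₀ u₀ (X s) b)
    (k := fun s => jac φ ρ₀ e₀ X s a)
    (fun s => -(flowSlope φ ρ₀ X s a • ContinuousLinearMap.id ℝ ℝ)) (fun _ => e₀ a) (M := M)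
    (T := t) (fun b s _ => (hX.hasDerivAt s b).hasDerivWithinAt)
    (fun s hs => (hX.hasDerivWithinAt_jac D a hs.1).congr_deriv (by simp; ring))
    (fun s hs => by
      rw [norm_neg, norm_smul, ContinuousLinearMap.norm_id, mul_one]
      exact hM s hs a ⟨le_rfl, le_rfl⟩)
    (by
      have : X 0 = id := funext hX.init
      rw [this, jac_zero]
      exact hasDerivAt_id a) ?_ t ⟨ht, le_rfl⟩
  intro ε hε
  set L := Real.exp ((K * (∫ x, ρ₀ x ∂torus) + K + 1) * t) with hL
  have hL0 : 0 < L := Real.exp_pos _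
  have hε1 : 0 < ε / (2 * L) := by positivity
  -- Compactness of `[0, t]` gives one neighbourhood size of the path in which the slope of the
  -- potential is close to its value on the path, at all times.
  obtain ⟨v, hv, hvF⟩ := isCompact_Icc.mem_uniformity_of_prod (s := univ) (k := Icc 0 t) (q := 0)
    (f := fun η s => flowConv φ ρ₀ X (fun _ _ => 1) s (X s a + η))
    (hconv.comp (f := fun z : ℝ × ℝ => (z.2, X z.2 a + z.1))
      (continuous_snd.prodMk (((hX.continuous_path a).comp continuous_snd).add
        continuous_fst)).continuousOn fun z hz => ⟨hz.2.1, trivial⟩) (mem_univ _)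
    (Metric.dist_mem_uniformity hε1)
  rw [nhdsWithin_univ] at hv
  obtain ⟨δ, hδ, hδv⟩ := Metric.mem_nhds_iff.1 hv
  have h1 := Asymptotics.isLittleO_iff.1 (hasDerivAt_iff_isLittleO.1 ha) (half_pos hε)
  filter_upwards [h1, Metric.ball_mem_nhds a (show 0 < δ / L by positivity)] with b hb hbδ s hs
  have hXL : |X s b - X s a| ≤ L * |b - a| := by
    have h := (hX.lipschitz D hs.1).dist_le_mul b a
    rw [Real.coe_toNNReal _ (Real.exp_pos _).le, Real.dist_eq, Real.dist_eq] at h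
    refine h.trans ?_
    have h1 := D.K_nonneg
    have h2 := D.mass_nonneg
    have h3 := hs.2
    rw [hL]
    gcongr
  have hbδ' : |b - a| < δ / L := hbδ
  have hXδ : |X s b - X s a| < δ := hXL.trans_lt (by
    rw [lt_div_iff₀ hL0] at hbδ'
    linarith)
  -- Linearization error of the potential, controlled by `|X s b - X s a| ≤ L |b - a|`; the error of
  -- `u₀ + prim φ * ρ₀` is the other half of ε.
  have h2 := Convex.norm_image_sub_le_of_norm_hasDerivWithin_le (𝕜 := ℝ)
    (f := fun z => potential φ ρ₀ (X s) z - z * flowSlope φ ρ₀ X s a)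
    (f' := fun z => flowConv φ ρ₀ X (fun _ _ => 1) s z - 1 * flowSlope φ ρ₀ X s a)
    (C := ε / (2 * L)) (s := Metric.ball (X s a) δ) (x := X s a) (y := X s b)
    (fun z _ => ((hX.hasDerivAt_potential D hs.1 z).sub
      ((hasDerivAt_id z).mul_const _)).hasDerivWithinAt)
    (fun z hz => by
      have hz' : z - X s a ∈ v := hδv (by simpa [Real.dist_eq] using hz)
      have h3 := hvF _ hz' s hs
      rw [add_sub_cancel, add_zero, mem_ofPred_eq, dist_eq_norm] at h3
      rw [one_mul]
      exact le_of_lt h3)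
    (convex_ball _ _) (Metric.mem_ball_self hδ) (by simpa [Real.dist_eq] using hXδ)
  have hb' : |u₀ b + potential φ ρ₀ id b - (u₀ a + potential φ ρ₀ id a) - (b - a) * e₀ a| ≤
      ε / 2 * |b - a| := by simpa using hb
  have h3 : ε / (2 * L) * |X s b - X s a| ≤ ε / 2 * |b - a| := by
    calc _ ≤ ε / (2 * L) * (L * |b - a|) := by gcongr
      _ = ε / 2 * |b - a| := by field_simp
  rw [Real.norm_eq_abs, Real.norm_eq_abs] at h2
  have e : configVel φ ρ₀ u₀ (X s) b - configVel φ ρ₀ u₀ (X s) a -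
      (-(flowSlope φ ρ₀ X s a • ContinuousLinearMap.id ℝ ℝ)) (X s b - X s a) - (b - a) • e₀ a =
      (u₀ b + potential φ ρ₀ id b - (u₀ a + potential φ ρ₀ id a) - (b - a) * e₀ a) -
      (potential φ ρ₀ (X s) (X s b) - X s b * flowSlope φ ρ₀ X s a -
        (potential φ ρ₀ (X s) (X s a) - X s a * flowSlope φ ρ₀ X s a)) := by
    simp [configVel]; ring
  rw [e, Real.norm_eq_abs]
  refine (abs_sub _ _).trans ?_
  linarith

omit hX in
theorem ae_hasDerivAt_slope :
    ∀ᵐ a, HasDerivAt (fun b => u₀ b + potential φ ρ₀ id b) (e₀ a) a := by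
  have hl : LocallyIntegrable e₀ volume :=
    (locallyIntegrable_const K).mono D.slope_measurable.aestronglyMeasurable
      (Eventually.of_forall fun x => by
        rw [Real.norm_eq_abs, abs_of_nonneg (D.slope_nonneg x)]
        exact (D.slope_le x).trans (le_abs_self K))
  filter_upwards [LocallyIntegrable.ae_hasDerivAt_integral hl] with a ha
  have h := (ha 0).const_add (u₀ 0 + potential φ ρ₀ id 0)
  refine h.congr_of_eventuallyEq (Eventually.of_forall fun b => ?_)
  have := D.slope_eq 0 b
  simp only
  linarith

/-! ### Change of variables -/

/-- The set of bad labels comes with no measurability; its measurable hull, still null, is removed.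
-/
theorem exists_full_set {t : ℝ} (ht : 0 ≤ t) : ∃ s : Set ℝ, MeasurableSet s ∧ volume sᶜ = 0 ∧
    ∀ a ∈ s, HasDerivAt (X t) (jac φ ρ₀ e₀ X t a) a := by
  refine ⟨(toMeasurable volume
    {a | ¬ HasDerivAt (fun b => u₀ b + potential φ ρ₀ id b) (e₀ a) a})ᶜ,
    (measurableSet_toMeasurable _ _).compl, ?_, fun a ha => hX.hasDerivAt_flow D ?_ ht⟩
  · rw [compl_compl, measure_toMeasurable]
    exact ae_iff.1 (ae_hasDerivAt_slope D)
  · by_contra h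
    exact ha (subset_toMeasurable _ _ h)

theorem image_Ioc {t : ℝ} (ht : 0 ≤ t) :
    X t '' Ioc 0 (2 * Real.pi) = Ioc (X t 0) (X t 0 + 2 * Real.pi) := by
  have h2 : X t 0 + 2 * Real.pi = X t (2 * Real.pi) := by
    rw [← hX.shift D ht, zero_add]
  have hm := hX.strictMono D ht
  rw [h2]
  ext x
  constructor
  · rintro ⟨a, ha, rfl⟩
    exact ⟨hm ha.1, hm.monotone ha.2⟩
  · intro hx
    obtain ⟨a, rfl⟩ := hX.surjective D ht x
    exact ⟨a, ⟨hm.lt_iff_lt.1 hx.1, hm.le_iff_le.1 hx.2⟩, rfl⟩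

theorem volume_image_eq_zero {t : ℝ} (ht : 0 ≤ t) {s : Set ℝ} (hs : volume s = 0) :
    volume (X t '' s) = 0 := by
  have h := (hX.lipschitz D ht).hausdorffMeasure_image_le (d := 1) zero_le_one s
  rw [hausdorffMeasure_real, hs, mul_zero] at h
  exact le_antisymm h zero_le

variable {E : Type*} [NormedAddCommGroup E] [NormedSpace ℝ E]

/-- The flow is differentiable only for almost every label, so the area formula is applied on a full
set of labels. The remaining null set has null image because the flow is Lipschitz. -/
theorem change_of_variables_aux {t : ℝ} (ht : 0 ≤ t) (g : ℝ → E) :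
    (∫ x in Ioc (X t 0) (X t 0 + 2 * Real.pi), g x =
      ∫ a, jac φ ρ₀ e₀ X t a • g (X t a) ∂torus) ∧
    (IntegrableOn g (Ioc (X t 0) (X t 0 + 2 * Real.pi)) ↔
      Integrable (fun a => jac φ ρ₀ e₀ X t a • g (X t a)) torus) := by
  obtain ⟨s, hs, hs0, hsd⟩ := hX.exists_full_set D ht
  have hm := hX.strictMono D ht
  set S := Ioc 0 (2 * Real.pi) ∩ s with hS
  have hSm : MeasurableSet S := measurableSet_Ioc.inter hs
  have e1 : (X t '' S : Set ℝ) =ᵐ[volume] Ioc (X t 0) (X t 0 + 2 * Real.pi) := by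
    rw [← hX.image_Ioc D ht]
    refine (LE.le.eventuallyLE (image_mono inter_subset_left)).antisymm ?_
    refine ae_le_set.2 (measure_mono_null ?_ (hX.volume_image_eq_zero D ht hs0))
    rintro x ⟨⟨a, ha, rfl⟩, hx⟩
    exact ⟨a, fun has => hx ⟨a, ⟨ha, has⟩, rfl⟩, rfl⟩
  have e2 : (S : Set ℝ) =ᵐ[volume] Ioc 0 (2 * Real.pi) := by
    refine (LE.le.eventuallyLE inter_subset_left).antisymm ?_
    refine ae_le_set.2 (measure_mono_null ?_ hs0)
    rintro x ⟨ha, hx⟩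
    exact fun has => hx ⟨ha, has⟩
  have hd : ∀ a ∈ S, HasDerivWithinAt (X t) (jac φ ρ₀ e₀ X t a) S a := fun a ha =>
    (hsd a ha.2).hasDerivWithinAt
  have e3 : ∀ a, |jac φ ρ₀ e₀ X t a| = jac φ ρ₀ e₀ X t a := fun a =>
    abs_of_pos (jac_pos D ht a)
  constructor
  · rw [← setIntegral_congr_set e1,
      integral_image_eq_integral_abs_deriv_smul hSm hd hm.injective.injOn]
    simp only [e3]
    exact setIntegral_congr_set e2
  · rw [← integrableOn_congr_set_ae e1,
      integrableOn_image_iff_integrableOn_abs_deriv_smul hSm hd hm.injective.injOn]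
    simp only [e3]
    exact integrableOn_congr_set_ae e2

theorem integral_comp_flow {t : ℝ} (ht : 0 ≤ t) {g : ℝ → E}
    (hg : Function.Periodic g (2 * Real.pi)) :
    ∫ x, g x ∂torus = ∫ a, jac φ ρ₀ e₀ X t a • g (X t a) ∂torus := by
  rw [integral_torus_eq_shift hg (X t 0),
    intervalIntegral.integral_of_le (by linarith [two_pi_pos])]
  exact (hX.change_of_variables_aux D ht g).1

theorem integrable_comp_flow {t : ℝ} (ht : 0 ≤ t) {g : ℝ → E}
    (hg : Function.Periodic g (2 * Real.pi)) :
    Integrable g torus ↔ Integrable (fun a => jac φ ρ₀ e₀ X t a • g (X t a)) torus := by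
  rw [← (hX.change_of_variables_aux D ht g).2, integrable_torus_iff,
    ← intervalIntegrable_iff_integrableOn_Ioc_of_le (by linarith [two_pi_pos])]
  exact ⟨fun h => hg.intervalIntegrable₀ two_pi_pos.ne' h _ _, fun h => by
    simpa using hg.intervalIntegrable two_pi_pos.ne' h 0 (2 * Real.pi)⟩

/-! ### The inverse flow -/

theorem flow_flowInv {t : ℝ} (ht : 0 ≤ t) (x : ℝ) : X t (flowInv X t x) = x :=
  Function.rightInverse_invFun (hX.surjective D ht) x

theorem flowInv_flow {t : ℝ} (ht : 0 ≤ t) (a : ℝ) : flowInv X t (X t a) = a :=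
  Function.leftInverse_invFun (hX.strictMono D ht).injective a

theorem flowInv_zero (x : ℝ) : flowInv X 0 x = x := by
  have := hX.flow_flowInv D le_rfl x
  rwa [hX.init] at this

theorem flowInv_add_two_pi {t : ℝ} (ht : 0 ≤ t) (x : ℝ) :
    flowInv X t (x + 2 * Real.pi) = flowInv X t x + 2 * Real.pi := by
  refine (hX.strictMono D ht).injective ?_
  rw [hX.flow_flowInv D ht, hX.shift D ht, hX.flow_flowInv D ht]

theorem abs_flowInv_sub_le {t : ℝ} (ht : 0 ≤ t) (x a : ℝ) :
    |flowInv X t x - a| ≤ Real.exp ((K * (∫ x, ρ₀ x ∂torus) + 1) * t) * |x - X t a| := by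
  have h := (hX.antilipschitz D ht).le_mul_dist (flowInv X t x) a
  rwa [hX.flow_flowInv D ht, Real.coe_toNNReal _ (Real.exp_pos _).le] at h

/-- With `a₀` the preimage of `x₀` at time `t₀`, the distance of `flowInv X t x` to `a₀` is at most
a locally bounded factor times `|x - X t a₀|`, which is continuous and vanishes at `(t₀, x₀)`. -/
theorem continuousOn_flowInv : ContinuousOn (Function.uncurry (flowInv X)) spaceTime := by
  rintro ⟨t₀, x₀⟩ hp
  have ht₀ : 0 ≤ t₀ := hp.1
  have hc : Continuous fun p : ℝ × ℝ => Real.exp ((K * (∫ x, ρ₀ x ∂torus) + 1) * p.1) *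
      |p.2 - X p.1 (flowInv X t₀ x₀)| := by
    have := (hX.continuous_path (flowInv X t₀ x₀)).comp (continuous_fst (X := ℝ) (Y := ℝ))
    exact (by fun_prop : Continuous fun p : ℝ × ℝ =>
      Real.exp ((K * (∫ x, ρ₀ x ∂torus) + 1) * p.1)).mul (continuous_snd.sub this).abs
  have hlim := (hc.tendsto (t₀, x₀)).mono_left (nhdsWithin_le_nhds (s := spaceTime))
  simp only [hX.flow_flowInv D ht₀, sub_self, abs_zero, mul_zero] at hlim
  rw [ContinuousWithinAt, tendsto_iff_dist_tendsto_zero]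
  refine squeeze_zero' (Eventually.of_forall fun _ => dist_nonneg) ?_ hlim
  filter_upwards [self_mem_nhdsWithin] with p hp
  exact hX.abs_flowInv_sub_le D hp.1 p.2 _

end IsFlow

/-- The velocity field transported by the flow. -/
def solVel (φ ρ₀ u₀ : ℝ → ℝ) (X : ℝ → ℝ → ℝ) (t x : ℝ) : ℝ :=
  configVel φ ρ₀ u₀ (X t) (flowInv X t x)

/-- The density transported by the flow. -/
def solDens (φ ρ₀ e₀ : ℝ → ℝ) (X : ℝ → ℝ → ℝ) (t x : ℝ) : ℝ :=
  ρ₀ (flowInv X t x) / jac φ ρ₀ e₀ X t (flowInv X t x)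

/-! ### The density and the velocity in Eulerian variables -/

namespace IsFlow

variable {φ ρ₀ u₀ e₀ : ℝ → ℝ} {K : ℝ} {X : ℝ → ℝ → ℝ} (hX : IsFlow φ ρ₀ u₀ X)
  (D : NormalData φ ρ₀ u₀ e₀ K)

include hX D

theorem configVel_add_two_pi {t : ℝ} (ht : 0 ≤ t) (a : ℝ) :
    configVel φ ρ₀ u₀ (X t) (a + 2 * Real.pi) = configVel φ ρ₀ u₀ (X t) a := by
  unfold configVel
  rw [D.velocity_periodic, D.potential_add_two_pi continuous_id, hX.shift D ht,
    D.potential_add_two_pi (hX.continuous_slice t)]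
  ring

theorem solVel_periodic {t : ℝ} (ht : 0 ≤ t) : IsPeriodic (solVel φ ρ₀ u₀ X t) := fun x => by
  unfold solVel
  rw [hX.flowInv_add_two_pi D ht, hX.configVel_add_two_pi D ht]

theorem solDens_periodic {t : ℝ} (ht : 0 ≤ t) : IsPeriodic (solDens φ ρ₀ e₀ X t) := fun x => by
  unfold solDens
  rw [hX.flowInv_add_two_pi D ht, hX.jac_add_two_pi D ht, D.density_periodic]

theorem solVel_flow {t : ℝ} (ht : 0 ≤ t) (a : ℝ) :
    solVel φ ρ₀ u₀ X t (X t a) = configVel φ ρ₀ u₀ (X t) a := by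
  unfold solVel
  rw [hX.flowInv_flow D ht]

theorem solDens_flow {t : ℝ} (ht : 0 ≤ t) (a : ℝ) :
    solDens φ ρ₀ e₀ X t (X t a) = ρ₀ a / jac φ ρ₀ e₀ X t a := by
  unfold solDens
  rw [hX.flowInv_flow D ht]

omit hX in
theorem solDens_nonneg {t : ℝ} (ht : 0 ≤ t) (x : ℝ) : 0 ≤ solDens φ ρ₀ e₀ X t x :=
  div_nonneg (D.density_nonneg _) (jac_pos D ht _).le

theorem solDens_zero (x : ℝ) : solDens φ ρ₀ e₀ X 0 x = ρ₀ x := by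
  unfold solDens
  rw [hX.flowInv_zero D, jac_zero, div_one]

theorem solVel_zero (x : ℝ) : solVel φ ρ₀ u₀ X 0 x = u₀ x := by
  unfold solVel configVel
  have : X 0 = id := funext hX.init
  rw [hX.flowInv_zero D, this]
  simp

theorem measurable_jac {t : ℝ} (ht : 0 ≤ t) : Measurable (jac φ ρ₀ e₀ X t) :=
  (continuousOn_slice_right (hX.continuousOn_jacHom D) ht).measurable.add
    (D.slope_measurable.mul (continuousOn_slice_right (hX.continuousOn_jacSrc D) ht).measurable)

theorem measurable_solDens {t : ℝ} (ht : 0 ≤ t) : Measurable (solDens φ ρ₀ e₀ X t) := by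
  have hY : Measurable (flowInv X t) :=
    (continuousOn_slice_right (hX.continuousOn_flowInv D) ht).measurable
  exact (D.density_measurable.comp hY).div ((hX.measurable_jac D ht).comp hY)

/-- The Jacobian in the density cancels the one of the change of variables. Every integral against
the density is moved to labels in this way. -/
theorem integral_solDens_mul {t : ℝ} (ht : 0 ≤ t) {g : ℝ → ℝ} (hg : IsPeriodic g) :
    ∫ x, solDens φ ρ₀ e₀ X t x * g x ∂torus = ∫ a, g (X t a) * ρ₀ a ∂torus := by
  have hp : IsPeriodic fun x => solDens φ ρ₀ e₀ X t x * g x := fun x => by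
    simp only [hX.solDens_periodic D ht x, hg x]
  rw [hX.integral_comp_flow D ht hp]
  congr 1 with a
  have := (jac_pos D (X := X) ht a).ne'
  simp only [hX.solDens_flow D ht, smul_eq_mul]
  field_simp

theorem memL1Plus_solDens {t : ℝ} (ht : 0 ≤ t) : MemL1Plus (solDens φ ρ₀ e₀ X t) := by
  refine ⟨hX.solDens_periodic D ht, ?_, Eventually.of_forall fun x => solDens_nonneg D ht x⟩
  rw [hX.integrable_comp_flow D ht (hX.solDens_periodic D ht)]
  refine D.density_integrable.congr (Eventually.of_forall fun a => ?_)
  have := (jac_pos D (X := X) ht a).ne'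
  simp only [hX.solDens_flow D ht, smul_eq_mul]
  field_simp

theorem continuousOn_solVel : ContinuousOn (Function.uncurry (solVel φ ρ₀ u₀ X)) spaceTime :=
  (hX.continuous_vel D).comp_continuousOn
    (continuousOn_fst.prodMk (hX.continuousOn_flowInv D))

theorem force_flow {t : ℝ} (ht : 0 ≤ t) (a : ℝ) :
    force φ (solDens φ ρ₀ e₀ X t) (solVel φ ρ₀ u₀ X t) (X t a) = flowForce φ ρ₀ u₀ X t a := by
  have hp : IsPeriodic fun y => φ (X t a - y) *
      (solVel φ ρ₀ u₀ X t y - solVel φ ρ₀ u₀ X t (X t a)) := fun y => by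
    have h1 := D.kernel_periodic.sub_eq (X t a - y)
    rw [sub_sub] at h1
    simp only [h1, hX.solVel_periodic D ht y]
  have h := hX.integral_solDens_mul D ht hp
  unfold force
  have e : ∀ y, φ (X t a - y) * (solVel φ ρ₀ u₀ X t y - solVel φ ρ₀ u₀ X t (X t a)) *
      solDens φ ρ₀ e₀ X t y = solDens φ ρ₀ e₀ X t y * (φ (X t a - y) *
      (solVel φ ρ₀ u₀ X t y - solVel φ ρ₀ u₀ X t (X t a))) := fun y => mul_comm _ _
  simp only [e]
  rw [h]
  have hv : Continuous (configVel φ ρ₀ u₀ (X t)) := D.continuous_configVel (hX.continuous_slice t)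
  unfold flowForce flowConv
  rw [← integral_const_mul, ← integral_sub
    (hX.integrable_kernel_mul D D.kernel_measurable D.kernel_le hv t (X t a))
    ((hX.integrable_kernel_mul D D.kernel_measurable D.kernel_le continuous_const t
      (X t a)).const_mul _)]
  congr 1 with b
  simp only [hX.solVel_flow D ht]
  ring

theorem force_periodic {t : ℝ} (ht : 0 ≤ t) :
    IsPeriodic (force φ (solDens φ ρ₀ e₀ X t) (solVel φ ρ₀ u₀ X t)) := fun x => by
  unfold force
  congr 1 with y
  rw [add_sub_right_comm, D.kernel_periodic, hX.solVel_periodic D ht]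

/-! ### Continuity in time of the density -/

theorem map_torus_le_volume {t : ℝ} (ht : 0 ≤ t) : torus.map (X t) ≤
    ENNReal.ofReal (Real.exp ((K * (∫ x, ρ₀ x ∂torus) + 1) * t)) • volume := by
  refine (hX.map_torus_le D ht).trans (Measure.le_iff'.2 fun s => ?_)
  simp only [Measure.smul_apply, smul_eq_mul]
  gcongr
  exact Measure.restrict_le_self

theorem integral_comp_le_of_integrable {t : ℝ} (ht : 0 ≤ t) {g : ℝ → ℝ} (hg : Measurable g)
    (hg0 : ∀ x, 0 ≤ g x) (hgi : Integrable g) :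
    ∫ b, g (X t b) ∂torus ≤
      Real.exp ((K * (∫ x, ρ₀ x ∂torus) + 1) * t) * ∫ x, g x := by
  rw [← integral_map (hX.continuous_slice t).aemeasurable hg.aestronglyMeasurable]
  refine (integral_mono_measure (hX.map_torus_le_volume D ht) (Eventually.of_forall hg0)
    (hgi.smul_measure ENNReal.ofReal_ne_top)).trans ?_
  rw [integral_smul_measure, ENNReal.toReal_ofReal (Real.exp_pos _).le, smul_eq_mul]

theorem integrable_comp_of_integrable {t : ℝ} (ht : 0 ≤ t) {g : ℝ → ℝ} (hg : Measurable g)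
    (hgi : Integrable g) : Integrable (fun b => g (X t b)) torus := by
  have h := (hgi.smul_measure (c := ENNReal.ofReal (Real.exp ((K * (∫ x, ρ₀ x ∂torus) + 1) * t)))
    ENNReal.ofReal_ne_top).mono_measure (hX.map_torus_le_volume D ht)
  exact (integrable_map_measure hg.aestronglyMeasurable
    (hX.continuous_slice t).aemeasurable).1 h

/-- Continuity of translations, with the flow in place of shifts: g is approximated in L¹ by a
compactly supported continuous η, and the bounded density of the image measure keeps the error small
after composition, uniformly in time. -/
theorem tendsto_integral_comp_sub {t : ℝ} (ht : 0 ≤ t) {g : ℝ → ℝ} (hg : Measurable g)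
    (hgi : Integrable g) :
    Tendsto (fun s => ∫ a, |g (X s a) - g (X t a)| ∂torus) (𝓝[Ici 0] t) (𝓝 0) := by
  set C := Real.exp ((K * (∫ x, ρ₀ x ∂torus) + 1) * (t + 1)) with hC
  have hC0 : 0 < C := Real.exp_pos _
  have hK := D.K_nonneg
  have hm := D.mass_nonneg
  rw [Metric.tendsto_nhds]
  intro ε hε
  obtain ⟨η, hηs, hη, hηc, hηi⟩ := hgi.exists_hasCompactSupport_integral_sub_le
    (show 0 < ε / (4 * C) by positivity)
  obtain ⟨M, hM⟩ := hηs.exists_bound_of_continuous hηc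
  have hlim : Tendsto (fun s => ∫ a, |η (X s a) - η (X t a)| ∂torus) (𝓝[Ici 0] t) (𝓝 0) := by
    have h := tendsto_integral_filter_of_dominated_convergence (μ := torus)
      (l := 𝓝[Ici 0] t) (F := fun s a => |η (X s a) - η (X t a)|) (f := fun _ => 0)
      (fun _ => M + M)
      (Eventually.of_forall fun s => ((hηc.comp (hX.continuous_slice s)).sub
        (hηc.comp (hX.continuous_slice t))).abs.aestronglyMeasurable)
      (Eventually.of_forall fun s => Eventually.of_forall fun a => by
        rw [Real.norm_eq_abs, abs_abs]
        exact (abs_sub _ _).trans (add_le_add (hM _) (hM _)))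
      (integrable_const _)
      (Eventually.of_forall fun a => by
        have h1 := (((hηc.comp (hX.continuous_path a)).sub continuous_const).abs.tendsto t
          (f := fun s => |η (X s a) - η (X t a)|)).mono_left (nhdsWithin_le_nhds (s := Ici 0))
        simpa using h1)
    simpa using h
  have key : ∀ s ∈ Icc 0 (t + 1), ∫ a, |g (X s a) - η (X s a)| ∂torus ≤ ε / 4 := by
    intro s hs
    have h1 := hX.integral_comp_le_of_integrable D hs.1 (g := fun x => |g x - η x|)
      (hg.sub hηc.measurable).norm (fun _ => abs_nonneg _) (hgi.sub hηi).abs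
    have h2 : Real.exp ((K * (∫ x, ρ₀ x ∂torus) + 1) * s) ≤ C := by
      have := hs.2
      rw [hC]
      gcongr
    calc _ ≤ _ := h1
      _ ≤ C * (ε / (4 * C)) := by
        gcongr
        exact hη
      _ = ε / 4 := by field_simp
  have hint : ∀ s ∈ Icc 0 (t + 1), Integrable (fun a => |g (X s a) - η (X s a)|) torus :=
    fun s hs => hX.integrable_comp_of_integrable D hs.1 (g := fun x => |g x - η x|)
      (hg.sub hηc.measurable).norm (hgi.sub hηi).abs
  filter_upwards [hlim.eventually (gt_mem_nhds (half_pos hε)), self_mem_nhdsWithin,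
    mem_nhdsWithin_of_mem_nhds (Iio_mem_nhds (show t < t + 1 by linarith))] with s hs hs0 hs1
  have hsI : s ∈ Icc 0 (t + 1) := ⟨hs0, le_of_lt hs1⟩
  have htI : t ∈ Icc 0 (t + 1) := ⟨ht, by linarith⟩
  have hηint : Integrable (fun a => |η (X s a) - η (X t a)|) torus :=
    integrable_torus_of_continuousOn ((hηc.comp (hX.continuous_slice s)).sub
        (hηc.comp (hX.continuous_slice t))).abs.continuousOn
  have h3 : ∫ a, |g (X s a) - g (X t a)| ∂torus ≤ ∫ a, (|g (X s a) - η (X s a)| +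
      |η (X s a) - η (X t a)| + |g (X t a) - η (X t a)|) ∂torus := by
    refine integral_mono_of_nonneg (Eventually.of_forall fun _ => abs_nonneg _)
      (((hint s hsI).add hηint).add (hint t htI)) (Eventually.of_forall fun a => ?_)
    have h4 := abs_sub_le (g (X s a)) (η (X s a)) (g (X t a))
    have h5 := abs_sub_le (η (X s a)) (η (X t a)) (g (X t a))
    rw [abs_sub_comm (η (X t a)) (g (X t a))] at h5
    simp only
    linarith
  have h6 : Integrable (fun a => |g (X s a) - η (X s a)| + |η (X s a) - η (X t a)|) torus :=
    (hint s hsI).add hηint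
  rw [integral_add h6 (hint t htI), integral_add (hint s hsI) hηint] at h3
  rw [Real.dist_eq, sub_zero, abs_of_nonneg (integral_nonneg fun _ => abs_nonneg _)]
  linarith [key s hsI, key t htI]

theorem exists_jac_bound (T : ℝ) : ∃ C, 0 ≤ C ∧
    ∀ s ∈ Icc 0 T, ∀ a ∈ Icc 0 (2 * Real.pi), jac φ ρ₀ e₀ X s a ≤ C := by
  obtain ⟨M, hM0, hM⟩ := exists_bound_spaceTime (hX.continuousOn_jacHom D) T 0 (2 * Real.pi)
  obtain ⟨N, hN0, hN⟩ := exists_bound_spaceTime (hX.continuousOn_jacSrc D) T 0 (2 * Real.pi)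
  have hK := D.K_nonneg
  refine ⟨M + K * N, by positivity, fun s hs a ha => ?_⟩
  have h1 := (le_abs_self _).trans (hM s hs a ha)
  have h2 := (le_abs_self _).trans (hN s hs a ha)
  have h3 := D.slope_nonneg a
  have h4 := D.slope_le a
  have h5 : e₀ a * jacSrc φ ρ₀ X s a ≤ K * N :=
    mul_le_mul h4 h2 (jacSrc_nonneg hs.1 a) hK
  unfold jac
  linarith

/-- Write f for the density at time t. In labels, both `J_s ρ_s(X_s)` and `J_t f(X_t)` equal `ρ₀`,
so `J_s |ρ_s(X_s) - f(X_s)|` is at most `|f(X_t)| |J_t - J_s| + J_s |f(X_s) - f(X_t)|`. The first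
term is handled by dominated convergence, the second by continuity under composition with the flow.
-/
theorem tendsto_integral_solDens_sub {t : ℝ} (ht : 0 ≤ t) :
    Tendsto (fun s => ∫ x, |solDens φ ρ₀ e₀ X s x - solDens φ ρ₀ e₀ X t x| ∂torus)
      (𝓝[Ici 0] t) (𝓝 0) := by
  obtain ⟨C, hC0, hC⟩ := hX.exists_jac_bound D (t + 1)
  obtain ⟨N, hN0, hN⟩ := exists_bound_spaceTime (hX.cont.continuousOn (s := spaceTime)) (t + 1)
    0 (2 * Real.pi)
  set f : ℝ → ℝ := solDens φ ρ₀ e₀ X t with hf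
  -- A periodic f is not integrable on the line in general. Since N bounds all positions reached
  -- from one period up to time `t + 1`, the truncation is invisible along the flow.
  set g : ℝ → ℝ := (Icc (-N) N).indicator f with hg
  have hfm : Measurable f := hX.measurable_solDens D ht
  have hgm : Measurable g := hfm.indicator measurableSet_Icc
  have hfp : IsPeriodic f := hX.solDens_periodic D ht
  have hgi : Integrable g := by
    rw [hg, integrable_indicator_iff measurableSet_Icc, integrableOn_Icc_iff_integrableOn_Ioc]
    have := hfp.intervalIntegrable₀ two_pi_pos.ne'
      (integrable_torus_iff.1 (hX.memL1Plus_solDens D ht).integrable) (-N) N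
    rwa [intervalIntegrable_iff_integrableOn_Ioc_of_le (by linarith)] at this
  have hgX : ∀ s ∈ Icc 0 (t + 1), ∀ a ∈ Icc 0 (2 * Real.pi), g (X s a) = f (X s a) := by
    intro s hs a ha
    refine indicator_of_mem ?_ _
    exact abs_le.1 (hN s hs a ha)
  have htI : t ∈ Icc 0 (t + 1) := ⟨ht, by linarith⟩
  have hgt : Integrable (fun a => g (X t a)) torus :=
    hX.integrable_comp_of_integrable D ht hgm hgi
  have hnear : ∀ᶠ s in 𝓝[Ici 0] t, s ∈ Icc 0 (t + 1) := by
    filter_upwards [self_mem_nhdsWithin,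
      mem_nhdsWithin_of_mem_nhds (Iio_mem_nhds (show t < t + 1 by linarith))] with s hs0 hs1
    exact ⟨hs0, le_of_lt hs1⟩
  have htor : ∀ {p : ℝ → Prop}, (∀ a ∈ Icc 0 (2 * Real.pi), p a) → ∀ᵐ a ∂torus, p a :=
    fun h => (ae_restrict_iff' measurableSet_Ioc).2
      (Eventually.of_forall fun a ha => h a ⟨ha.1.le, ha.2⟩)
  have hbd : ∀ s ∈ Icc 0 (t + 1), ∀ a ∈ Icc 0 (2 * Real.pi),
      ‖|g (X t a)| * |jac φ ρ₀ e₀ X t a - jac φ ρ₀ e₀ X s a|‖ ≤ |g (X t a)| * (C + C) := by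
    intro s hs a ha
    rw [norm_mul, Real.norm_eq_abs, Real.norm_eq_abs, abs_abs, abs_abs]
    gcongr
    refine (abs_sub _ _).trans (add_le_add ?_ ?_)
    · rw [abs_of_pos (jac_pos D ht a)]; exact hC t htI a ha
    · rw [abs_of_pos (jac_pos D hs.1 a)]; exact hC s hs a ha
  have hmeas : ∀ s ∈ Icc 0 (t + 1), AEStronglyMeasurable
      (fun a => |g (X t a)| * |jac φ ρ₀ e₀ X t a - jac φ ρ₀ e₀ X s a|) torus := fun s hs =>
    ((hgm.comp (hX.continuous_slice t).measurable).norm.mul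
      ((hX.measurable_jac D ht).sub (hX.measurable_jac D hs.1)).norm).aestronglyMeasurable
  have hA : Tendsto (fun s => ∫ a, |g (X t a)| *
      |jac φ ρ₀ e₀ X t a - jac φ ρ₀ e₀ X s a| ∂torus) (𝓝[Ici 0] t) (𝓝 0) := by
    have h := tendsto_integral_filter_of_dominated_convergence (μ := torus)
      (l := 𝓝[Ici 0] t)
      (F := fun s a => |g (X t a)| * |jac φ ρ₀ e₀ X t a - jac φ ρ₀ e₀ X s a|) (f := fun _ => 0)
      (fun a => |g (X t a)| * (C + C))
      (hnear.mono hmeas) (hnear.mono fun s hs => htor (hbd s hs)) (hgt.abs.mul_const _)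
      (Eventually.of_forall fun a => by
        have h1 : Tendsto (fun s => jac φ ρ₀ e₀ X s a) (𝓝[Ici 0] t) (𝓝 (jac φ ρ₀ e₀ X t a)) :=
          (hX.hasDerivWithinAt_jac D a ht).continuousWithinAt
        have h2 := ((tendsto_const_nhds (x := jac φ ρ₀ e₀ X t a)).sub h1).abs.const_mul
          |g (X t a)|
        simpa using h2)
    simpa using h
  have hB := (hX.tendsto_integral_comp_sub D ht hgm hgi).const_mul C
  have hAB := hA.add hB
  simp only [mul_zero, add_zero] at hAB
  refine squeeze_zero' (Eventually.of_forall fun s => integral_nonneg fun _ => abs_nonneg _) ?_ hAB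
  filter_upwards [hnear] with s hs
  have hp : IsPeriodic fun x => |solDens φ ρ₀ e₀ X s x - f x| := fun x => by
    simp only [hX.solDens_periodic D hs.1 x, hfp x]
  rw [hX.integral_comp_flow D hs.1 hp, ← integral_const_mul]
  have hi1 : Integrable (fun a => |g (X t a)| * |jac φ ρ₀ e₀ X t a - jac φ ρ₀ e₀ X s a|) torus :=
    (hgt.abs.mul_const (C + C)).mono' (hmeas s hs) (htor (hbd s hs))
  have hi2 : Integrable (fun a => C * |g (X s a) - g (X t a)|) torus :=
    (((hX.integrable_comp_of_integrable D hs.1 hgm hgi).sub hgt).abs).const_mul C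
  rw [← integral_add hi1 hi2]
  refine integral_mono_of_nonneg (Eventually.of_forall fun a =>
    smul_nonneg (jac_pos D hs.1 a).le (abs_nonneg _)) (hi1.add hi2) (htor fun a ha => ?_)
  have h1 := jac_pos D (X := X) hs.1 a
  have h2 := jac_pos D (X := X) ht a
  simp only [smul_eq_mul]
  rw [hgX s hs a ha, hgX t htI a ha]
  have e1 : jac φ ρ₀ e₀ X s a * |solDens φ ρ₀ e₀ X s (X s a) - f (X s a)| =
      |f (X t a) * (jac φ ρ₀ e₀ X t a - jac φ ρ₀ e₀ X s a) -
        jac φ ρ₀ e₀ X s a * (f (X s a) - f (X t a))| := by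
    rw [← abs_of_pos h1, ← abs_mul, abs_of_pos h1, hX.solDens_flow D hs.1, hf,
      hX.solDens_flow D ht]
    congr 1
    field_simp
    ring
  rw [e1]
  refine (abs_sub _ _).trans ?_
  rw [abs_mul, abs_mul, abs_of_pos h1]
  gcongr
  exact hC s hs a ha

end IsFlow

/-! ### Lipschitz functions as Sobolev functions, and test functions along paths -/

/-- Absolute continuity justifies integration by parts; periodicity kills the boundary terms. -/
theorem memW1Infty_of_lipschitz {f : ℝ → ℝ} (hp : IsPeriodic f) {L : NNReal}
    (hL : LipschitzWith L f) : MemW1Infty f (deriv f) := by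
  have hd : ∀ x, ‖deriv f x‖ ≤ L := fun x => norm_deriv_le_of_lipschitz hL
  refine ⟨hp, ?_, memLp_top_of_bound (measurable_deriv f).aestronglyMeasurable L
    (Eventually.of_forall hd), fun ψ hψ hψp => ?_⟩
  · obtain ⟨M, hM⟩ := isCompact_Icc.exists_bound_of_continuousOn (s := Icc 0 (2 * Real.pi))
      hL.continuous.continuousOn
    exact memLp_top_of_bound hL.continuous.aestronglyMeasurable M
      ((ae_restrict_iff' measurableSet_Ioc).2
        (Eventually.of_forall fun x hx => hM x (Ioc_subset_Icc_self hx)))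
  · have h1 : AbsolutelyContinuousOnInterval f 0 (2 * Real.pi) :=
      hL.lipschitzOnWith.absolutelyContinuousOnInterval
    have h2 : AbsolutelyContinuousOnInterval ψ 0 (2 * Real.pi) :=
      (hψ.of_le (by exact_mod_cast le_top)).contDiffOn.absolutelyContinuousOnInterval
    have h3 := h1.integral_mul_deriv_eq_deriv_mul h2
    rw [integral_torus_eq_intervalIntegral, integral_torus_eq_intervalIntegral, h3]
    have e1 := hp 0
    have e2 := hψp 0
    rw [zero_add] at e1 e2
    rw [e1, e2]
    ring

theorem integral_torus_deriv_eq_zero {q q' : ℝ → ℝ} (hq : IsPeriodic q)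
    (hac : AbsolutelyContinuousOnInterval q 0 (2 * Real.pi))
    (hd : ∀ᵐ a, HasDerivAt q (q' a) a) : ∫ a, q' a ∂torus = 0 := by
  have h1 : ∫ a, q' a ∂torus = ∫ a, deriv q a ∂torus :=
    integral_congr_ae (ae_restrict_of_ae (hd.mono fun a ha => ha.deriv.symm))
  have e1 := hq 0
  rw [zero_add] at e1
  rw [h1, integral_torus_eq_intervalIntegral, hac.integral_deriv_eq_sub, e1, sub_self]

namespace IsTest

variable {ψ : ℝ → ℝ → ℝ} (hψ : IsTest ψ)

include hψ

theorem hasFDerivAt (t x : ℝ) : HasFDerivAt (fun p : ℝ × ℝ => ψ p.1 p.2)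
    (fderiv ℝ (fun p : ℝ × ℝ => ψ p.1 p.2) (t, x)) (t, x) :=
  (hψ.smooth.differentiable (by simp) (t, x)).hasFDerivAt

theorem hasDerivAt_time (t x : ℝ) : HasDerivAt (fun s => ψ s x)
    (fderiv ℝ (fun p : ℝ × ℝ => ψ p.1 p.2) (t, x) (1, 0)) t :=
  (hψ.hasFDerivAt t x).comp_hasDerivAt (f := fun s : ℝ => (s, x)) t
    ((hasDerivAt_id t).prodMk (hasDerivAt_const t x))

theorem hasDerivAt_space (t x : ℝ) : HasDerivAt (ψ t)
    (fderiv ℝ (fun p : ℝ × ℝ => ψ p.1 p.2) (t, x) (0, 1)) x :=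
  (hψ.hasFDerivAt t x).comp_hasDerivAt (f := fun y : ℝ => (t, y)) x
    ((hasDerivAt_const x t).prodMk (hasDerivAt_id x))

theorem continuous_deriv_time : Continuous (Function.uncurry fun t x => deriv (fun s => ψ s x) t) := by
  have : (Function.uncurry fun t x => deriv (fun s => ψ s x) t) =
      fun p => fderiv ℝ (fun p : ℝ × ℝ => ψ p.1 p.2) p (1, 0) :=
    funext fun p => (hψ.hasDerivAt_time p.1 p.2).deriv
  rw [this]
  exact (hψ.smooth.continuous_fderiv (by simp)).clm_apply continuous_const

theorem continuous_deriv_space : Continuous (Function.uncurry fun t x => deriv (ψ t) x) := by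
  have : (Function.uncurry fun t x => deriv (ψ t) x) =
      fun p => fderiv ℝ (fun p : ℝ × ℝ => ψ p.1 p.2) p (0, 1) :=
    funext fun p => (hψ.hasDerivAt_space p.1 p.2).deriv
  rw [this]
  exact (hψ.smooth.continuous_fderiv (by simp)).clm_apply continuous_const

theorem continuous : Continuous (Function.uncurry ψ) := hψ.smooth.continuous

theorem deriv_time_periodic (t : ℝ) : IsPeriodic fun x => deriv (fun s => ψ s x) t := fun x => by
  simp only [hψ.periodic _ x]

theorem deriv_space_periodic (t : ℝ) : IsPeriodic (deriv (ψ t)) := fun x => by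
  have h : ψ t = fun y => ψ t (y + 2 * Real.pi) := funext fun y => (hψ.periodic t y).symm
  conv_rhs => rw [h]
  rw [deriv_comp_add_const]

theorem hasDerivWithinAt_path {X : ℝ → ℝ} {v t : ℝ} {s : Set ℝ} (hX : HasDerivWithinAt X v s t) :
    HasDerivWithinAt (fun r => ψ r (X r))
      (deriv (fun r => ψ r (X t)) t + v * deriv (ψ t) (X t)) s t := by
  have h := (hψ.hasFDerivAt t (X t)).comp_hasDerivWithinAt t
    ((hasDerivWithinAt_id t s).prodMk hX)
  refine h.congr_deriv ?_
  rw [(hψ.hasDerivAt_time t (X t)).deriv, (hψ.hasDerivAt_space t (X t)).deriv, ← smul_eq_mul,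
    ← map_smul, ← map_add]
  simp

end IsTest

/-! ### Lipschitz bounds for the velocity -/

namespace IsFlow

variable {φ ρ₀ u₀ e₀ : ℝ → ℝ} {K : ℝ} {X : ℝ → ℝ → ℝ} (hX : IsFlow φ ρ₀ u₀ X)
  (D : NormalData φ ρ₀ u₀ e₀ K)

include hX D

theorem abs_vel_sub_le (t a b : ℝ) :
    |configVel φ ρ₀ u₀ (X t) a - configVel φ ρ₀ u₀ (X t) b| ≤
      K * |a - b| + K * (∫ x, ρ₀ x ∂torus) * |X t a - X t b| := by
  have h1 : |∫ x in b..a, e₀ x| ≤ K * |a - b| :=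
    intervalIntegral.norm_integral_le_of_norm_le_const fun x _ => by
      rw [Real.norm_eq_abs, abs_of_nonneg (D.slope_nonneg x)]
      exact D.slope_le x
  rw [← D.slope_eq] at h1
  have h2 := D.abs_potential_sub_le_mul (hX.continuous_slice t) (X t a) (X t b)
  have e : configVel φ ρ₀ u₀ (X t) a - configVel φ ρ₀ u₀ (X t) b =
      (u₀ a + potential φ ρ₀ id a - (u₀ b + potential φ ρ₀ id b)) -
      (potential φ ρ₀ (X t) (X t a) - potential φ ρ₀ (X t) (X t b)) := by
    unfold configVel; ring
  rw [e]
  exact (abs_sub _ _).trans (add_le_add h1 h2)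

theorem lipschitz_solVel {t T : ℝ} (ht : 0 ≤ t) (htT : t ≤ T) :
    LipschitzWith (K * Real.exp ((K * (∫ x, ρ₀ x ∂torus) + 1) * T) +
      K * (∫ x, ρ₀ x ∂torus)).toNNReal (solVel φ ρ₀ u₀ X t) := by
  have hK := D.K_nonneg
  have hm := D.mass_nonneg
  refine LipschitzWith.of_dist_le_mul fun x y => ?_
  rw [Real.coe_toNNReal _ (by positivity), Real.dist_eq, Real.dist_eq]
  have h1 := hX.abs_vel_sub_le D t (flowInv X t x) (flowInv X t y)
  rw [hX.flow_flowInv D ht, hX.flow_flowInv D ht] at h1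
  have h2 := hX.abs_flowInv_sub_le D ht x (flowInv X t y)
  rw [hX.flow_flowInv D ht] at h2
  calc _ ≤ _ := h1
    _ ≤ K * (Real.exp ((K * (∫ x, ρ₀ x ∂torus) + 1) * T) * |x - y|) +
        K * (∫ x, ρ₀ x ∂torus) * |x - y| := by
      gcongr
      refine h2.trans ?_
      gcongr
    _ = _ := by ring

theorem exists_solVel_bound (T : ℝ) : ∃ C : ℝ, ∀ t, 0 ≤ t → t ≤ T → ∃ v : ℝ → ℝ,
    MemW1Infty (solVel φ ρ₀ u₀ X t) v ∧ (∀ᵐ x ∂torus, |solVel φ ρ₀ u₀ X t x| ≤ C) ∧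
      (∀ᵐ x ∂torus, |v x| ≤ C) := by
  obtain ⟨M, -, hM⟩ := exists_bound_spaceTime (hX.continuousOn_solVel D) T 0 (2 * Real.pi)
  refine ⟨max M (K * Real.exp ((K * (∫ x, ρ₀ x ∂torus) + 1) * T) +
      K * (∫ x, ρ₀ x ∂torus)).toNNReal, fun t ht htT => ⟨_, memW1Infty_of_lipschitz
      (hX.solVel_periodic D ht) (hX.lipschitz_solVel D ht htT), ?_, Eventually.of_forall fun x =>
      (norm_deriv_le_of_lipschitz (hX.lipschitz_solVel D ht htT)).trans (le_max_right _ _)⟩⟩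
  exact (ae_restrict_iff' measurableSet_Ioc).2 (Eventually.of_forall fun x hx =>
    (hM t ⟨ht, htT⟩ x (Ioc_subset_Icc_self hx)).trans (le_max_left _ _))

/-! ### The weak formulations -/

omit D in
theorem continuous_test {ψ : ℝ → ℝ → ℝ} (hψ : Continuous (Function.uncurry ψ)) :
    Continuous (Function.uncurry fun t a => ψ t (X t a)) :=
  hψ.comp (continuous_fst.prodMk hX.cont)

/-- In labels the weight `ρ₀` is constant in time, so only `ψ t (X t a)` is differentiated. -/
theorem weak_mass {ψ : ℝ → ℝ → ℝ} (hψ : IsTest ψ) {t : ℝ} (ht : 0 ≤ t) :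
    (∫ x, solDens φ ρ₀ e₀ X t x * ψ t x ∂torus) - ∫ x, ρ₀ x * ψ 0 x ∂torus =
      ∫ s in (0 : ℝ)..t, ∫ x, (solDens φ ρ₀ e₀ X s x * deriv (fun r => ψ r x) s +
        solDens φ ρ₀ e₀ X s x * solVel φ ρ₀ u₀ X s x * deriv (ψ s) x) ∂torus := by
  have h := integral_mul_sub_eq D.density_integrable (p := fun s a => ψ s (X s a))
    (p' := fun s a => deriv (fun r => ψ r (X s a)) s +
      configVel φ ρ₀ u₀ (X s) a * deriv (ψ s) (X s a))
    (fun s _ => (hX.continuous_test hψ.continuous).comp (continuous_const.prodMk continuous_id))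
    (fun a s _ => hψ.hasDerivWithinAt_path (hX.hasDerivAt s a).hasDerivWithinAt)
    ((hX.continuous_test hψ.continuous_deriv_time).add
      ((hX.continuous_vel D).mul (hX.continuous_test hψ.continuous_deriv_space))).continuousOn ht
  rw [hX.integral_solDens_mul D ht (hψ.periodic t)]
  have e0 : ∫ x, ρ₀ x * ψ 0 x ∂torus = ∫ a, ψ 0 (X 0 a) * ρ₀ a ∂torus := by
    simp only [hX.init, mul_comm]
  rw [e0, h]
  refine intervalIntegral.integral_congr fun s hs => ?_
  rw [uIcc_of_le ht] at hs
  have hp : IsPeriodic fun x => deriv (fun r => ψ r x) s + solVel φ ρ₀ u₀ X s x * deriv (ψ s) x :=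
    fun x => by
      simp only [hψ.deriv_time_periodic s x, hψ.deriv_space_periodic s x,
        hX.solVel_periodic D hs.1 x]
  have h2 := hX.integral_solDens_mul D hs.1 hp
  simp only [hX.solVel_flow D hs.1] at h2
  rw [← h2]
  congr 1 with x
  ring

/-- As for the mass, now with the velocity times ψ along paths; its derivative brings in the force.
-/
theorem weak_momentum {ψ : ℝ → ℝ → ℝ} (hψ : IsTest ψ) {t : ℝ} (ht : 0 ≤ t) :
    (∫ x, solDens φ ρ₀ e₀ X t x * solVel φ ρ₀ u₀ X t x * ψ t x ∂torus) -
      ∫ x, ρ₀ x * u₀ x * ψ 0 x ∂torus =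
      ∫ s in (0 : ℝ)..t, ∫ x,
        (solDens φ ρ₀ e₀ X s x * solVel φ ρ₀ u₀ X s x * deriv (fun r => ψ r x) s +
        solDens φ ρ₀ e₀ X s x * solVel φ ρ₀ u₀ X s x ^ 2 * deriv (ψ s) x +
        solDens φ ρ₀ e₀ X s x * force φ (solDens φ ρ₀ e₀ X s) (solVel φ ρ₀ u₀ X s) x * ψ s x)
          ∂torus := by
  have h := integral_mul_sub_eq D.density_integrable
    (p := fun s a => configVel φ ρ₀ u₀ (X s) a * ψ s (X s a))
    (p' := fun s a => flowForce φ ρ₀ u₀ X s a * ψ s (X s a) + configVel φ ρ₀ u₀ (X s) a *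
      (deriv (fun r => ψ r (X s a)) s + configVel φ ρ₀ u₀ (X s) a * deriv (ψ s) (X s a)))
    (fun s _ => ((hX.continuous_vel D).mul (hX.continuous_test hψ.continuous)).comp
      (continuous_const.prodMk continuous_id))
    (fun a s hs => (hX.hasDerivWithinAt_vel D a hs).mul
      (hψ.hasDerivWithinAt_path (hX.hasDerivAt s a).hasDerivWithinAt))
    (((hX.continuousOn_flowForce D).mul (hX.continuous_test hψ.continuous).continuousOn).add
      ((hX.continuous_vel D).mul ((hX.continuous_test hψ.continuous_deriv_time).add
      ((hX.continuous_vel D).mul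
        (hX.continuous_test hψ.continuous_deriv_space)))).continuousOn) ht
  have hpt : IsPeriodic fun x => solVel φ ρ₀ u₀ X t x * ψ t x := fun x => by
    simp only [hψ.periodic t x, hX.solVel_periodic D ht x]
  have et := hX.integral_solDens_mul D ht hpt
  simp only [hX.solVel_flow D ht, ← mul_assoc] at et
  have e0 : ∫ x, ρ₀ x * u₀ x * ψ 0 x ∂torus =
      ∫ a, configVel φ ρ₀ u₀ (X 0) a * ψ 0 (X 0 a) * ρ₀ a ∂torus := by
    congr 1 with a
    rw [← hX.solVel_flow D le_rfl, hX.init, hX.solVel_zero D]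
    ring
  rw [et, e0, h]
  refine intervalIntegral.integral_congr fun s hs => ?_
  rw [uIcc_of_le ht] at hs
  have hp : IsPeriodic fun x =>
      force φ (solDens φ ρ₀ e₀ X s) (solVel φ ρ₀ u₀ X s) x * ψ s x + solVel φ ρ₀ u₀ X s x *
        (deriv (fun r => ψ r x) s + solVel φ ρ₀ u₀ X s x * deriv (ψ s) x) :=
    fun x => by
      simp only [hψ.deriv_time_periodic s x, hψ.deriv_space_periodic s x,
        hX.solVel_periodic D hs.1 x, hX.force_periodic D hs.1 x, hψ.periodic s x]
  have h2 := hX.integral_solDens_mul D hs.1 hp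
  simp only [hX.solVel_flow D hs.1, hX.force_flow D hs.1] at h2
  rw [← h2]
  congr 1 with x
  ring

theorem hasDerivWithinAt_jacHom (a : ℝ) {t : ℝ} (ht : 0 ≤ t) :
    HasDerivWithinAt (fun s => jacHom φ ρ₀ X s a)
      (-(flowSlope φ ρ₀ X t a * jacHom φ ρ₀ X t a)) (Ici 0) t := by
  have hc := continuousOn_slice_left (hX.continuousOn_flowSlope D) a
  have h := (hasDerivWithinAt_integral_Ici hc ht).fun_neg.exp
  exact h.congr_deriv (by unfold jacHom; ring)

theorem hasDerivWithinAt_jacSrc (a : ℝ) {t : ℝ} (ht : 0 ≤ t) :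
    HasDerivWithinAt (fun s => jacSrc φ ρ₀ X s a)
      (1 - flowSlope φ ρ₀ X t a * jacSrc φ ρ₀ X t a) (Ici 0) t := by
  have hc := continuousOn_slice_left (hX.continuousOn_flowSlope D) a
  have hc2 : ContinuousOn (fun r => Real.exp (∫ s in (0 : ℝ)..r, flowSlope φ ρ₀ X s a)) (Ici 0) :=
    fun s hs => (hasDerivWithinAt_integral_Ici hc hs).continuousWithinAt.rexp
  have h := (hX.hasDerivWithinAt_jacHom D a ht).mul (hasDerivWithinAt_integral_Ici hc2 ht)
  refine h.congr_deriv ?_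
  have e : jacHom φ ρ₀ X t a * Real.exp (∫ s in (0 : ℝ)..t, flowSlope φ ρ₀ X s a) = 1 := by
    unfold jacHom
    rw [← Real.exp_add]; simp
  rw [e]
  unfold jacSrc
  ring

theorem hasDerivAt_vel_label {a : ℝ}
    (ha : HasDerivAt (fun b => u₀ b + potential φ ρ₀ id b) (e₀ a) a) {t : ℝ} (ht : 0 ≤ t) :
    HasDerivAt (configVel φ ρ₀ u₀ (X t))
      (e₀ a - flowSlope φ ρ₀ X t a * jac φ ρ₀ e₀ X t a) a :=
  ha.sub ((hX.hasDerivAt_potential D ht (X t a)).comp a (hX.hasDerivAt_flow D ha ht))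

/-- The integrand is the label derivative of the periodic function `V² ψ(X) / 2`, with V the
particle velocity. This exact term converts transport by u into the flux `u²/2`. -/
theorem integral_deriv_vel_sq_mul {ψ : ℝ → ℝ → ℝ} (hψ : IsTest ψ) {t : ℝ} (ht : 0 ≤ t) :
    ∫ a, (configVel φ ρ₀ u₀ (X t) a * (e₀ a - flowSlope φ ρ₀ X t a * jac φ ρ₀ e₀ X t a) *
      ψ t (X t a) + configVel φ ρ₀ u₀ (X t) a ^ 2 / 2 *
        (deriv (ψ t) (X t a) * jac φ ρ₀ e₀ X t a)) ∂torus = 0 := by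
  have hK := D.K_nonneg
  have hm := D.mass_nonneg
  have hV : LipschitzWith (K + K * (∫ x, ρ₀ x ∂torus) *
      Real.exp ((K * (∫ x, ρ₀ x ∂torus) + K + 1) * t)).toNNReal (configVel φ ρ₀ u₀ (X t)) := by
    refine LipschitzWith.of_dist_le_mul fun a b => ?_
    have h2 := (hX.lipschitz D ht).dist_le_mul a b
    rw [Real.coe_toNNReal _ (Real.exp_pos _).le, Real.dist_eq, Real.dist_eq] at h2
    rw [Real.coe_toNNReal _ (by positivity), Real.dist_eq, Real.dist_eq, add_mul, mul_assoc]
    refine (hX.abs_vel_sub_le D t a b).trans ?_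
    gcongr
  have hVac := hV.lipschitzOnWith.absolutelyContinuousOnInterval (a := 0) (b := 2 * Real.pi)
  have hψt : ContDiff ℝ 1 (ψ t) :=
    (hψ.smooth.comp (contDiff_const.prodMk contDiff_id)).of_le (by exact_mod_cast le_top)
  obtain ⟨L, hL⟩ := (hψt.contDiffOn (s := X t '' uIcc 0 (2 * Real.pi))).exists_lipschitzOnWith
    (by simp) (by
      rw [(hX.continuous_slice t).continuousOn.image_uIcc]
      exact convex_Icc _ _) (isCompact_uIcc.image (hX.continuous_slice t))
  have hψac : AbsolutelyContinuousOnInterval (fun a => ψ t (X t a)) 0 (2 * Real.pi) :=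
    (hL.comp (hX.lipschitz D ht).lipschitzOnWith
      (mapsTo_image _ _)).absolutelyContinuousOnInterval
  refine integral_torus_deriv_eq_zero
    (q := fun a => (configVel φ ρ₀ u₀ (X t) a * configVel φ ρ₀ u₀ (X t) a) * ψ t (X t a) / 2)
    (fun a => by
      simp only [hX.configVel_add_two_pi D ht, hX.shift D ht, hψ.periodic t (X t a)]) ?_ ?_
  · have := (hVac.fun_mul hVac).fun_mul hψac
    simpa only [div_eq_inv_mul] using this.const_mul 2⁻¹
  · filter_upwards [ae_hasDerivAt_slope D] with a ha
    have h1 := hX.hasDerivAt_vel_label D ha ht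
    have h2 := ((hψt.differentiable (by simp)) (X t a)).hasDerivAt.comp a
      (hX.hasDerivAt_flow D ha ht)
    refine (((h1.mul h1).mul h2).div_const 2).congr_deriv ?_
    simp only [Pi.mul_apply, Function.comp_apply]
    ring

/-- Without the density the weight in labels is the Jacobian, which depends on time and is only
measurable in the label. It splits as `jacHom + e₀ jacSrc`, with factors jointly continuous and
fixed weights 1 and `e₀`, so the template for time integration applies to each part. -/
theorem weak_velocity {ψ : ℝ → ℝ → ℝ} (hψ : IsTest ψ) {t : ℝ} (ht : 0 ≤ t) :
    (∫ x, solVel φ ρ₀ u₀ X t x * ψ t x ∂torus) - ∫ x, u₀ x * ψ 0 x ∂torus =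
      ∫ s in (0 : ℝ)..t, ∫ x, (solVel φ ρ₀ u₀ X s x * deriv (fun r => ψ r x) s +
        solVel φ ρ₀ u₀ X s x ^ 2 / 2 * deriv (ψ s) x +
        force φ (solDens φ ρ₀ e₀ X s) (solVel φ ρ₀ u₀ X s) x * ψ s x) ∂torus := by
  set V : ℝ → ℝ → ℝ := fun s a => configVel φ ρ₀ u₀ (X s) a with hV
  set Q : ℝ → ℝ → ℝ := fun s a => V s a * ψ s (X s a) with hQ
  set Q' : ℝ → ℝ → ℝ := fun s a => flowForce φ ρ₀ u₀ X s a * ψ s (X s a) + V s a *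
      (deriv (fun r => ψ r (X s a)) s + V s a * deriv (ψ s) (X s a)) with hQ'
  have hVc : Continuous (Function.uncurry V) := hX.continuous_vel D
  have hQc : Continuous (Function.uncurry Q) := hVc.mul (hX.continuous_test hψ.continuous)
  have hQd : ∀ a s, 0 ≤ s → HasDerivWithinAt (fun s => Q s a) (Q' s a) (Ici 0) s := fun a s hs =>
    (hX.hasDerivWithinAt_vel D a hs).mul
      (hψ.hasDerivWithinAt_path (hX.hasDerivAt s a).hasDerivWithinAt)
  have hQ'c : ContinuousOn (Function.uncurry Q') spaceTime :=
    ((hX.continuousOn_flowForce D).mul (hX.continuous_test hψ.continuous).continuousOn).add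
      (hVc.mul ((hX.continuous_test hψ.continuous_deriv_time).add
      (hVc.mul (hX.continuous_test hψ.continuous_deriv_space)))).continuousOn
  have hone : Integrable (fun _ : ℝ => (1 : ℝ)) torus := integrable_const _
  have he₀ : Integrable e₀ torus :=
    integrable_torus_iff.2 (D.slope_intervalIntegrable 0 (2 * Real.pi))
  set A : ℝ → ℝ → ℝ := fun s a => Q' s a * jacHom φ ρ₀ X s a +
    Q s a * -(flowSlope φ ρ₀ X s a * jacHom φ ρ₀ X s a) with hA
  set B : ℝ → ℝ → ℝ := fun s a => Q' s a * jacSrc φ ρ₀ X s a +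
    Q s a * (1 - flowSlope φ ρ₀ X s a * jacSrc φ ρ₀ X s a) with hB
  have hAc : ContinuousOn (Function.uncurry A) spaceTime :=
    (hQ'c.mul (hX.continuousOn_jacHom D)).add (hQc.continuousOn.mul
      ((hX.continuousOn_flowSlope D).mul (hX.continuousOn_jacHom D)).neg)
  have hBc : ContinuousOn (Function.uncurry B) spaceTime :=
    (hQ'c.mul (hX.continuousOn_jacSrc D)).add (hQc.continuousOn.mul
      (continuousOn_const.sub ((hX.continuousOn_flowSlope D).mul (hX.continuousOn_jacSrc D))))
  have hpA : ∀ s, 0 ≤ s → Continuous fun a => Q s a * jacHom φ ρ₀ X s a := fun s hs =>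
    (hQc.comp (continuous_const.prodMk continuous_id)).mul
      (continuousOn_slice_right (hX.continuousOn_jacHom D) hs)
  have hpB : ∀ s, 0 ≤ s → Continuous fun a => Q s a * jacSrc φ ρ₀ X s a := fun s hs =>
    (hQc.comp (continuous_const.prodMk continuous_id)).mul
      (continuousOn_slice_right (hX.continuousOn_jacSrc D) hs)
  have h1 := integral_mul_sub_eq hone (p := fun s a => Q s a * jacHom φ ρ₀ X s a) (p' := A)
    hpA (fun a s hs => (hQd a s hs).mul (hX.hasDerivWithinAt_jacHom D a hs)) hAc ht
  have h2 := integral_mul_sub_eq he₀ (p := fun s a => Q s a * jacSrc φ ρ₀ X s a) (p' := B)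
    hpB (fun a s hs => (hQd a s hs).mul (hX.hasDerivWithinAt_jacSrc D a hs)) hBc ht
  have hiA : ∀ s, 0 ≤ s → Integrable (fun a => Q s a * jacHom φ ρ₀ X s a * 1) torus := fun s hs =>
    integrable_continuousOn_mul (hpA s hs).continuousOn hone
  have hiB : ∀ s, 0 ≤ s → Integrable (fun a => Q s a * jacSrc φ ρ₀ X s a * e₀ a) torus :=
    fun s hs => integrable_continuousOn_mul (hpB s hs).continuousOn he₀
  have hiA' : ∀ s, 0 ≤ s → Integrable (fun a => A s a * 1) torus := fun s hs =>
    integrable_continuousOn_mul (continuousOn_slice_right hAc hs).continuousOn hone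
  have hiB' : ∀ s, 0 ≤ s → Integrable (fun a => B s a * e₀ a) torus := fun s hs =>
    integrable_continuousOn_mul (continuousOn_slice_right hBc hs).continuousOn he₀
  have hlhs : ∀ s, 0 ≤ s → ∫ x, solVel φ ρ₀ u₀ X s x * ψ s x ∂torus =
      (∫ a, Q s a * jacHom φ ρ₀ X s a * 1 ∂torus) +
        ∫ a, Q s a * jacSrc φ ρ₀ X s a * e₀ a ∂torus := by
    intro s hs
    have hp : IsPeriodic fun x => solVel φ ρ₀ u₀ X s x * ψ s x := fun x => by
      simp only [hψ.periodic s x, hX.solVel_periodic D hs x]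
    rw [hX.integral_comp_flow D hs hp, ← integral_add (hiA s hs) (hiB s hs)]
    congr 1 with a
    simp only [hX.solVel_flow D hs, hQ, hV, jac, smul_eq_mul]
    ring
  have e0 : ∫ x, u₀ x * ψ 0 x ∂torus = ∫ x, solVel φ ρ₀ u₀ X 0 x * ψ 0 x ∂torus := by
    simp only [hX.solVel_zero D]
  have hcA : ContinuousOn (fun s => ∫ a, A s a * 1 ∂torus) (Ici 0) := by
    have h := continuousOn_integral_smul hone (F := A) (S := Ici 0)
      (hAc.mono (prod_mono_right (subset_univ _)))
    simpa [mul_comm] using h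
  have hcB : ContinuousOn (fun s => ∫ a, B s a * e₀ a ∂torus) (Ici 0) := by
    have h := continuousOn_integral_smul he₀ (F := B) (S := Ici 0)
      (hBc.mono (prod_mono_right (subset_univ _)))
    simpa [mul_comm] using h
  have hii : ∀ {f : ℝ → ℝ}, ContinuousOn f (Ici 0) → IntervalIntegrable f volume 0 t := fun hf =>
    (hf.mono (by rw [uIcc_of_le ht]; exact Icc_subset_Ici_self)).intervalIntegrable
  rw [e0, hlhs t ht, hlhs 0 le_rfl, add_sub_add_comm, h1, h2,
    ← intervalIntegral.integral_add (hii hcA) (hii hcB)]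
  refine intervalIntegral.integral_congr fun s hs => ?_
  rw [uIcc_of_le ht] at hs
  have hp : IsPeriodic fun x => solVel φ ρ₀ u₀ X s x * deriv (fun r => ψ r x) s +
      solVel φ ρ₀ u₀ X s x ^ 2 / 2 * deriv (ψ s) x +
      force φ (solDens φ ρ₀ e₀ X s) (solVel φ ρ₀ u₀ X s) x * ψ s x := fun x => by
    simp only [hψ.deriv_time_periodic s x, hψ.deriv_space_periodic s x,
        hX.solVel_periodic D hs.1 x, hX.force_periodic D hs.1 x, hψ.periodic s x]
  have hz := hX.integral_deriv_vel_sq_mul D hψ hs.1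
  rw [hX.integral_comp_flow D hs.1 hp, ← integral_add (hiA' s hs.1) (hiB' s hs.1)]
  have hsum : Integrable (fun a => A s a * 1 + B s a * e₀ a) torus :=
    (hiA' s hs.1).add (hiB' s hs.1)
  -- The Eulerian integrand in labels equals the time derivative of `V ψ(X) J` minus an exact label
  -- derivative, because the label derivative of V is the time derivative of J.
  have key : ∀ a, jac φ ρ₀ e₀ X s a • (solVel φ ρ₀ u₀ X s (X s a) *
      deriv (fun r => ψ r (X s a)) s + solVel φ ρ₀ u₀ X s (X s a) ^ 2 / 2 * deriv (ψ s) (X s a) +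
      force φ (solDens φ ρ₀ e₀ X s) (solVel φ ρ₀ u₀ X s) (X s a) * ψ s (X s a)) =
      (A s a * 1 + B s a * e₀ a) -
      (configVel φ ρ₀ u₀ (X s) a * (e₀ a - flowSlope φ ρ₀ X s a * jac φ ρ₀ e₀ X s a) *
      ψ s (X s a) + configVel φ ρ₀ u₀ (X s) a ^ 2 / 2 *
        (deriv (ψ s) (X s a) * jac φ ρ₀ e₀ X s a)) := by
    intro a
    simp only [hX.solVel_flow D hs.1, hX.force_flow D hs.1, hA, hB, hQ, hQ', hV, jac, smul_eq_mul]
    ring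
  have hVs : Continuous fun a => configVel φ ρ₀ u₀ (X s) a :=
    hVc.comp (continuous_const.prodMk continuous_id)
  have hψs : Continuous fun a => ψ s (X s a) :=
    (hX.continuous_test hψ.continuous).comp (continuous_const.prodMk continuous_id)
  have hψxs : Continuous fun a => deriv (ψ s) (X s a) :=
    (hX.continuous_test hψ.continuous_deriv_space).comp (continuous_const.prodMk continuous_id)
  have hjac : Integrable (jac φ ρ₀ e₀ X s) torus :=
    (integrable_torus_of_continuousOn
      (continuousOn_slice_right (hX.continuousOn_jacHom D) hs.1).continuousOn).add (by
        have := integrable_continuousOn_mul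
          (continuousOn_slice_right (hX.continuousOn_jacSrc D) hs.1).continuousOn he₀
        exact this.congr (Eventually.of_forall fun a => mul_comm _ _))
  have hzi : Integrable (fun a => configVel φ ρ₀ u₀ (X s) a *
      (e₀ a - flowSlope φ ρ₀ X s a * jac φ ρ₀ e₀ X s a) * ψ s (X s a) +
      configVel φ ρ₀ u₀ (X s) a ^ 2 / 2 *
        (deriv (ψ s) (X s a) * jac φ ρ₀ e₀ X s a)) torus := by
    have i1 := integrable_continuousOn_mul (hVs.mul hψs).continuousOn (he₀.sub
      (integrable_continuousOn_mul
        (continuousOn_slice_right (hX.continuousOn_flowSlope D) hs.1).continuousOn hjac))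
    have i2 := integrable_continuousOn_mul (((hVs.pow 2).div_const 2).mul hψxs).continuousOn hjac
    refine (i1.add i2).congr (Eventually.of_forall fun a => ?_)
    simp only [Pi.add_apply, Pi.sub_apply, Pi.mul_apply, Pi.pow_apply]
    ring
  simp only [key]
  rw [integral_sub hsum hzi, hz, sub_zero]

theorem isGlobalSolution :
    IsGlobalSolution φ ρ₀ u₀ (solDens φ ρ₀ e₀ X) (solVel φ ρ₀ u₀ X) where
  density_mem _ ht := hX.memL1Plus_solDens D ht
  density_continuous _ ht := hX.tendsto_integral_solDens_sub D ht
  velocity_continuous := hX.continuousOn_solVel D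
  velocity_mem T := hX.exists_solVel_bound D T
  initial_density := Eventually.of_forall (hX.solDens_zero D)
  initial_velocity := Eventually.of_forall (hX.solVel_zero D)
  mass _ hψ _ ht := hX.weak_mass D hψ ht
  momentum _ hψ _ ht := hX.weak_momentum D hψ ht
  velocity _ hψ _ ht := hX.weak_velocity D hψ ht

end IsFlow

/-! ### Convolution on the torus of vector-valued functions -/

section Convolution

variable {E : Type*} [NormedAddCommGroup E] [NormedSpace ℝ E]

/-- Convolution on the torus of a scalar kernel with a vector-valued function. -/
def tconv (φ : ℝ → ℝ) (f : ℝ → E) (x : ℝ) : E := ∫ z, φ z • f (x - z) ∂torus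

theorem integral_torus_sub_left {g : ℝ → E} (hg : Function.Periodic g (2 * Real.pi)) (x : ℝ) :
    ∫ z, g (x - z) ∂torus = ∫ z, g z ∂torus := by
  rw [integral_torus_eq_intervalIntegral, intervalIntegral.integral_comp_sub_left,
    integral_torus_eq_shift hg (x - 2 * Real.pi)]
  simp

theorem conv_eq_tconv {φ ρ : ℝ → ℝ} (hφ : IsPeriodic φ) (hρ : IsPeriodic ρ) (x : ℝ) :
    conv φ ρ x = tconv φ ρ x := by
  have hp : IsPeriodic fun z => φ z * ρ (x - z) := fun z => by
    have h1 := hρ.sub_eq (x - z)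
    rw [sub_sub] at h1
    simp only [hφ z, h1]
  have := integral_torus_sub_left hp x
  simp only [sub_sub_cancel] at this
  exact this

theorem integrable_tconv {φ : ℝ → ℝ} (hφ : Integrable φ torus) {f : ℝ → E} (hf : Continuous f)
    (x : ℝ) : Integrable (fun z => φ z • f (x - z)) torus :=
  integrable_smul_continuousOn hφ (by fun_prop)

theorem tconv_periodic {φ : ℝ → ℝ} {f : ℝ → E} (hf : Function.Periodic f (2 * Real.pi)) :
    Function.Periodic (tconv φ f) (2 * Real.pi) := fun x => by
  unfold tconv
  congr 1 with z
  rw [add_sub_right_comm, hf]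

theorem tconv_add {φ : ℝ → ℝ} (hφ : IsPeriodic φ) {f : ℝ → E}
    (hf : Function.Periodic f (2 * Real.pi)) (x r : ℝ) :
    tconv φ f (x + r) = ∫ z, φ (z + r) • f (x - z) ∂torus := by
  have hp : Function.Periodic (fun z => φ z • f (x + r - z)) (2 * Real.pi) := fun z => by
    have h1 := hf.sub_eq (x + r - z)
    rw [sub_sub] at h1
    simp only [hφ z, h1]
  have e : (fun z => φ (z + r) • f (x - z)) = fun z => (fun y => φ y • f (x + r - y)) (z + r) := by
    funext z
    simp only [add_sub_add_right_eq_sub]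
  rw [e, integral_torus_eq_intervalIntegral, intervalIntegral.integral_comp_add_right
    (fun y => φ y • f (x + r - y))]
  unfold tconv
  rw [integral_torus_eq_shift hp r]
  simp [add_comm]

theorem norm_integral_smul_le {φ : ℝ → ℝ} (hφ : Integrable φ torus) {f : ℝ → E} {C : ℝ}
    (hC : ∀ z, ‖f z‖ ≤ C) : ‖∫ z, φ z • f z ∂torus‖ ≤ (∫ z, |φ z| ∂torus) * C := by
  rw [← integral_mul_const]
  refine norm_integral_le_of_norm_le (hφ.abs.mul_const _) (Eventually.of_forall fun z => ?_)
  rw [norm_smul, Real.norm_eq_abs]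
  exact mul_le_mul_of_nonneg_left (hC z) (abs_nonneg _)

theorem norm_tconv_sub_le {φ : ℝ → ℝ} (hφ : Integrable φ torus) {f : ℝ → E} (hf : Continuous f)
    {x y C : ℝ} (hC : ∀ z, ‖f (x - z) - f (y - z)‖ ≤ C) :
    ‖tconv φ f x - tconv φ f y‖ ≤ (∫ z, |φ z| ∂torus) * C := by
  unfold tconv
  rw [← integral_sub (integrable_tconv hφ hf x) (integrable_tconv hφ hf y)]
  simp only [← smul_sub]
  exact norm_integral_smul_le hφ hC

theorem tconv_sub_kernel {φ η : ℝ → ℝ} (hφ : Integrable φ torus) (hη : Integrable η torus)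
    {f : ℝ → E} (hf : Continuous f) (x : ℝ) :
    tconv (fun z => φ z - η z) f x = tconv φ f x - tconv η f x := by
  unfold tconv
  rw [← integral_sub (integrable_tconv hφ hf x) (integrable_tconv hη hf x)]
  simp only [sub_smul]

theorem continuousOn_tconv {φ : ℝ → ℝ} (hφ : Integrable φ torus) {f : ℝ → ℝ → E}
    (hf : ContinuousOn (Function.uncurry f) spaceTime) :
    ContinuousOn (Function.uncurry fun t x => tconv φ (f t) x) spaceTime :=
  continuousOn_integral_smul hφ (F := fun (p : ℝ × ℝ) z => f p.1 (p.2 - z))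
    (hf.comp (f := fun q : (ℝ × ℝ) × ℝ => (q.1.1, q.1.2 - q.2)) (by fun_prop)
      fun q hq => ⟨hq.1.1, trivial⟩)

theorem tconv_prod {G : Type*} [NormedAddCommGroup G] [NormedSpace ℝ G] [CompleteSpace E]
    [CompleteSpace G] {φ : ℝ → ℝ} (hφ : Integrable φ torus) {f : ℝ → E} {g : ℝ → G}
    (hf : Continuous f) (hg : Continuous g) (x : ℝ) :
    tconv φ (fun y => (f y, g y)) x = (tconv φ f x, tconv φ g x) :=
  integral_pair (integrable_tconv hφ hf x) (integrable_tconv hφ hg x)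

theorem hasDerivAt_tconv {φ : ℝ → ℝ} (hφ : Integrable φ torus) {f g : ℝ → E}
    (hf : ∀ x, HasDerivAt f (g x) x) (hg : Continuous g) (x : ℝ) :
    HasDerivAt (tconv φ f) (tconv φ g x) x := by
  have hfc : Continuous f := continuous_iff_continuousAt.2 fun x => (hf x).continuousAt
  obtain ⟨M, hM⟩ := isCompact_Icc.exists_bound_of_continuousOn
    (s := Icc (x - 1 - 2 * Real.pi) (x + 1)) hg.continuousOn
  refine (hasDerivAt_integral_of_dominated_loc_of_deriv_le (μ := torus)
    (F := fun y z => φ z • f (y - z)) (F' := fun y z => φ z • g (y - z))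
    (bound := fun z => |φ z| * M) (Metric.ball_mem_nhds x one_pos)
    (Eventually.of_forall fun y => (integrable_tconv hφ hfc y).aestronglyMeasurable)
    (integrable_tconv hφ hfc x) (integrable_tconv hφ hg x).aestronglyMeasurable ?_
    (hφ.abs.mul_const _) (Eventually.of_forall fun z y _ => ?_)).2
  · refine (ae_restrict_iff' measurableSet_Ioc).2 (Eventually.of_forall fun z hz y hy => ?_)
    rw [norm_smul, Real.norm_eq_abs]
    refine mul_le_mul_of_nonneg_left (hM _ ?_) (abs_nonneg _)
    rw [Metric.mem_ball, Real.dist_eq, abs_lt] at hy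
    exact ⟨by linarith [hz.2], by linarith [hz.1]⟩
  · exact ((hf (y - z)).comp_sub_const y z).const_smul (φ z)

theorem integral_smul_sub_eq [CompleteSpace E] {r : ℝ → ℝ} (hr : Integrable r torus)
    {p p' : ℝ → ℝ → E} (hp : ∀ t, 0 ≤ t → Continuous (p t))
    (hd : ∀ a t, 0 ≤ t → HasDerivWithinAt (fun s => p s a) (p' t a) (Ici 0) t)
    (hp' : ContinuousOn (Function.uncurry p') spaceTime) {t : ℝ} (ht : 0 ≤ t) :
    (∫ a, r a • p t a ∂torus) - ∫ a, r a • p 0 a ∂torus =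
      ∫ s in (0 : ℝ)..t, ∫ a, r a • p' s a ∂torus := by
  obtain ⟨M, -, hM⟩ := exists_bound_spaceTime hp' t 0 (2 * Real.pi)
  have hmeas : AEStronglyMeasurable (Function.uncurry p')
      ((volume.restrict (uIoc 0 t)).prod torus) := by
    rw [Measure.prod_restrict]
    refine (hp'.mono fun z hz => ?_).aestronglyMeasurable
      (measurableSet_uIoc.prod measurableSet_Ioc)
    rw [uIoc_of_le ht] at hz
    exact ⟨mem_Ici.2 hz.1.1.le, trivial⟩
  have hfin : IsFiniteMeasure (volume.restrict (uIoc 0 t)) := by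
    unfold uIoc
    infer_instance
  have hi : Integrable (Function.uncurry fun s a => r a • p' s a)
      ((volume.restrict (uIoc 0 t)).prod torus) := by
    have h1 : Integrable (fun z : ℝ × ℝ => M * |r z.2|)
      ((volume.restrict (uIoc 0 t)).prod torus) := (integrable_const M).mul_prod hr.abs
    refine h1.mono' (hr.aestronglyMeasurable.comp_snd.smul hmeas) ?_
    rw [Measure.prod_restrict]
    refine (ae_restrict_iff' (measurableSet_uIoc.prod measurableSet_Ioc)).2
      (Eventually.of_forall fun z hz => ?_)
    simp only [Function.uncurry, norm_smul, Real.norm_eq_abs]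
    rw [mul_comm]
    have hz1 := hz.1
    rw [uIoc_of_le ht] at hz1
    exact mul_le_mul_of_nonneg_right (hM z.1 ⟨hz1.1.le, hz1.2⟩ z.2 (Ioc_subset_Icc_self hz.2))
      (abs_nonneg _)
  rw [intervalIntegral_integral_swap hi,
    ← integral_sub (integrable_smul_continuousOn hr (hp t ht).continuousOn)
      (integrable_smul_continuousOn hr (hp 0 le_rfl).continuousOn)]
  congr 1 with a
  rw [intervalIntegral.integral_smul,
    integral_eq_sub_of_hasDerivWithinAt_Ici (hd a) (continuousOn_slice_left hp' a) ht, smul_sub]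

theorem hasDerivWithinAt_tconv [CompleteSpace E] {φ : ℝ → ℝ} (hφ : Integrable φ torus)
    {f ft : ℝ → ℝ → E} (hc : ∀ t, 0 ≤ t → Continuous (f t))
    (hf : ∀ t, 0 ≤ t → ∀ x, HasDerivWithinAt (fun s => f s x) (ft t x) (Ici 0) t)
    (hft : ContinuousOn (Function.uncurry ft) spaceTime) {t : ℝ} (ht : 0 ≤ t) (x : ℝ) :
    HasDerivWithinAt (fun s => tconv φ (f s) x) (tconv φ (ft t) x) (Ici 0) t := by
  have h := (hasDerivWithinAt_integral_Ici
    (continuousOn_slice_left (continuousOn_tconv hφ hft) x) ht).const_add (tconv φ (f 0) x)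
  refine h.congr_of_mem (fun s hs => ?_) ht
  have h2 := integral_smul_sub_eq hφ (p := fun s z => f s (x - z)) (p' := fun s z => ft s (x - z))
    (fun s hs => (hc s hs).comp (by fun_prop)) (fun a s hs => hf s hs (x - a))
    (hft.comp (f := fun q : ℝ × ℝ => (q.1, x - q.2)) (by fun_prop) fun q hq => ⟨hq.1, trivial⟩)
    (mem_Ici.1 hs)
  change tconv φ (f s) x = tconv φ (f 0) x + _
  unfold tconv
  rw [← h2]
  abel

theorem exists_partial_of_contDiffOn {n : ℕ} {f : ℝ → ℝ → E}
    (hf : ContDiffOn ℝ (n + 1 : ℕ) (Function.uncurry f) spaceTime) :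
    ∃ ft fx : ℝ → ℝ → E,
      (∀ t, 0 ≤ t → ∀ x, HasDerivWithinAt (fun s => f s x) (ft t x) (Ici 0) t) ∧
      (∀ t, 0 ≤ t → ∀ x, HasDerivAt (f t) (fx t x) x) ∧
      ContDiffOn ℝ n (Function.uncurry ft) spaceTime ∧
      ContDiffOn ℝ n (Function.uncurry fx) spaceTime := by
  have hfd : ∀ p ∈ spaceTime, HasFDerivWithinAt (Function.uncurry f)
      (fderivWithin ℝ (Function.uncurry f) spaceTime p) spaceTime p := fun p hp =>
    ((hf.differentiableOn (by simp)) p hp).hasFDerivWithinAt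
  have hD : ContDiffOn ℝ n (fderivWithin ℝ (Function.uncurry f) spaceTime) spaceTime :=
    hf.fderivWithin uniqueDiffOn_spaceTime (by push_cast; exact le_rfl)
  refine ⟨fun t x => fderivWithin ℝ (Function.uncurry f) spaceTime (t, x) (1, 0),
    fun t x => fderivWithin ℝ (Function.uncurry f) spaceTime (t, x) (0, 1),
    fun t ht x => ?_, fun t ht x => ?_, hD.clm_apply contDiffOn_const,
    hD.clm_apply contDiffOn_const⟩
  · exact (hfd (t, x) ⟨ht, trivial⟩).comp_hasDerivWithinAt (f := fun s : ℝ => (s, x)) t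
      ((hasDerivWithinAt_id t (Ici 0)).prodMk (hasDerivWithinAt_const t _ x))
      fun s hs => ⟨hs, trivial⟩
  · have h := (hfd (t, x) ⟨ht, trivial⟩).comp_hasDerivWithinAt (f := fun y : ℝ => (t, y))
      (s := univ) x
      ((hasDerivWithinAt_const x _ t).prodMk (hasDerivWithinAt_id x univ))
      fun s hs => ⟨ht, trivial⟩
    exact hasDerivWithinAt_univ.1 h

/-- All derivatives, in time and in space, fall on f; the kernel need only be integrable. -/
theorem contDiffOn_tconv [CompleteSpace E] {φ : ℝ → ℝ} (hφ : Integrable φ torus) (n : ℕ)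
    {f : ℝ → ℝ → E} (hf : ContDiffOn ℝ n (Function.uncurry f) spaceTime) :
    ContDiffOn ℝ n (Function.uncurry fun t x => tconv φ (f t) x) spaceTime := by
  induction n generalizing f with
  | zero =>
    rw [Nat.cast_zero, contDiffOn_zero] at hf ⊢
    exact continuousOn_tconv hφ hf
  | succ n ih =>
    obtain ⟨ft, fx, h1, h2, h3, h4⟩ := exists_partial_of_contDiffOn hf
    exact contDiffOn_succ_of_partial
      (fun t ht x => hasDerivWithinAt_tconv hφ
        (fun s hs => continuousOn_slice_right hf.continuousOn hs) h1 h3.continuousOn ht x)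
      (fun t ht x => hasDerivAt_tconv hφ (h2 t ht) (continuousOn_slice_right h4.continuousOn ht) x)
      (ih h3) (ih h4)

variable {φ ρ₀ u₀ e₀ : ℝ → ℝ} {K : ℝ}

namespace NormalData

variable (D : NormalData φ ρ₀ u₀ e₀ K)

include D

theorem kernel_integrable : Integrable φ torus :=
  integrable_torus_iff.2 (D.kernel_intervalIntegrable _ _)

theorem steklov_integrable (n : ℕ) : Integrable (steklov φ n) torus :=
  integrable_torus_of_continuousOn (D.continuous_steklov n).continuousOn

/-- Fubini moves the average from the kernel to the convolution. So `φₙ * f` is an average of the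
continuous function `φ * f`, hence differentiable for merely continuous f. -/
theorem tconv_steklov [CompleteSpace E] {f : ℝ → E} (hf : Continuous f)
    (hfp : Function.Periodic f (2 * Real.pi)) (n : ℕ) (x : ℝ) :
    tconv (steklov φ n) f x =
      ((n : ℝ) + 1) • ∫ y in x..(x + ((n : ℝ) + 1)⁻¹), tconv φ f y := by
  set h := ((n : ℝ) + 1)⁻¹ with hh
  have hfin : IsFiniteMeasure (volume.restrict (uIoc 0 h)) := by
    unfold uIoc
    infer_instance
  obtain ⟨M, hM⟩ := isCompact_Icc.exists_bound_of_continuousOn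
    (s := Icc 0 (2 * Real.pi)) (f := fun z => f (x - z)) (by fun_prop)
  have hi : Integrable (Function.uncurry fun r z => φ (z + r) • f (x - z))
      ((volume.restrict (uIoc 0 h)).prod torus) := by
    refine Integrable.mono' (g := fun _ => K * M) (integrable_const _)
      (((D.kernel_measurable.comp (measurable_snd.add measurable_fst)).aestronglyMeasurable).smul
        (hf.comp (continuous_const.sub continuous_snd)).aestronglyMeasurable) ?_
    rw [Measure.prod_restrict]
    refine (ae_restrict_iff' (measurableSet_uIoc.prod measurableSet_Ioc)).2
      (Eventually.of_forall fun z hz => ?_)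
    simp only [Function.uncurry, norm_smul, Real.norm_eq_abs]
    exact mul_le_mul (D.kernel_le _) (hM _ (Ioc_subset_Icc_self hz.2)) (norm_nonneg _) D.K_nonneg
  have e1 : ∫ y in x..(x + h), tconv φ f y = ∫ r in (0 : ℝ)..h, tconv φ f (x + r) := by
    rw [intervalIntegral.integral_comp_add_left (fun y => tconv φ f y), add_zero]
  rw [e1]
  simp only [tconv_add D.kernel_periodic hfp]
  rw [intervalIntegral_integral_swap hi, ← integral_smul]
  unfold tconv
  congr 1 with z
  rw [intervalIntegral.integral_smul_const, smul_smul,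
    intervalIntegral.integral_comp_add_left (fun y => φ y), add_zero]
  unfold steklov
  rw [prim_sub_prim D.kernel_intervalIntegrable]

theorem hasDerivAt_tconv_steklov [CompleteSpace E] {f : ℝ → E} (hf : Continuous f)
    (hfp : Function.Periodic f (2 * Real.pi)) (hc : Continuous (tconv φ f)) (n : ℕ) (x : ℝ) :
    HasDerivAt (tconv (steklov φ n) f)
      (((n : ℝ) + 1) • (tconv φ f (x + ((n : ℝ) + 1)⁻¹) - tconv φ f x)) x := by
  have e : tconv (steklov φ n) f = fun x => ((n : ℝ) + 1) •
      ((∫ y in (0 : ℝ)..(x + ((n : ℝ) + 1)⁻¹), tconv φ f y) - ∫ y in (0 : ℝ)..x, tconv φ f y) := by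
    funext y
    rw [D.tconv_steklov hf hfp, intervalIntegral.integral_interval_sub_left
      (hc.intervalIntegrable _ _) (hc.intervalIntegrable _ _)]
  rw [e]
  exact (((hc.integral_hasStrictDerivAt 0 _).hasDerivAt.comp_add_const x _).sub
    (hc.integral_hasStrictDerivAt 0 x).hasDerivAt).const_smul _

/-- The convolution of a bounded kernel with a function that is Lipschitz in space, locally
uniformly in time, is continuously differentiable in space. -/
theorem exists_hasDerivAt_tconv [CompleteSpace E] {f : ℝ → ℝ → E}
    (hf : ContinuousOn (Function.uncurry f) spaceTime)
    (hfp : ∀ t, 0 ≤ t → Function.Periodic (f t) (2 * Real.pi))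
    (hL : ∀ T, ∃ L, ∀ t ∈ Icc 0 T, ∀ x y, ‖f t x - f t y‖ ≤ L * |x - y|) :
    ∃ cx : ℝ → ℝ → E, (∀ t, 0 ≤ t → ∀ x, HasDerivAt (tconv φ (f t)) (cx t x) x) ∧
      ContinuousOn (Function.uncurry cx) spaceTime := by
  have hφ := D.kernel_integrable
  have hcc := continuousOn_tconv hφ hf
  have hfc : ∀ t, 0 ≤ t → Continuous (f t) := fun t ht => continuousOn_slice_right hf ht
  set d : ℕ → ℝ → ℝ → E := fun n t x =>
    ((n : ℝ) + 1) • (tconv φ (f t) (x + ((n : ℝ) + 1)⁻¹) - tconv φ (f t) x) with hd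
  have hdc : ∀ n, ContinuousOn (Function.uncurry (d n)) spaceTime := fun n =>
    ((hcc.comp (f := fun p : ℝ × ℝ => (p.1, p.2 + ((n : ℝ) + 1)⁻¹)) (by fun_prop)
      fun p hp => ⟨hp.1, trivial⟩).sub hcc).const_smul ((n : ℝ) + 1)
  have hdd : ∀ n t, 0 ≤ t → ∀ x, HasDerivAt (tconv (steklov φ n) (f t)) (d n t x) x :=
    fun n t ht x => D.hasDerivAt_tconv_steklov (hfc t ht) (hfp t ht)
      (continuousOn_slice_right hcc ht) n x
  set δ : ℕ → ℝ := fun n => ∫ z, |steklov φ n z - φ z| ∂torus with hδ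
  have hδ0 : Tendsto δ atTop (𝓝 0) := D.tendsto_integral_steklov
  have hδn : ∀ n, 0 ≤ δ n := fun n => integral_nonneg fun _ => abs_nonneg _
  have hsub : ∀ n, Integrable (fun z => steklov φ n z - φ z) torus := fun n =>
    (D.steklov_integrable n).sub hφ
  have hbound : ∀ T L, (∀ t ∈ Icc 0 T, ∀ x y, ‖f t x - f t y‖ ≤ L * |x - y|) →
      ∀ n m, ∀ t ∈ Icc 0 T, ∀ x, ‖d n t x - d m t x‖ ≤ (δ n + δ m) * |L| := by
    intro T L hL n m t ht x
    -- A derivative is bounded by a Lipschitz constant, and `(φₙ - φ) * f` has constant at most `δ n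
    -- * |L|`. The derivatives of `φₙ * f` are therefore uniformly Cauchy without f being
    -- differentiable.
    refine HasDerivAt.le_of_lip' ((hdd n t ht.1 x).sub (hdd m t ht.1 x)) (by
      have := hδn n; have := hδn m; positivity) (Eventually.of_forall fun y => ?_)
    have key : ∀ k, ‖(tconv (steklov φ k) (f t) y - tconv φ (f t) y) -
        (tconv (steklov φ k) (f t) x - tconv φ (f t) x)‖ ≤ δ k * (|L| * |y - x|) := by
      intro k
      rw [← tconv_sub_kernel (D.steklov_integrable k) hφ (hfc t ht.1),
        ← tconv_sub_kernel (D.steklov_integrable k) hφ (hfc t ht.1)]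
      refine norm_tconv_sub_le (hsub k) (hfc t ht.1) fun z => (hL t ht _ _).trans ?_
      rw [sub_sub_sub_cancel_right]
      exact mul_le_mul_of_nonneg_right (le_abs_self L) (abs_nonneg _)
    have e : (tconv (steklov φ n) (f t) - tconv (steklov φ m) (f t)) y -
        (tconv (steklov φ n) (f t) - tconv (steklov φ m) (f t)) x =
        ((tconv (steklov φ n) (f t) y - tconv φ (f t) y) -
        (tconv (steklov φ n) (f t) x - tconv φ (f t) x)) -
        ((tconv (steklov φ m) (f t) y - tconv φ (f t) y) -
        (tconv (steklov φ m) (f t) x - tconv φ (f t) x)) := by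
      simp only [Pi.sub_apply]; abel
    rw [e]
    refine (norm_sub_le _ _).trans ((add_le_add (key n) (key m)).trans (le_of_eq ?_))
    rw [Real.norm_eq_abs]
    ring
  have hcauchy : ∀ t, 0 ≤ t → ∀ x, CauchySeq fun n => d n t x := by
    intro t ht x
    obtain ⟨L, hLt⟩ := hL t
    refine Metric.cauchySeq_iff.2 fun ε hε => ?_
    have h0 : Tendsto (fun n => δ n * (|L| + 1)) atTop (𝓝 0) := by simpa using hδ0.mul_const (|L| + 1)
    obtain ⟨N, hN⟩ := eventually_atTop.1 (h0.eventually (gt_mem_nhds (half_pos hε)))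
    refine ⟨N, fun n hn m hm => ?_⟩
    rw [dist_eq_norm]
    refine (hbound t L hLt n m t ⟨ht, le_rfl⟩ x).trans_lt ?_
    have h1 := hN n hn
    have h2 := hN m hm
    have := hδn n
    have := hδn m
    nlinarith
  -- At negative times nothing is claimed, and the limit is given the value 0.
  have hlim : ∀ t x, ∃ l, 0 ≤ t → Tendsto (fun n => d n t x) atTop (𝓝 l) := by
    intro t x
    by_cases ht : 0 ≤ t
    · obtain ⟨l, hl⟩ := cauchySeq_tendsto_of_complete (hcauchy t ht x)
      exact ⟨l, fun _ => hl⟩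
    · exact ⟨0, fun h => absurd h ht⟩
  choose cx hcx using hlim
  have hunif : ∀ T, ∃ L, ∀ n, ∀ t ∈ Icc 0 T, ∀ x, ‖d n t x - cx t x‖ ≤ δ n * L := by
    intro T
    obtain ⟨L, hLT⟩ := hL T
    refine ⟨|L|, fun n t ht x => ?_⟩
    have h1 : Tendsto (fun m => ‖d n t x - d m t x‖) atTop (𝓝 ‖d n t x - cx t x‖) :=
      (tendsto_const_nhds.sub (hcx t x ht.1)).norm
    have h2 : Tendsto (fun m => (δ n + δ m) * |L|) atTop (𝓝 ((δ n + 0) * |L|)) :=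
      (tendsto_const_nhds.add hδ0).mul_const _
    rw [add_zero] at h2
    exact le_of_tendsto_of_tendsto' h1 h2 fun m => hbound T L hLT n m t ht x
  have hsmall : ∀ T ε, 0 < ε → ∀ᶠ n in atTop, ∀ t ∈ Icc 0 T, ∀ x, dist (cx t x) (d n t x) < ε := by
    intro T ε hε
    obtain ⟨L, hLT⟩ := hunif T
    have h0 : Tendsto (fun n => δ n * L) atTop (𝓝 0) := by simpa using hδ0.mul_const L
    filter_upwards [h0.eventually (gt_mem_nhds hε)] with n hn t ht x
    rw [dist_comm, dist_eq_norm]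
    exact (hLT n t ht x).trans_lt hn
  refine ⟨cx, fun t ht x => ?_, ?_⟩
  · refine hasDerivAt_of_tendstoUniformly (f := fun n => tconv (steklov φ n) (f t))
      (f' := fun n => d n t) (l := atTop) ?_ (Eventually.of_forall fun n x => hdd n t ht x)
      (fun x => ?_) x
    · refine Metric.tendstoUniformly_iff.2 fun ε hε => ?_
      filter_upwards [hsmall t ε hε] with n hn x using hn t ⟨ht, le_rfl⟩ x
    · obtain ⟨M, hM⟩ := isCompact_Icc.exists_bound_of_continuousOn
        (s := Icc 0 (2 * Real.pi)) (hfc t ht).continuousOn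
      have hM' : ∀ z, ‖f t z‖ ≤ M := fun z => by
        obtain ⟨y, hy, hyz⟩ := (hfp t ht).exists_mem_Ico₀ two_pi_pos z
        rw [hyz]
        exact hM y ⟨hy.1, hy.2.le⟩
      have h0 : Tendsto (fun n => δ n * M) atTop (𝓝 0) := by simpa using hδ0.mul_const M
      refine tendsto_iff_norm_sub_tendsto_zero.2 (squeeze_zero (fun _ => norm_nonneg _)
        (fun n => ?_) h0)
      rw [← tconv_sub_kernel (D.steklov_integrable n) hφ (hfc t ht)]
      exact norm_integral_smul_le (hsub n) fun z => hM' _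
  · refine continuousOn_of_locally_uniform_approx_of_continuousWithinAt fun p hp U hU => ?_
    obtain ⟨ε, hε, hεU⟩ := Metric.mem_uniformity_dist.1 hU
    obtain ⟨n, hn⟩ := (hsmall (p.1 + 1) ε hε).exists
    refine ⟨spaceTime ∩ {q | q.1 < p.1 + 1}, ?_, Function.uncurry (d n), hdc n p hp,
      fun q hq => hεU (hn q.1 ⟨hq.1.1, le_of_lt hq.2⟩ q.2)⟩
    refine inter_mem self_mem_nhdsWithin (mem_nhdsWithin_of_mem_nhds ?_)
    exact (isOpen_lt continuous_fst continuous_const).mem_nhds (by simp)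

end NormalData

end Convolution

/-! ### Linear equations and uniform linearization -/

section Linear

variable {E G : Type*} [NormedAddCommGroup E] [NormedSpace ℝ E] [NormedAddCommGroup G]
  [NormedSpace ℝ G]

/-- Differentiability at `a₀` uniformly in time: the derivative is equicontinuous there over the
compact `[0, T]`. -/
theorem eventually_norm_sub_sub_smul_le {q q' : ℝ → ℝ → E}
    (hq : ∀ t, 0 ≤ t → ∀ x, HasDerivAt (q t) (q' t x) x)
    (hq' : ContinuousOn (Function.uncurry q') spaceTime) (T a₀ : ℝ) {ε : ℝ} (hε : 0 < ε) :
    ∀ᶠ a in 𝓝 a₀, ∀ t ∈ Icc 0 T, ‖q t a - q t a₀ - (a - a₀) • q' t a₀‖ ≤ ε * |a - a₀| := by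
  obtain ⟨v, hv, hvF⟩ := isCompact_Icc.mem_uniformity_of_prod (s := univ) (k := Icc 0 T) (q := a₀)
    (f := fun a t => q' t a)
    (hq'.comp (f := fun z : ℝ × ℝ => (z.2, z.1)) continuous_swap.continuousOn
      fun z hz => ⟨hz.2.1, trivial⟩) (mem_univ _) (Metric.dist_mem_uniformity hε)
  rw [nhdsWithin_univ] at hv
  obtain ⟨δ, hδ, hδv⟩ := Metric.mem_nhds_iff.1 hv
  filter_upwards [Metric.ball_mem_nhds a₀ hδ] with a ha t ht
  have h := Convex.norm_image_sub_le_of_norm_hasDerivWithin_le (𝕜 := ℝ)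
    (f := fun z => q t z - z • q' t a₀) (f' := fun z => q' t z - (1 : ℝ) • q' t a₀) (C := ε)
    (s := Metric.ball a₀ δ) (x := a₀) (y := a)
    (fun z _ => ((hq t ht.1 z).sub ((hasDerivAt_id z).smul_const _)).hasDerivWithinAt)
    (fun z hz => by
      have h3 := hvF _ (hδv hz) t ht
      rw [mem_ofPred_eq, dist_eq_norm] at h3
      rw [one_smul]
      exact le_of_lt h3)
    (convex_ball _ _) (Metric.mem_ball_self hδ) ha
  have e : q t a - q t a₀ - (a - a₀) • q' t a₀ = q t a - a • q' t a₀ - (q t a₀ - a₀ • q' t a₀) := by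
    rw [sub_smul]; abel
  rw [e]
  exact h

/-- Closed balls are compact, so the derivative is uniformly continuous on them and one δ serves all
base points. -/
theorem exists_uniform_linearization [ProperSpace E] {F : E → G} (hF : ContDiff ℝ 1 F) (R : ℝ)
    {ε : ℝ} (hε : 0 < ε) : ∃ δ > 0, ∀ p q, ‖p‖ ≤ R → ‖q‖ ≤ R → ‖p - q‖ < δ →
      ‖F p - F q - fderiv ℝ F q (p - q)‖ ≤ ε * ‖p - q‖ := by
  have huc : UniformContinuousOn (fderiv ℝ F) (Metric.closedBall 0 R) :=
    (isCompact_closedBall 0 R).uniformContinuousOn_of_continuous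
      (hF.continuous_fderiv (by simp)).continuousOn
  obtain ⟨δ, hδ, h⟩ := Metric.uniformContinuousOn_iff.1 huc ε hε
  refine ⟨δ, hδ, fun p q hp hq hpq => ?_⟩
  refine Convex.norm_image_sub_le_of_norm_hasFDerivWithin_le' (𝕜 := ℝ)
    (s := Metric.closedBall 0 R ∩ Metric.ball q δ) (f' := fderiv ℝ F)
    (fun z _ => (hF.differentiable (by simp) z).hasFDerivAt.hasFDerivWithinAt) (fun z hz => ?_)
    ((convex_closedBall _ _).inter (convex_ball _ _)) ⟨by simpa using hq, Metric.mem_ball_self hδ⟩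
    ⟨by simpa using hp, by rwa [Metric.mem_ball, dist_eq_norm]⟩
  have := h z hz.1 q (by simpa using hq) hz.2
  rw [dist_eq_norm] at this
  exact this.le

theorem exists_linear_solution [CompleteSpace E] {A : ℝ → E →L[ℝ] E} {b : ℝ → E}
    (hA : ContinuousOn A (Ici 0)) (hb : ContinuousOn b (Ici 0)) (k₀ : E) {T : ℝ} (hT : 0 ≤ T) :
    ∃ k : ℝ → E, k 0 = k₀ ∧
      ∀ t ∈ Icc 0 T, HasDerivWithinAt k (A t (k t) + b t) (Ici 0) t := by
  -- Clamping time to `[0, T]` makes the coefficients continuous and bounded on the whole line, as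
  -- the global existence theorem requires.
  set θ : ℝ → ℝ := fun t => max 0 (min t T) with hθ
  have hθI : ∀ t, θ t ∈ Icc 0 T := fun t =>
    ⟨le_max_left _ _, max_le hT (min_le_right _ _)⟩
  have hθe : ∀ t ∈ Icc 0 T, θ t = t := fun t ht => by
    simp only [hθ, min_eq_left ht.2, max_eq_right ht.1]
  have hθc : Continuous θ := by fun_prop
  have hAc : Continuous fun t => A (θ t) := hA.comp_continuous hθc fun t => (hθI t).1
  have hbc : Continuous fun t => b (θ t) := hb.comp_continuous hθc fun t => (hθI t).1
  obtain ⟨M, hM⟩ := isCompact_Icc.exists_bound_of_continuousOn (s := Icc 0 T)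
    (hA.mono Icc_subset_Ici_self)
  obtain ⟨N, hN⟩ := isCompact_Icc.exists_bound_of_continuousOn (s := Icc 0 T)
    (hb.mono Icc_subset_Ici_self)
  have hM0 : 0 ≤ M := (norm_nonneg _).trans (hM 0 ⟨le_rfl, hT⟩)
  obtain ⟨k, hk0, hk⟩ := exists_forall_hasDerivAt_of_lipschitz
    (fun t x => A (θ t) x + b (θ t))
    (((hAc.comp continuous_fst).clm_apply continuous_snd).add (hbc.comp continuous_fst)) hM0
    (fun t x y => by
      rw [add_sub_add_right_eq_sub, ← map_sub]
      exact (A (θ t)).le_of_opNorm_le (hM _ (hθI t)) _)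
    (B := N) (fun t => by
      rw [map_zero, zero_add]
      exact hN _ (hθI t)) k₀
  refine ⟨k, hk0, fun t ht => ?_⟩
  have := (hk t).hasDerivWithinAt (s := Ici 0)
  rwa [hθe t ht] at this

/-- The difference of the solutions at two labels solves a linear equation whose source is the
variation of the coefficients along the fixed solution at `a₀`. That source is small uniformly in
time by compactness, and Grönwall concludes. -/
theorem continuousOn_linear_solution {A : ℝ → ℝ → E →L[ℝ] E} {b k : ℝ → ℝ → E}
    (hA : ContinuousOn (Function.uncurry A) spaceTime)
    (hb : ContinuousOn (Function.uncurry b) spaceTime)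
    (hk : ∀ a t, 0 ≤ t → HasDerivWithinAt (fun s => k s a) (A t a (k t a) + b t a) (Ici 0) t)
    (h0 : Continuous (k 0)) : ContinuousOn (Function.uncurry k) spaceTime := by
  rintro ⟨t₀, a₀⟩ hp
  have ht₀ : 0 ≤ t₀ := hp.1
  set T := t₀ + 1 with hT
  obtain ⟨M, hM0, hM⟩ := exists_bound_spaceTime hA T (a₀ - 1) (a₀ + 1)
  have hkc : ∀ a, ContinuousOn (fun s => k s a) (Ici 0) := fun a s hs =>
    (hk a s hs).continuousWithinAt
  have hdef : ContinuousOn (Function.uncurry fun a t =>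
      (A t a - A t a₀) (k t a₀) + (b t a - b t a₀)) (univ ×ˢ Icc 0 T) := by
    have hsw : MapsTo (fun z : ℝ × ℝ => (z.2, z.1)) (univ ×ˢ Icc 0 T) spaceTime :=
      fun z hz => ⟨hz.2.1, trivial⟩
    have hsw0 : MapsTo (fun z : ℝ × ℝ => (z.2, a₀)) (univ ×ˢ Icc 0 T) spaceTime :=
      fun z hz => ⟨hz.2.1, trivial⟩
    have c1 : Continuous fun z : ℝ × ℝ => (z.2, z.1) := by fun_prop
    have c2 : Continuous fun z : ℝ × ℝ => (z.2, a₀) := by fun_prop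
    exact (((hA.comp c1.continuousOn hsw).sub (hA.comp c2.continuousOn hsw0)).clm_apply
      ((hkc a₀).comp continuous_snd.continuousOn fun z hz => hz.2.1)).add
      ((hb.comp c1.continuousOn hsw).sub (hb.comp c2.continuousOn hsw0))
  rw [Metric.continuousWithinAt_iff']
  intro ε hε
  set B := (1 + T) * Real.exp (M * T) with hB
  have hT0 : 0 ≤ T := by linarith
  have hB0 : 0 < B := by positivity
  have hη : 0 < ε / (2 * B) := by positivity
  obtain ⟨v, hv, hvF⟩ := isCompact_Icc.mem_uniformity_of_prod (q := a₀) hdef (mem_univ _)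
    (Metric.dist_mem_uniformity hη)
  rw [nhdsWithin_univ] at hv
  have hkt : ∀ᶠ p : ℝ × ℝ in 𝓝[spaceTime] (t₀, a₀), dist (k p.1 a₀) (k t₀ a₀) < ε / 2 := by
    have h1 : Tendsto (fun p : ℝ × ℝ => p.1) (𝓝[spaceTime] (t₀, a₀)) (𝓝[Ici 0] t₀) :=
      tendsto_nhdsWithin_iff.2 ⟨continuous_fst.continuousWithinAt,
        eventually_nhdsWithin_of_forall fun p hp => hp.1⟩
    exact ((hkc a₀ t₀ ht₀).tendsto.comp h1).eventually (Metric.ball_mem_nhds _ (half_pos hε))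
  have hsnd : Tendsto (fun p : ℝ × ℝ => p.2) (𝓝[spaceTime] (t₀, a₀)) (𝓝 a₀) :=
    continuous_snd.continuousWithinAt
  have hfst : Tendsto (fun p : ℝ × ℝ => p.1) (𝓝[spaceTime] (t₀, a₀)) (𝓝 t₀) :=
    continuous_fst.continuousWithinAt
  filter_upwards [hkt, hsnd.eventually hv, hsnd.eventually (h0.tendsto a₀
    (Metric.ball_mem_nhds _ hη)), hsnd.eventually (Metric.ball_mem_nhds a₀ one_pos),
    hfst.eventually (Iio_mem_nhds (show t₀ < T by linarith)), self_mem_nhdsWithin]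
    with p h1 h2 h3 h4 h5 h6
  have h4' : p.2 ∈ Icc (a₀ - 1) (a₀ + 1) := by
    rw [Real.dist_eq, abs_lt] at h4
    exact ⟨by linarith, by linarith⟩
  have hg := norm_le_exp_of_norm_derivWithin_le (f := fun s => k s p.2 - k s a₀)
    (f' := fun s => A s p.2 (k s p.2) + b s p.2 - (A s a₀ (k s a₀) + b s a₀))
    (δ := ε / (2 * B)) (K := M) (ε := ε / (2 * B)) (T := T) hM0 hη.le
    (fun s hs => (hk p.2 s hs.1).sub (hk a₀ s hs.1))
    (by
      rw [← dist_eq_norm]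
      exact le_of_lt h3)
    (fun s hs => by
      have h7 := hvF p.2 h2 s hs
      rw [mem_ofPred_eq, sub_self, sub_self, zero_apply, add_zero,
        dist_zero_right] at h7
      have e : A s p.2 (k s p.2) + b s p.2 - (A s a₀ (k s a₀) + b s a₀) =
          A s p.2 (k s p.2 - k s a₀) +
            ((A s p.2 - A s a₀) (k s a₀) + (b s p.2 - b s a₀)) := by
        rw [map_sub, sub_apply]; abel
      rw [e]
      exact (norm_add_le _ _).trans (add_le_add
        ((A s p.2).le_of_opNorm_le (hM s hs _ h4') _) h7.le)) p.1 ⟨h6.1, le_of_lt h5⟩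
  have h8 : (ε / (2 * B) + ε / (2 * B) * p.1) * Real.exp (M * p.1) ≤ ε / 2 := by
    have hp1 : p.1 ≤ T := le_of_lt h5
    have hp0 : 0 ≤ p.1 := h6.1
    calc _ ≤ (ε / (2 * B) + ε / (2 * B) * T) * Real.exp (M * T) := by gcongr
      _ = ε / (2 * B) * B := by rw [hB]; ring
      _ = ε / 2 := by field_simp
  have h9 := dist_triangle (k p.1 p.2) (k p.1 a₀) (k t₀ a₀)
  rw [dist_eq_norm (k p.1 p.2) (k p.1 a₀)] at h9
  simp only [Function.uncurry]
  linarith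

end Linear

/-- A flow `X` with inverse `Y` and Jacobian `J`, generated by a velocity field `u` with slope
`ux`. -/
structure CharFlow (X Y J u ux : ℝ → ℝ → ℝ) : Prop where
  init : ∀ a, X 0 a = a
  cont : Continuous (Function.uncurry X)
  hasDerivWithinAt : ∀ a t, 0 ≤ t → HasDerivWithinAt (fun s => X s a) (u t (X t a)) (Ici 0) t
  right_inv : ∀ t, 0 ≤ t → ∀ x, X t (Y t x) = x
  left_inv : ∀ t, 0 ≤ t → ∀ a, Y t (X t a) = a
  cont_inv : ContinuousOn (Function.uncurry Y) spaceTime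
  jac_pos : ∀ t, 0 ≤ t → ∀ a, 0 < J t a
  jac_cont : ContinuousOn (Function.uncurry J) spaceTime
  hasDerivAt_label : ∀ t, 0 ≤ t → ∀ a, HasDerivAt (X t) (J t a) a
  jac_hasDerivWithinAt : ∀ a t, 0 ≤ t →
    HasDerivWithinAt (fun s => J s a) (ux t (X t a) * J t a) (Ici 0) t
  bilipschitz : ∀ T, ∃ B, 1 ≤ B ∧ ∀ s ∈ Icc 0 T, ∀ t ∈ Icc 0 T, ∀ a b,
    |X s a - X s b| ≤ B * |X t a - X t b|

/-- A function `f` with values in `E` that solves a nonlocal system `f_t + u f_x = F(f, φ * f)` along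
the flow `X`, whose velocity is a linear function of `f` and has slope `lam (f, φ * f)`. -/
structure TransportSystem {E : Type*} [NormedAddCommGroup E] [NormedSpace ℝ E] (φ : ℝ → ℝ)
    (X u ux : ℝ → ℝ → ℝ) (ℓ : E →L[ℝ] ℝ) (F : E × E → E) (lam : E × E → ℝ) (f : ℝ → ℝ → E) :
    Prop where
  smooth : ContDiff ℝ ∞ F
  slope_smooth : ContDiff ℝ ∞ lam
  cont : ContinuousOn (Function.uncurry f) spaceTime
  periodic : ∀ t, 0 ≤ t → Function.Periodic (f t) (2 * Real.pi)
  init_smooth : ContDiff ℝ ∞ (f 0)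
  transport : ∀ a t, 0 ≤ t → HasDerivWithinAt (fun s => f s (X s a))
    (F (f t (X t a), tconv φ (f t) (X t a))) (Ici 0) t
  vel : ∀ t, 0 ≤ t → ∀ x, ℓ (f t x) = u t x
  slope : ∀ t, 0 ≤ t → ∀ x, ux t x = lam (f t x, tconv φ (f t) x)

/-! ### Spatial Lipschitz bounds for transport systems -/

theorem exists_bound_of_periodic {E : Type*} [NormedAddCommGroup E] {f : ℝ → ℝ → E}
    (hf : ContinuousOn (Function.uncurry f) spaceTime)
    (hp : ∀ t, 0 ≤ t → Function.Periodic (f t) (2 * Real.pi)) (T : ℝ) :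
    ∃ M, 0 ≤ M ∧ ∀ t ∈ Icc 0 T, ∀ x, ‖f t x‖ ≤ M := by
  obtain ⟨M, hM0, hM⟩ := exists_bound_spaceTime hf T 0 (2 * Real.pi)
  refine ⟨M, hM0, fun t ht x => ?_⟩
  obtain ⟨y, hy, hyx⟩ := (hp t ht.1).exists_mem_Ico₀ two_pi_pos x
  rw [hyx]
  exact hM t ht y ⟨hy.1, hy.2.le⟩

theorem exists_lipschitz_of_periodic {E : Type*} [NormedAddCommGroup E] [NormedSpace ℝ E]
    {f : ℝ → E} (hf : ContDiff ℝ 1 f) (hp : Function.Periodic f (2 * Real.pi)) :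
    ∃ L, 0 < L ∧ ∀ x y, ‖f x - f y‖ ≤ L * |x - y| := by
  have hdp : Function.Periodic (deriv f) (2 * Real.pi) := fun x => by
    have h : f = fun y => f (y + 2 * Real.pi) := funext fun y => (hp y).symm
    conv_rhs => rw [h]
    rw [deriv_comp_add_const]
  obtain ⟨M, hM0, hM⟩ := exists_bound_of_periodic (f := fun _ => deriv f)
    ((hf.continuous_deriv (by simp)).comp continuous_snd).continuousOn (fun _ _ => hdp) 0
  refine ⟨M + 1, by linarith, fun x y => ?_⟩
  have h := Convex.norm_image_sub_le_of_norm_hasDerivWithin_le (𝕜 := ℝ) (f := f) (f' := deriv f)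
    (C := M + 1) (s := univ) (x := y) (y := x)
    (fun z _ => (hf.differentiable (by simp) z).hasDerivAt.hasDerivWithinAt)
    (fun z _ => by linarith [hM 0 ⟨le_rfl, le_rfl⟩ z]) convex_univ trivial trivial
  exact h

namespace TransportSystem

variable {E : Type*} [NormedAddCommGroup E] [NormedSpace ℝ E]
  {φ : ℝ → ℝ} {X Y J u ux : ℝ → ℝ → ℝ} {ℓ : E →L[ℝ] ℝ} {F : E × E → E} {lam : E × E → ℝ}
  {f : ℝ → ℝ → E} (S : TransportSystem φ X u ux ℓ F lam f)

include S

theorem tconv_cont (hφ : Integrable φ torus) :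
    ContinuousOn (Function.uncurry fun t x => tconv φ (f t) x) spaceTime :=
  continuousOn_tconv hφ S.cont

/-- Two characteristics are compared. The local dependence of F on f closes by Grönwall, while the
convolution is estimated by the assumed constant N; with μ large enough its contribution costs only
`N / 2`. The regularization ε lets the assumption start from mere boundedness, and C and μ depend
neither on ε nor on N. -/
theorem exists_lipschitz_estimate [ProperSpace E] (hX : CharFlow X Y J u ux)
    (hφ : Integrable φ torus) {T : ℝ} (hT : 0 ≤ T) :
    ∃ C μ, 0 ≤ C ∧ ∀ ε > 0, ∀ N, 0 ≤ N →
      (∀ t ∈ Icc 0 T, ∀ x y, ‖f t x - f t y‖ ≤ N * Real.exp (μ * t) * (|x - y| + ε)) →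
      ∀ t ∈ Icc 0 T, ∀ x y,
        ‖f t x - f t y‖ ≤ (C + N / 2) * Real.exp (μ * t) * (|x - y| + ε) := by
  obtain ⟨M, hM0, hM⟩ := exists_bound_of_periodic S.cont S.periodic T
  obtain ⟨M', hM'0, hM'⟩ := exists_bound_of_periodic (S.tconv_cont hφ)
    (fun t ht => tconv_periodic (S.periodic t ht)) T
  obtain ⟨L₀, hL₀, hL₀f⟩ := exists_lipschitz_of_periodic
    (S.init_smooth.of_le (by exact_mod_cast le_top)) (S.periodic 0 le_rfl)
  obtain ⟨B, hB1, hB⟩ := hX.bilipschitz T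
  set R := max M M' with hR
  obtain ⟨L, hL⟩ := (S.smooth.of_le (m := 1) (by exact_mod_cast le_top)).contDiffOn.exists_lipschitzOnWith
    (s := Metric.closedBall (0 : E × E) R) (by simp) (convex_closedBall _ _)
    (isCompact_closedBall _ _)
  set κ := ∫ z, |φ z| ∂torus with hκ
  have hκ0 : 0 ≤ κ := integral_nonneg fun _ => abs_nonneg _
  have hL0 : (0 : ℝ) ≤ L := L.2
  -- `L` pays for the local term, `2 * B * L * κ` for the convolution, and 1 makes the comparison
  -- strict.
  set μ : ℝ := L + 2 * B * L * κ + 1 with hμ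
  have hB0 : 0 < B := by linarith
  refine ⟨L₀ * B, μ, by positivity, fun ε hε N hN hNf t ht x y => ?_⟩
  set a := Y t x
  set b := Y t y
  have hxa : X t a = x := hX.right_inv t ht.1 x
  have hyb : X t b = y := hX.right_inv t ht.1 y
  set r := B * (|x - y| + ε) with hr
  have hr0 : 0 < r := by positivity
  -- The first term dominates the initial difference. The second makes `N * r ≤ 2 * B * A` and,
  -- since `r` carries the factor `B`, equals `N / 2` times `|x - y| + ε`.
  set A := L₀ * r + N / (2 * B) * r with hA
  have hA0 : 0 < A := by positivity
  have hmem : ∀ s ∈ Icc 0 T, ∀ z, (f s z, tconv φ (f s) z) ∈ Metric.closedBall (0 : E × E) R := by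
    intro s hs z
    rw [mem_closedBall_zero_iff, Prod.norm_def]
    exact max_le_max (hM s hs z) (hM' s hs z)
  have hfence := image_norm_le_of_norm_deriv_right_lt_deriv_boundary' (a := 0) (b := t)
    (f := fun s => f s (X s a) - f s (X s b))
    (f' := fun s => F (f s (X s a), tconv φ (f s) (X s a)) -
      F (f s (X s b), tconv φ (f s) (X s b)))
    (B := fun s => A * Real.exp (μ * s)) (B' := fun s => A * (Real.exp (μ * s) * μ))
    (fun s hs => (((S.transport a s hs.1).sub
      (S.transport b s hs.1)).continuousWithinAt).mono Icc_subset_Ici_self)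
    (fun s hs => ((S.transport a s hs.1).sub (S.transport b s hs.1)).mono (Ici_subset_Ici.2 hs.1))
    (by
      simp only [hX.init, mul_zero, Real.exp_zero, mul_one]
      have h1 := hB 0 ⟨le_rfl, hT⟩ t ht a b
      rw [hX.init, hX.init, hxa, hyb] at h1
      calc _ ≤ L₀ * |a - b| := hL₀f a b
        _ ≤ L₀ * (B * (|x - y| + ε)) := by
          gcongr
          exact h1.trans (by gcongr; linarith)
        _ ≤ A := by
          rw [hA]
          have : 0 ≤ N / (2 * B) * r := by positivity
          linarith)
    (by fun_prop)
    (fun s hs => by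
      have h : HasDerivAt (fun s => A * Real.exp (μ * s)) (A * (Real.exp (μ * s) * (μ * 1))) s :=
        (((hasDerivAt_id s).const_mul μ).exp).const_mul A
      rw [mul_one] at h
      exact h.hasDerivWithinAt)
    (fun s hs hsB => by
      have hsT : s ∈ Icc 0 T := ⟨hs.1, hs.2.le.trans ht.2⟩
      have h1 := hL.dist_le_mul _ (hmem s hsT (X s a)) _ (hmem s hsT (X s b))
      rw [dist_eq_norm, dist_eq_norm, Prod.norm_def] at h1
      have h2 : ‖tconv φ (f s) (X s a) - tconv φ (f s) (X s b)‖ ≤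
          κ * (N * Real.exp (μ * s) * r) := by
        refine norm_tconv_sub_le hφ (continuousOn_slice_right S.cont hs.1) fun z => ?_
        refine (hNf s hsT _ _).trans ?_
        rw [sub_sub_sub_cancel_right]
        have h3 := hB s hsT t ht a b
        rw [hxa, hyb] at h3
        gcongr
        rw [hr, mul_add]
        have : 1 * ε ≤ B * ε := by gcongr
        linarith
      have h4 : κ * (N * Real.exp (μ * s) * r) ≤ 2 * B * κ * (A * Real.exp (μ * s)) := by
        have h5 : N * r = 2 * B * (N / (2 * B) * r) := by field_simp
        have h6 : N / (2 * B) * r ≤ A := by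
          rw [hA]
          have : 0 ≤ L₀ * r := by positivity
          linarith
        calc κ * (N * Real.exp (μ * s) * r) = κ * (N * r) * Real.exp (μ * s) := by ring
          _ = κ * (2 * B * (N / (2 * B) * r)) * Real.exp (μ * s) := by rw [h5]
          _ ≤ κ * (2 * B * A) * Real.exp (μ * s) := by gcongr
          _ = _ := by ring
      have h7 : 0 < A * Real.exp (μ * s) := by positivity
      have h9 : ‖f s (X s a) - f s (X s b)‖ = A * Real.exp (μ * s) := hsB
      have h8 : max ‖f s (X s a) - f s (X s b)‖
          ‖tconv φ (f s) (X s a) - tconv φ (f s) (X s b)‖ ≤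
          A * Real.exp (μ * s) + 2 * B * κ * (A * Real.exp (μ * s)) :=
        max_le (by rw [h9]; have : 0 ≤ 2 * B * κ * (A * Real.exp (μ * s)) := by positivity
                   linarith) (by linarith [h2.trans h4])
      calc _ ≤ _ := h1
        _ ≤ L * (A * Real.exp (μ * s) + 2 * B * κ * (A * Real.exp (μ * s))) := by gcongr; exact h8
        _ < A * (Real.exp (μ * s) * μ) := by
          rw [hμ]
          linarith)
    ⟨ht.1, le_rfl⟩
  simp only [hxa, hyb] at hfence
  refine hfence.trans (le_of_eq ?_)
  rw [hA, hr]
  field_simp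

/-- Iterating `N ↦ C + N / 2` drives the constant to `2 * C`, which does not depend on ε; then ε
tends to 0. -/
theorem exists_lipschitz [ProperSpace E] (hX : CharFlow X Y J u ux) (hφ : Integrable φ torus)
    (T : ℝ) : ∃ L, ∀ t ∈ Icc 0 T, ∀ x y, ‖f t x - f t y‖ ≤ L * |x - y| := by
  rcases lt_or_ge T 0 with hT | hT
  · exact ⟨0, fun t ht => absurd (ht.1.trans ht.2) (not_le.2 hT)⟩
  obtain ⟨C, μ, hC, h⟩ := S.exists_lipschitz_estimate hX hφ hT
  obtain ⟨M, hM0, hM⟩ := exists_bound_of_periodic S.cont S.periodic T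
  refine ⟨2 * C * Real.exp (|μ| * T), fun t ht x y => ?_⟩
  have hε : ∀ ε > 0, ‖f t x - f t y‖ ≤ 2 * C * Real.exp (μ * t) * (|x - y| + ε) := by
    intro ε hε
    -- Boundedness alone gives this constant, as `|x - y| + ε ≥ ε`; the exponential compensates for
    -- a possibly negative μ.
    set N₀ := 2 * M / ε * Real.exp (|μ| * T) with hN₀
    have hN₀0 : 0 ≤ N₀ := by positivity
    have hn : ∀ n : ℕ, ∀ t ∈ Icc 0 T, ∀ x y,
        ‖f t x - f t y‖ ≤ (2 * C + N₀ / 2 ^ n) * Real.exp (μ * t) * (|x - y| + ε) := by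
      intro n
      induction n with
      | zero =>
        intro t ht x y
        have h1 : ‖f t x - f t y‖ ≤ 2 * M :=
          (norm_sub_le _ _).trans (by linarith [hM t ht x, hM t ht y])
        have h2 : 1 ≤ Real.exp (|μ| * T) * Real.exp (μ * t) := by
          rw [← Real.exp_add]
          refine Real.one_le_exp ?_
          have h3 : -(|μ| * T) ≤ μ * t := by
            have h4 : |μ * t| ≤ |μ| * T := by
              rw [abs_mul, abs_of_nonneg ht.1]
              have := ht.2
              gcongr
            linarith [neg_abs_le (μ * t)]
          linarith
        calc _ ≤ 2 * M := h1
          _ = 2 * M / ε * 1 * ε := by field_simp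
          _ ≤ 2 * M / ε * (Real.exp (|μ| * T) * Real.exp (μ * t)) * (|x - y| + ε) := by
            gcongr
            linarith [abs_nonneg (x - y)]
          _ = N₀ * Real.exp (μ * t) * (|x - y| + ε) := by rw [hN₀]; ring
          _ ≤ _ := by
            rw [pow_zero, div_one]
            gcongr
            linarith
      | succ n ih =>
        have h1 := h ε hε (2 * C + N₀ / 2 ^ n) (by positivity) ih
        intro t ht x y
        refine (h1 t ht x y).trans (le_of_eq ?_)
        rw [pow_succ]
        field_simp
        ring
    have hlim : Tendsto (fun n : ℕ => (2 * C + N₀ / 2 ^ n) * Real.exp (μ * t) * (|x - y| + ε)) atTop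
        (𝓝 ((2 * C + 0) * Real.exp (μ * t) * (|x - y| + ε))) := by
      refine ((tendsto_const_nhds.add ?_).mul_const _).mul_const _
      exact tendsto_const_nhds.div_atTop (tendsto_pow_atTop_atTop_of_one_lt (by norm_num))
    rw [add_zero] at hlim
    exact ge_of_tendsto' hlim fun n => hn n t ht x y
  have hlim : Tendsto (fun ε : ℝ => 2 * C * Real.exp (μ * t) * (|x - y| + ε)) (𝓝[>] 0)
      (𝓝 (2 * C * Real.exp (μ * t) * (|x - y| + 0))) :=
    (Continuous.tendsto (by fun_prop) 0).mono_left nhdsWithin_le_nhds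
  rw [add_zero] at hlim
  refine (ge_of_tendsto hlim (eventually_nhdsWithin_of_forall fun ε h => hε ε h)).trans ?_
  have h1 := ht.2
  have h2 := ht.1
  gcongr
  exact le_abs_self μ

end TransportSystem

/-- The right-hand side of the system for a solution of a transport system together with its
spatial derivative. -/
def prolong {E : Type*} [NormedAddCommGroup E] [NormedSpace ℝ E] (F : E × E → E) (lam : E × E → ℝ)
    (z : (E × E) × (E × E)) : E × E :=
  (F (z.1.1, z.2.1),
    fderiv ℝ F (z.1.1, z.2.1) (z.1.2, z.2.2) - lam (z.1.1, z.2.1) • z.1.2)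

/-! ### Differentiation and prolongation of transport systems -/

namespace CharFlow

variable {X Y J u ux : ℝ → ℝ → ℝ} (hX : CharFlow X Y J u ux)

include hX

theorem continuousOn_comp {E : Type*} [TopologicalSpace E] {w : ℝ → ℝ → E}
    (hw : ContinuousOn (Function.uncurry w) spaceTime) :
    ContinuousOn (Function.uncurry fun t a => w t (X t a)) spaceTime :=
  hw.comp (f := fun p : ℝ × ℝ => (p.1, X p.1 p.2))
    (continuous_fst.prodMk hX.cont).continuousOn fun _ hp => ⟨hp.1, trivial⟩

theorem continuousOn_comp_inv {E : Type*} [TopologicalSpace E] {w : ℝ → ℝ → E}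
    (hw : ContinuousOn (Function.uncurry w) spaceTime) :
    ContinuousOn (Function.uncurry fun t x => w t (Y t x)) spaceTime :=
  hw.comp (f := fun p : ℝ × ℝ => (p.1, Y p.1 p.2))
    (continuousOn_fst.prodMk hX.cont_inv) fun _ hp => ⟨hp.1, trivial⟩

theorem hasDerivAt_inv {t : ℝ} (ht : 0 ≤ t) (x : ℝ) :
    HasDerivAt (Y t) (J t (Y t x))⁻¹ x := by
  refine HasDerivAt.of_local_left_inverse (f := X t)
    (continuousOn_slice_right hX.cont_inv ht).continuousAt
    (hX.hasDerivAt_label t ht _) (hX.jac_pos t ht _).ne'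
    (Eventually.of_forall fun y => hX.right_inv t ht y)

end CharFlow

namespace TransportSystem

variable {E : Type*} [NormedAddCommGroup E] [NormedSpace ℝ E] [ProperSpace E]
  {φ : ℝ → ℝ} {X Y J u ux : ℝ → ℝ → ℝ} {ℓ : E →L[ℝ] ℝ} {F : E × E → E} {lam : E × E → ℝ}
  {f : ℝ → ℝ → E} (S : TransportSystem φ X u ux ℓ F lam f)

include S

/-- Along characteristics, solutions are differentiable in the label, and the derivative solves the
linearized equation. -/
theorem exists_label_derivative (hX : CharFlow X Y J u ux) (hφ : Integrable φ torus)
    {cx : ℝ → ℝ → E} (hcx : ∀ t, 0 ≤ t → ∀ x, HasDerivAt (tconv φ (f t)) (cx t x) x)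
    (hcxc : ContinuousOn (Function.uncurry cx) spaceTime) {T : ℝ} (hT : 0 ≤ T) (a : ℝ) :
    ∃ k : ℝ → E, k 0 = deriv (f 0) a ∧
      (∀ t ∈ Icc 0 T, HasDerivWithinAt k
        (fderiv ℝ F (f t (X t a), tconv φ (f t) (X t a)) (k t, J t a • cx t (X t a))) (Ici 0) t) ∧
      ∀ t ∈ Icc 0 T, HasDerivAt (fun b => f t (X t b)) (k t) a := by
  set P : ℝ → ℝ → E × E := fun t b => (f t (X t b), tconv φ (f t) (X t b)) with hP
  have hPc : ContinuousOn (Function.uncurry P) spaceTime :=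
    (hX.continuousOn_comp S.cont).prodMk (hX.continuousOn_comp (S.tconv_cont hφ))
  have hF1 : ContDiff ℝ 1 F := S.smooth.of_le (by exact_mod_cast le_top)
  have hFP : ContinuousOn (fun t => fderiv ℝ F (P t a)) (Ici 0) :=
    (hF1.continuous_fderiv (by simp)).comp_continuousOn (continuousOn_slice_left hPc a)
  set q : ℝ → ℝ → E := fun t b => tconv φ (f t) (X t b) with hq
  set q' : ℝ → ℝ → E := fun t b => J t b • cx t (X t b) with hq'
  have hqd : ∀ t, 0 ≤ t → ∀ b, HasDerivAt (q t) (q' t b) b := fun t ht b =>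
    (hcx t ht (X t b)).scomp b (hX.hasDerivAt_label t ht b)
  have hq'c : ContinuousOn (Function.uncurry q') spaceTime :=
    hX.jac_cont.smul (hX.continuousOn_comp hcxc)
  -- The derivative of F splits into a part acting on the unknown label derivative and a source
  -- coming from `φ * f`, whose spatial derivative is already known.
  set A : ℝ → E →L[ℝ] E := fun t => (fderiv ℝ F (P t a)).comp (ContinuousLinearMap.inl ℝ E E)
    with hA
  set b : ℝ → E := fun t => fderiv ℝ F (P t a) (0, q' t a) with hb
  have hAc : ContinuousOn A (Ici 0) := hFP.clm_comp continuousOn_const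
  have hbc : ContinuousOn b (Ici 0) :=
    hFP.clm_apply (continuousOn_const.prodMk (continuousOn_slice_left hq'c a))
  obtain ⟨k, hk0, hk⟩ := exists_linear_solution hAc hbc (deriv (f 0) a) hT
  have hsplit : ∀ t w, A t w + b t = fderiv ℝ F (P t a) (w, q' t a) := fun t w => by
    rw [hA, hb, ContinuousLinearMap.comp_apply, ContinuousLinearMap.inl_apply, ← map_add,
      Prod.mk_add_mk, add_zero, zero_add]
  refine ⟨k, hk0, fun t ht => (hk t ht).congr_deriv (hsplit t _), ?_⟩
  obtain ⟨M, hM⟩ := isCompact_Icc.exists_bound_of_continuousOn (s := Icc 0 T)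
    (hAc.mono Icc_subset_Ici_self)
  obtain ⟨N, hN⟩ := isCompact_Icc.exists_bound_of_continuousOn (s := Icc 0 T)
    (hFP.mono Icc_subset_Ici_self)
  have hN0 : 0 ≤ N := (norm_nonneg _).trans (hN 0 ⟨le_rfl, hT⟩)
  obtain ⟨R₁, -, hR₁⟩ := exists_bound_of_periodic S.cont S.periodic T
  obtain ⟨R₂, -, hR₂⟩ := exists_bound_of_periodic (S.tconv_cont hφ)
    (fun t ht => tconv_periodic (S.periodic t ht)) T
  have hPR : ∀ t ∈ Icc 0 T, ∀ c, ‖P t c‖ ≤ max R₁ R₂ := fun t ht c =>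
    max_le_max (hR₁ t ht _) (hR₂ t ht _)
  obtain ⟨L, hL⟩ := S.exists_lipschitz hX hφ T
  obtain ⟨B, hB1, hB⟩ := hX.bilipschitz T
  set κ := ∫ z, |φ z| ∂torus with hκ
  have hκ0 : 0 ≤ κ := integral_nonneg fun _ => abs_nonneg _
  set C := (1 + κ) * (|L| * B) + 1 with hC
  have hC0 : 0 < C := by positivity
  have hPL : ∀ t ∈ Icc 0 T, ∀ c, ‖P t c - P t a‖ ≤ C * |c - a| := by
    intro t ht c
    have h1 := hB t ht 0 ⟨le_rfl, hT⟩ c a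
    rw [hX.init, hX.init] at h1
    have h2 : ∀ x y, |x - y| = |X t c - X t a| → ‖f t x - f t y‖ ≤ |L| * (B * |c - a|) := by
      intro x y hxy
      refine (hL t ht x y).trans ?_
      rw [hxy]
      exact mul_le_mul (le_abs_self L) h1 (abs_nonneg _) (abs_nonneg _)
    have h3 := norm_tconv_sub_le hφ (continuousOn_slice_right S.cont ht.1)
      (x := X t c) (y := X t a) (C := |L| * (B * |c - a|))
      (fun z => h2 _ _ (by rw [sub_sub_sub_cancel_right]))
    have h4 : 0 ≤ |L| * (B * |c - a|) := by positivity
    have h5 : C * |c - a| = |L| * (B * |c - a|) + κ * (|L| * (B * |c - a|)) + |c - a| := by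
      rw [hC]; ring
    have h6 : 0 ≤ κ * (|L| * (B * |c - a|)) := by positivity
    have h7 := abs_nonneg (c - a)
    rw [h5]
    refine max_le ?_ ?_
    · have := h2 (X t c) (X t a) rfl
      simp only [hP, Prod.fst_sub]
      linarith
    · simp only [hP, Prod.snd_sub]
      linarith
  refine hasDerivAt_param_of_linearized (x := fun t c => f t (X t c)) (v := fun t c => F (P t c))
    A b (M := M) (fun c t ht => S.transport c t ht.1) hk hM ?_ ?_
  · have e : (fun c => f 0 (X 0 c)) = f 0 := funext fun c => by rw [hX.init]
    rw [e, hk0]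
    exact (S.init_smooth.differentiable (by simp) a).hasDerivAt
  -- Half of ε goes to the Taylor remainder of F, using the Lipschitz bound on the state, and half
  -- to the expansion of `φ * f` along the flow.
  · intro ε hε
    have hε1 : 0 < ε / (2 * C) := by positivity
    obtain ⟨δ, hδ, hδF⟩ := exists_uniform_linearization hF1 (max R₁ R₂) hε1
    have hε2 : 0 < ε / (2 * (N + 1)) := by positivity
    filter_upwards [eventually_norm_sub_sub_smul_le hqd hq'c T a hε2,
      Metric.ball_mem_nhds a (show 0 < δ / C by positivity)] with c hc hcδ t ht
    have h1 := hPL t ht c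
    have hcδ' : |c - a| < δ / C := hcδ
    have h2 : ‖P t c - P t a‖ < δ := h1.trans_lt (by
      rw [lt_div_iff₀ hC0] at hcδ'
      linarith)
    have h3 := hδF (P t c) (P t a) (hPR t ht c) (hPR t ht a) h2
    have h4 : ε / (2 * C) * ‖P t c - P t a‖ ≤ ε / 2 * |c - a| := by
      calc _ ≤ ε / (2 * C) * (C * |c - a|) := by gcongr
        _ = ε / 2 * |c - a| := by field_simp
    have h5 : ‖fderiv ℝ F (P t a) (0, q t c - q t a - (c - a) • q' t a)‖ ≤ ε / 2 * |c - a| := by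
      refine ((fderiv ℝ F (P t a)).le_of_opNorm_le (hN t ht) _).trans ?_
      have h6 : ‖((0 : E), q t c - q t a - (c - a) • q' t a)‖ ≤ ε / (2 * (N + 1)) * |c - a| := by
        rw [Prod.norm_def, norm_zero]
        exact max_le (by positivity) (hc t ht)
      calc _ ≤ N * (ε / (2 * (N + 1)) * |c - a|) := by gcongr
        _ ≤ (N + 1) * (ε / (2 * (N + 1)) * |c - a|) := by gcongr; linarith
        _ = ε / 2 * |c - a| := by field_simp
    have e : F (P t c) - F (P t a) - A t (f t (X t c) - f t (X t a)) - (c - a) • b t =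
        (F (P t c) - F (P t a) - fderiv ℝ F (P t a) (P t c - P t a)) +
          fderiv ℝ F (P t a) (0, q t c - q t a - (c - a) • q' t a) := by
      have e1 : P t c - P t a = (f t (X t c) - f t (X t a), (0 : E)) + (0, q t c - q t a) := by
        simp [hP, hq]
      have e2 : ((0 : E), q t c - q t a - (c - a) • q' t a) =
          (0, q t c - q t a) - (c - a) • ((0 : E), q' t a) := by simp
      rw [e1, map_add, e2, map_sub (fderiv ℝ F (P t a)), map_smul, hA, hb]
      simp only [ContinuousLinearMap.comp_apply, ContinuousLinearMap.inl_apply]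
      abel
    rw [e]
    refine (norm_add_le _ _).trans ?_
    linarith

/-- A solution of a transport system is continuously differentiable in space, and together with its
derivative it solves a system of the same form. -/
theorem exists_prolongation {ρ₀ u₀ e₀ : ℝ → ℝ} {K : ℝ} (D : NormalData φ ρ₀ u₀ e₀ K)
    (hX : CharFlow X Y J u ux) :
    ∃ g : ℝ → ℝ → E, (∀ t, 0 ≤ t → ∀ x, HasDerivAt (f t) (g t x) x) ∧
      TransportSystem φ X u ux (ℓ.comp (ContinuousLinearMap.fst ℝ E E)) (prolong F lam)
        (fun z => lam (z.1.1, z.2.1)) (fun t x => (f t x, g t x)) := by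
  have hφ := D.kernel_integrable
  obtain ⟨cx, hcx, hcxc⟩ := D.exists_hasDerivAt_tconv S.cont S.periodic
    (S.exists_lipschitz hX hφ)
  have hF1 : ContDiff ℝ 1 F := S.smooth.of_le (by exact_mod_cast le_top)
  -- Being a derivative, it coincides with the solutions k found on the various intervals `[0, T]`,
  -- and so solves the linearized equation for all times.
  set h : ℝ → ℝ → E := fun t a => deriv (fun b => f t (X t b)) a with hh
  have key : ∀ T, 0 ≤ T → ∀ a, ∃ k : ℝ → E, k 0 = deriv (f 0) a ∧
      (∀ t ∈ Icc 0 T, HasDerivWithinAt k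
        (fderiv ℝ F (f t (X t a), tconv φ (f t) (X t a)) (k t, J t a • cx t (X t a))) (Ici 0) t) ∧
      ∀ t ∈ Icc 0 T, HasDerivAt (fun b => f t (X t b)) (k t) a := fun T hT a =>
    S.exists_label_derivative hX hφ hcx hcxc hT a
  have hd : ∀ t, 0 ≤ t → ∀ a, HasDerivAt (fun b => f t (X t b)) (h t a) a := by
    intro t ht a
    obtain ⟨k, -, -, h3⟩ := key t ht a
    exact (h3 t ⟨ht, le_rfl⟩).differentiableAt.hasDerivAt
  have hode : ∀ a t, 0 ≤ t → HasDerivWithinAt (fun s => h s a)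
      (fderiv ℝ F (f t (X t a), tconv φ (f t) (X t a)) (h t a, J t a • cx t (X t a)))
      (Ici 0) t := by
    intro a t ht
    obtain ⟨k, -, h2, h3⟩ := key (t + 1) (by linarith) a
    have e : ∀ s ∈ Icc 0 (t + 1), h s a = k s := fun s hs => (h3 s hs).deriv
    have ht1 : t ∈ Icc 0 (t + 1) := ⟨ht, by linarith⟩
    rw [e t ht1]
    refine (h2 t ht1).congr_of_eventuallyEq ?_ (e t ht1)
    filter_upwards [self_mem_nhdsWithin,
      mem_nhdsWithin_of_mem_nhds (Iio_mem_nhds (show t < t + 1 by linarith))] with s hs0 hs1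
    exact e s ⟨hs0, le_of_lt hs1⟩
  have hX0 : (fun b => f 0 (X 0 b)) = f 0 := funext fun b => by rw [hX.init]
  have h0 : h 0 = deriv (f 0) := by
    funext a
    rw [hh]
    simp only [hX0]
  have hd0 : ContDiff ℝ ∞ (deriv (f 0)) := by
    have := S.init_smooth
    rw [contDiff_infty_iff_deriv] at this
    exact this.2
  have hFPc : ContinuousOn (Function.uncurry fun t a =>
      fderiv ℝ F (f t (X t a), tconv φ (f t) (X t a))) spaceTime :=
    (hF1.continuous_fderiv (by simp)).comp_continuousOn
      ((hX.continuousOn_comp S.cont).prodMk (hX.continuousOn_comp (S.tconv_cont hφ)))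
  have hhc : ContinuousOn (Function.uncurry h) spaceTime :=
    continuousOn_linear_solution
      (A := fun t a => (fderiv ℝ F (f t (X t a), tconv φ (f t) (X t a))).comp
        (ContinuousLinearMap.inl ℝ E E))
      (b := fun t a => fderiv ℝ F (f t (X t a), tconv φ (f t) (X t a)) (0, J t a • cx t (X t a)))
      (hFPc.clm_comp continuousOn_const)
      (hFPc.clm_apply (continuousOn_const.prodMk (hX.jac_cont.smul (hX.continuousOn_comp hcxc))))
      (fun a t ht => (hode a t ht).congr_deriv (by
        rw [ContinuousLinearMap.comp_apply, ContinuousLinearMap.inl_apply, ← map_add,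
          Prod.mk_add_mk, add_zero, zero_add]))
      (by rw [h0]; exact hd0.continuous)
  set g : ℝ → ℝ → E := fun t x => (J t (Y t x))⁻¹ • h t (Y t x) with hg
  have hgd : ∀ t, 0 ≤ t → ∀ x, HasDerivAt (f t) (g t x) x := by
    intro t ht x
    have h1 := (hd t ht (Y t x)).scomp x (hX.hasDerivAt_inv ht x)
    have e : (fun b => f t (X t b)) ∘ Y t = f t := funext fun y => by
      simp only [Function.comp_apply, hX.right_inv t ht]
    rwa [e] at h1
  have hgc : ContinuousOn (Function.uncurry g) spaceTime :=
    (hX.continuousOn_comp_inv (w := fun t a => (J t a)⁻¹)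
      (hX.jac_cont.inv₀ fun p hp => (hX.jac_pos p.1 hp.1 p.2).ne')).smul
      (hX.continuousOn_comp_inv hhc)
  have hfc : ∀ t, 0 ≤ t → Continuous (f t) := fun t ht => continuousOn_slice_right S.cont ht
  have hgct : ∀ t, 0 ≤ t → Continuous (g t) := fun t ht => continuousOn_slice_right hgc ht
  -- The convolution of the derivative is the derivative of the convolution; this closes the system
  -- for the pair `(f, g)`.
  have hcg : ∀ t, 0 ≤ t → ∀ x, tconv φ (g t) x = cx t x := fun t ht x =>
    (hasDerivAt_tconv hφ (hgd t ht) (hgct t ht) x).unique (hcx t ht x)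
  have hpair : ∀ t, 0 ≤ t → ∀ x, tconv φ (fun y => (f t y, g t y)) x =
      (tconv φ (f t) x, cx t x) := fun t ht x => by
    rw [tconv_prod hφ (hfc t ht) (hgct t ht), hcg t ht]
  have hg0 : g 0 = deriv (f 0) := funext fun x => ((hgd 0 le_rfl x).deriv).symm
  refine ⟨g, hgd, ?_, ?_, S.cont.prodMk hgc, ?_, ?_, ?_, ?_, ?_⟩
  · have c1 : ContDiff ℝ ∞ fun z : (E × E) × (E × E) => (z.1.1, z.2.1) := by fun_prop
    have c2 : ContDiff ℝ ∞ fun z : (E × E) × (E × E) => (z.1.2, z.2.2) := by fun_prop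
    have c3 : ContDiff ℝ ∞ fun z : (E × E) × (E × E) => z.1.2 := by fun_prop
    have c4 : ContDiff ℝ ∞ (fderiv ℝ F) := S.smooth.fderiv_right (by simp)
    exact (S.smooth.comp c1).prodMk
      (((c4.comp c1).clm_apply c2).sub ((S.slope_smooth.comp c1).smul c3))
  · have c1 : ContDiff ℝ ∞ fun z : (E × E) × (E × E) => (z.1.1, z.2.1) := by fun_prop
    exact S.slope_smooth.comp c1
  · intro t ht x
    have e : g t (x + 2 * Real.pi) = g t x := by
      refine ((hgd t ht (x + 2 * Real.pi)).comp_add_const x _).unique ?_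
      have : (fun y => f t (y + 2 * Real.pi)) = f t := funext (S.periodic t ht)
      rw [this]
      exact hgd t ht x
    simp only [S.periodic t ht x, e]
  · change ContDiff ℝ ∞ fun x => (f 0 x, g 0 x)
    rw [hg0]
    exact S.init_smooth.prodMk hd0
  · intro a t ht
    rw [hpair t ht]
    have hgX : ∀ s, 0 ≤ s → g s (X s a) = (J s a)⁻¹ • h s a := fun s hs => by
      simp only [hg, hX.left_inv s hs]
    have hJ := (hX.jac_pos t ht a).ne'
    -- The inverse Jacobian decays at rate `ux`, which produces the term `-lam • g` of the prolonged
    -- system.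
    have h1 : HasDerivWithinAt (fun s => (J s a)⁻¹ • h s a)
        ((J t a)⁻¹ • fderiv ℝ F (f t (X t a), tconv φ (f t) (X t a))
          (h t a, J t a • cx t (X t a)) + (-(ux t (X t a) * J t a) / J t a ^ 2) • h t a)
        (Ici 0) t :=
      ((hX.jac_hasDerivWithinAt a t ht).fun_inv hJ).smul (hode a t ht)
    have h2 : HasDerivWithinAt (fun s => g s (X s a))
        (fderiv ℝ F (f t (X t a), tconv φ (f t) (X t a)) (g t (X t a), cx t (X t a)) -
          ux t (X t a) • g t (X t a)) (Ici 0) t := by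
      refine (h1.congr_of_mem (fun s hs => hgX s hs) ht).congr_deriv ?_
      rw [← map_smul, Prod.smul_mk, smul_smul, inv_mul_cancel₀ hJ, one_smul, hgX t ht,
        sub_eq_add_neg, smul_smul, ← neg_smul]
      congr 2
      field_simp
    have h3 := (S.transport a t ht).prodMk h2
    rw [S.slope t ht] at h3
    exact h3
  · intro t ht x
    exact S.vel t ht x
  · intro t ht x
    rw [hpair t ht]
    exact S.slope t ht x

omit [ProperSpace E] in
-- The derivative along the characteristic through x, minus the part due to its motion in space, is
-- the time derivative at x.
theorem hasDerivWithinAt_time (hX : CharFlow X Y J u ux) {g : ℝ → ℝ → E}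
    (hg : ∀ t, 0 ≤ t → ∀ x, HasDerivAt (f t) (g t x) x)
    (hgc : ContinuousOn (Function.uncurry g) spaceTime) {t : ℝ} (ht : 0 ≤ t) (x : ℝ) :
    HasDerivWithinAt (fun s => f s x) (F (f t x, tconv φ (f t) x) - u t x • g t x) (Ici 0) t := by
  have h := (S.transport (Y t x) t ht).sub
    (hasDerivWithinAt_slice_path hg hgc ht (hX.hasDerivWithinAt (Y t x) t ht))
  rw [hX.right_inv t ht] at h
  refine h.congr_of_mem (fun s _ => ?_) ht
  simp

omit S in
/-- Solutions of transport systems with smooth initial data are smooth. -/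
theorem contDiffOn_nat {ρ₀ u₀ e₀ : ℝ → ℝ} {K : ℝ} (D : NormalData φ ρ₀ u₀ e₀ K)
    (hX : CharFlow X Y J u ux) (n : ℕ) : ∀ {E : Type} [NormedAddCommGroup E] [NormedSpace ℝ E]
    [ProperSpace E] {ℓ : E →L[ℝ] ℝ} {F : E × E → E} {lam : E × E → ℝ} {f : ℝ → ℝ → E},
    TransportSystem φ X u ux ℓ F lam f → ContDiffOn ℝ n (Function.uncurry f) spaceTime := by
  -- The claim covers all state spaces and systems, because the inductive step uses it for the
  -- prolonged system on `E × E`.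
  induction n with
  | zero =>
    intro E _ _ _ ℓ F lam f S
    rw [Nat.cast_zero, contDiffOn_zero]
    exact S.cont
  | succ n ih =>
    intro E _ _ _ ℓ F lam f S
    obtain ⟨g, hg, S'⟩ := S.exists_prolongation D hX
    have h1 := ih S'
    have hf : ContDiffOn ℝ n (Function.uncurry f) spaceTime := h1.fst
    have hgn : ContDiffOn ℝ n (Function.uncurry g) spaceTime := h1.snd
    have hc := contDiffOn_tconv D.kernel_integrable n hf
    have hFn : ContDiff ℝ n F := S.smooth.of_le (by exact_mod_cast le_top)
    refine contDiffOn_succ_of_partial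
      (ft := fun t x => F (f t x, tconv φ (f t) x) - ℓ (f t x) • g t x) ?_ hg ?_ hgn
    · intro t ht x
      rw [S.vel t ht]
      exact S.hasDerivWithinAt_time hX hg hgn.continuousOn ht x
    · exact (hFn.comp_contDiffOn (hf.prodMk hc)).sub
        ((ℓ.contDiff.comp_contDiffOn hf).smul hgn)

omit S in
theorem contDiffOn {ρ₀ u₀ e₀ : ℝ → ℝ} {K : ℝ} (D : NormalData φ ρ₀ u₀ e₀ K)
    (hX : CharFlow X Y J u ux) {E : Type} [NormedAddCommGroup E] [NormedSpace ℝ E]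
    [ProperSpace E] {ℓ : E →L[ℝ] ℝ} {F : E × E → E} {lam : E × E → ℝ} {f : ℝ → ℝ → E}
    (S : TransportSystem φ X u ux ℓ F lam f) :
    ContDiffOn ℝ ∞ (Function.uncurry f) spaceTime :=
  contDiffOn_infty.2 fun n => contDiffOn_nat D hX n S

end TransportSystem

/-! ### The Cucker–Smale state as a transport system -/

section Components

variable {E G : Type*} [NormedAddCommGroup E] [NormedSpace ℝ E] [NormedAddCommGroup G]
  [NormedSpace ℝ G] {f : ℝ → E × G} {f' : E × G} {s : Set ℝ} {t : ℝ}

theorem hasDerivWithinAt_fst_comp (h : HasDerivWithinAt f f' s t) :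
    HasDerivWithinAt (fun r => (f r).1) f'.1 s t :=
  (ContinuousLinearMap.fst ℝ E G).hasFDerivAt.comp_hasDerivWithinAt t h

theorem hasDerivWithinAt_snd_comp (h : HasDerivWithinAt f f' s t) :
    HasDerivWithinAt (fun r => (f r).2) f'.2 s t :=
  (ContinuousLinearMap.snd ℝ E G).hasFDerivAt.comp_hasDerivWithinAt t h

theorem hasDerivAt_fst_comp (h : HasDerivAt f f' t) : HasDerivAt (fun r => (f r).1) f'.1 t :=
  (ContinuousLinearMap.fst ℝ E G).hasFDerivAt.comp_hasDerivAt t h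

theorem hasDerivAt_snd_comp (h : HasDerivAt f f' t) : HasDerivAt (fun r => (f r).2) f'.2 t :=
  (ContinuousLinearMap.snd ℝ E G).hasFDerivAt.comp_hasDerivAt t h

end Components

/-- The slope `u_x + φ * ρ` transported by the flow. -/
def solSlope (φ ρ₀ e₀ : ℝ → ℝ) (X : ℝ → ℝ → ℝ) (t x : ℝ) : ℝ :=
  e₀ (flowInv X t x) / jac φ ρ₀ e₀ X t (flowInv X t x)

/-- The state `(ρ, u_x + φ * ρ, u, ρ u)`. -/
def solState (φ ρ₀ u₀ e₀ : ℝ → ℝ) (X : ℝ → ℝ → ℝ) (t x : ℝ) : ℝ × ℝ × ℝ × ℝ :=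
  (solDens φ ρ₀ e₀ X t x, solSlope φ ρ₀ e₀ X t x, solVel φ ρ₀ u₀ X t x,
    solDens φ ρ₀ e₀ X t x * solVel φ ρ₀ u₀ X t x)

/-- The right-hand side of the system satisfied by the state along characteristics. -/
def stateRhs (z : (ℝ × ℝ × ℝ × ℝ) × (ℝ × ℝ × ℝ × ℝ)) : ℝ × ℝ × ℝ × ℝ :=
  (-(z.1.1 * (z.1.2.1 - z.2.1)), -(z.1.2.1 * (z.1.2.1 - z.2.1)),
    z.2.2.2.2 - z.1.2.2.1 * z.2.1,
    -(z.1.1 * (z.1.2.1 - z.2.1)) * z.1.2.2.1 + z.1.1 * (z.2.2.2.2 - z.1.2.2.1 * z.2.1))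

namespace IsFlow

variable {φ ρ₀ u₀ e₀ : ℝ → ℝ} {K : ℝ} {X : ℝ → ℝ → ℝ} (hX : IsFlow φ ρ₀ u₀ X)
  (D : NormalData φ ρ₀ u₀ e₀ K)

include hX D

omit hX in
theorem hasDerivAt_slope (he : Continuous e₀) (a : ℝ) :
    HasDerivAt (fun b => u₀ b + potential φ ρ₀ id b) (e₀ a) a := by
  have h := (he.integral_hasStrictDerivAt 0 a).hasDerivAt.const_add (u₀ 0 + potential φ ρ₀ id 0)
  refine h.congr_of_eventuallyEq (Eventually.of_forall fun b => ?_)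
  have := D.slope_eq 0 b
  simp only
  linarith

theorem exists_bilipschitz (T : ℝ) : ∃ B, 1 ≤ B ∧ ∀ s ∈ Icc 0 T, ∀ t ∈ Icc 0 T, ∀ a b,
    |X s a - X s b| ≤ B * |X t a - X t b| := by
  rcases lt_or_ge T 0 with hT | hT
  · exact ⟨1, le_rfl, fun t ht => absurd (ht.1.trans ht.2) (not_le.2 hT)⟩
  have hK := D.K_nonneg
  have hm := D.mass_nonneg
  refine ⟨Real.exp ((K * (∫ x, ρ₀ x ∂torus) + K + 1) * T) *
    Real.exp ((K * (∫ x, ρ₀ x ∂torus) + 1) * T), ?_, fun s hs t ht a b => ?_⟩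
  · rw [← Real.exp_add]
    exact Real.one_le_exp (by positivity)
  · have h1 := (hX.lipschitz D hs.1).dist_le_mul a b
    rw [Real.coe_toNNReal _ (Real.exp_pos _).le, Real.dist_eq, Real.dist_eq] at h1
    have h2 := (hX.antilipschitz D ht.1).le_mul_dist a b
    rw [Real.coe_toNNReal _ (Real.exp_pos _).le, Real.dist_eq, Real.dist_eq] at h2
    have hs2 := hs.2
    have ht2 := ht.2
    calc _ ≤ _ := h1
      _ ≤ Real.exp ((K * (∫ x, ρ₀ x ∂torus) + K + 1) * T) *
          (Real.exp ((K * (∫ x, ρ₀ x ∂torus) + 1) * T) * |X t a - X t b|) := by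
        gcongr
        refine h2.trans ?_
        gcongr
      _ = _ := by ring

theorem charFlow (he : Continuous e₀) : CharFlow X (flowInv X) (jac φ ρ₀ e₀ X) (solVel φ ρ₀ u₀ X)
    (fun t x => solSlope φ ρ₀ e₀ X t x - flowConv φ ρ₀ X (fun _ _ => 1) t x) where
  init := hX.init
  cont := hX.cont
  hasDerivWithinAt a t ht := by
    rw [hX.solVel_flow D ht]
    exact (hX.hasDerivAt t a).hasDerivWithinAt
  right_inv t ht x := hX.flow_flowInv D ht x
  left_inv t ht a := hX.flowInv_flow D ht a
  cont_inv := hX.continuousOn_flowInv D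
  jac_pos t ht a := jac_pos D ht a
  jac_cont := (hX.continuousOn_jacHom D).add
    ((he.comp continuous_snd).continuousOn.mul (hX.continuousOn_jacSrc D))
  hasDerivAt_label t ht a := hX.hasDerivAt_flow D (hasDerivAt_slope D he a) ht
  jac_hasDerivWithinAt a t ht := by
    refine (hX.hasDerivWithinAt_jac D a ht).congr_deriv ?_
    have := (jac_pos D (X := X) ht a).ne'
    unfold solSlope flowSlope
    rw [hX.flowInv_flow D ht]
    field_simp
  bilipschitz := hX.exists_bilipschitz D

theorem tconv_solDens {t : ℝ} (ht : 0 ≤ t) (x : ℝ) :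
    tconv φ (solDens φ ρ₀ e₀ X t) x = flowConv φ ρ₀ X (fun _ _ => 1) t x := by
  rw [← conv_eq_tconv D.kernel_periodic (hX.solDens_periodic D ht)]
  have hp : IsPeriodic fun y => φ (x - y) := fun y => by
    have h1 := D.kernel_periodic.sub_eq (x - y)
    rw [sub_sub] at h1
    exact h1
  have h := hX.integral_solDens_mul D ht hp
  unfold conv flowConv
  simp only [one_mul]
  rw [← h]
  simp only [mul_comm]

theorem tconv_momentum {t : ℝ} (ht : 0 ≤ t) (x : ℝ) :
    tconv φ (fun y => solDens φ ρ₀ e₀ X t y * solVel φ ρ₀ u₀ X t y) x =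
      flowConv φ ρ₀ X (fun t a => configVel φ ρ₀ u₀ (X t) a) t x := by
  have hm : IsPeriodic fun y => solDens φ ρ₀ e₀ X t y * solVel φ ρ₀ u₀ X t y := fun y => by
    simp only [hX.solDens_periodic D ht y, hX.solVel_periodic D ht y]
  rw [← conv_eq_tconv D.kernel_periodic hm]
  have hp : IsPeriodic fun y => φ (x - y) * solVel φ ρ₀ u₀ X t y := fun y => by
    have h1 := D.kernel_periodic.sub_eq (x - y)
    rw [sub_sub] at h1
    simp only [h1, hX.solVel_periodic D ht y]
  have h := hX.integral_solDens_mul D ht hp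
  simp only [hX.solVel_flow D ht] at h
  unfold conv flowConv
  simp only [← mul_assoc]
  rw [← h]
  congr 1 with y
  ring

theorem force_eq {t : ℝ} (ht : 0 ≤ t) (x : ℝ) :
    force φ (solDens φ ρ₀ e₀ X t) (solVel φ ρ₀ u₀ X t) x =
      flowConv φ ρ₀ X (fun t a => configVel φ ρ₀ u₀ (X t) a) t x -
        solVel φ ρ₀ u₀ X t x * flowConv φ ρ₀ X (fun _ _ => 1) t x := by
  have h := hX.force_flow D ht (flowInv X t x)
  unfold flowForce at h
  rw [hX.flow_flowInv D ht] at h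
  exact h

theorem continuousOn_div_jac (he : Continuous e₀) {w : ℝ → ℝ} (hw : Continuous w) :
    ContinuousOn (Function.uncurry fun t x =>
      w (flowInv X t x) / jac φ ρ₀ e₀ X t (flowInv X t x)) spaceTime :=
  (hX.charFlow D he).continuousOn_comp_inv (w := fun t a => w a / jac φ ρ₀ e₀ X t a)
    ((hw.comp continuous_snd).continuousOn.div (hX.charFlow D he).jac_cont
      fun p hp => (jac_pos D hp.1 p.2).ne')

theorem hasDerivWithinAt_div_jac (c a : ℝ) {t : ℝ} (ht : 0 ≤ t) :
    HasDerivWithinAt (fun s => c / jac φ ρ₀ e₀ X s a)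
      (-(c / jac φ ρ₀ e₀ X t a * (e₀ a / jac φ ρ₀ e₀ X t a - flowSlope φ ρ₀ X t a)))
      (Ici 0) t := by
  have hJ := (jac_pos D (X := X) ht a).ne'
  refine ((hasDerivWithinAt_const t (Ici 0) c).div (hX.hasDerivWithinAt_jac D a ht)
    hJ).congr_deriv ?_
  field_simp
  ring

theorem continuousOn_solState (hρ : Continuous ρ₀) (he : Continuous e₀) :
    ContinuousOn (Function.uncurry (solState φ ρ₀ u₀ e₀ X)) spaceTime := by
  have h1 := hX.continuousOn_div_jac D he hρ
  have h2 := hX.continuousOn_div_jac D he he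
  have h3 := hX.continuousOn_solVel D
  exact h1.prodMk (h2.prodMk (h3.prodMk (h1.mul h3)))

theorem tconv_solState (hρ : Continuous ρ₀) (he : Continuous e₀) {t : ℝ} (ht : 0 ≤ t) (x : ℝ) :
    tconv φ (solState φ ρ₀ u₀ e₀ X t) x = (flowConv φ ρ₀ X (fun _ _ => 1) t x,
      tconv φ (solSlope φ ρ₀ e₀ X t) x, tconv φ (solVel φ ρ₀ u₀ X t) x,
      flowConv φ ρ₀ X (fun t a => configVel φ ρ₀ u₀ (X t) a) t x) := by
  have hφ := D.kernel_integrable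
  have h1 : Continuous (solDens φ ρ₀ e₀ X t) :=
    continuousOn_slice_right (hX.continuousOn_div_jac D he hρ) ht
  have h2 : Continuous (solSlope φ ρ₀ e₀ X t) :=
    continuousOn_slice_right (hX.continuousOn_div_jac D he he) ht
  have h3 : Continuous (solVel φ ρ₀ u₀ X t) :=
    continuousOn_slice_right (hX.continuousOn_solVel D) ht
  rw [← hX.tconv_solDens D ht, ← hX.tconv_momentum D ht]
  unfold solState
  have h4 : Continuous fun y => solDens φ ρ₀ e₀ X t y * solVel φ ρ₀ u₀ X t y := h1.mul h3
  rw [tconv_prod hφ h1 (h2.prodMk (h3.prodMk h4)), tconv_prod hφ h2 (h3.prodMk h4),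
    tconv_prod hφ h3 h4]

/-- The component `e` makes the slope `u_x = e - φ * ρ` a function of the state and its convolution.
The redundant `ρ u` is carried because the force `φ * (ρ u) - u (φ * ρ)` needs its convolution. -/
theorem transportSystem (hρ : ContDiff ℝ ∞ ρ₀) (hu : ContDiff ℝ ∞ u₀) (he : ContDiff ℝ ∞ e₀) :
    TransportSystem φ X (solVel φ ρ₀ u₀ X)
      (fun t x => solSlope φ ρ₀ e₀ X t x - flowConv φ ρ₀ X (fun _ _ => 1) t x)
      (((ContinuousLinearMap.fst ℝ ℝ ℝ).comp (ContinuousLinearMap.snd ℝ ℝ (ℝ × ℝ))).comp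
        (ContinuousLinearMap.snd ℝ ℝ (ℝ × ℝ × ℝ)))
      stateRhs (fun z => z.1.2.1 - z.2.1) (solState φ ρ₀ u₀ e₀ X) where
  smooth := by unfold stateRhs; fun_prop
  slope_smooth := by fun_prop
  cont := hX.continuousOn_solState D hρ.continuous he.continuous
  periodic t ht x := by
    unfold solState solSlope
    rw [hX.solDens_periodic D ht, hX.solVel_periodic D ht, hX.flowInv_add_two_pi D ht,
      hX.jac_add_two_pi D ht, D.slope_periodic]
  init_smooth := by
    have e : solState φ ρ₀ u₀ e₀ X 0 = fun x => (ρ₀ x, e₀ x, u₀ x, ρ₀ x * u₀ x) := by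
      funext x
      unfold solState solSlope
      rw [hX.solDens_zero D, hX.solVel_zero D, hX.flowInv_zero D, jac_zero, div_one]
    rw [e]
    fun_prop
  transport a t ht := by
    rw [hX.tconv_solState D hρ.continuous he.continuous ht]
    have h1 := hX.hasDerivWithinAt_div_jac D (ρ₀ a) a ht
    have h2 := hX.hasDerivWithinAt_div_jac D (e₀ a) a ht
    have h3 := hX.hasDerivWithinAt_vel D a ht
    have e : ∀ s, 0 ≤ s → solState φ ρ₀ u₀ e₀ X s (X s a) =
        (ρ₀ a / jac φ ρ₀ e₀ X s a, e₀ a / jac φ ρ₀ e₀ X s a, configVel φ ρ₀ u₀ (X s) a,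
          ρ₀ a / jac φ ρ₀ e₀ X s a * configVel φ ρ₀ u₀ (X s) a) := fun s hs => by
      unfold solState solSlope
      rw [hX.solDens_flow D hs, hX.solVel_flow D hs, hX.flowInv_flow D hs]
    rw [e t ht]
    exact (h1.prodMk (h2.prodMk (h3.prodMk (h1.mul h3)))).congr_of_mem (fun s hs => e s hs) ht
  vel t ht x := rfl
  slope t ht x := by
    rw [hX.tconv_solState D hρ.continuous he.continuous ht]
    rfl

theorem hasDerivAt_solVel (he : Continuous e₀) {t : ℝ} (ht : 0 ≤ t) (x : ℝ) :
    HasDerivAt (solVel φ ρ₀ u₀ X t)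
      (solSlope φ ρ₀ e₀ X t x - flowConv φ ρ₀ X (fun _ _ => 1) t x) x := by
  have h := (hX.hasDerivAt_vel_label D (hasDerivAt_slope D he (flowInv X t x)) ht).comp x
    ((hX.charFlow D he).hasDerivAt_inv ht x)
  refine h.congr_deriv ?_
  have := (jac_pos D (X := X) ht (flowInv X t x)).ne'
  unfold solSlope flowSlope
  rw [hX.flow_flowInv D ht]
  field_simp

/-- The three equations are components of `f_t = F - u f_x` after substituting `u_x = e - φ * ρ`. -/
theorem isSmoothSolution (hρ : ContDiff ℝ ∞ ρ₀) (hu : ContDiff ℝ ∞ u₀) (he : ContDiff ℝ ∞ e₀) :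
    IsSmoothSolution φ ρ₀ u₀ (solDens φ ρ₀ e₀ X) (solVel φ ρ₀ u₀ X) := by
  have S := hX.transportSystem D hρ hu he
  have C := hX.charFlow D he.continuous
  have hs : ContDiffOn ℝ ∞ (Function.uncurry (solState φ ρ₀ u₀ e₀ X)) spaceTime :=
    TransportSystem.contDiffOn D C S
  obtain ⟨g, hg, S'⟩ := S.exists_prolongation D C
  have ht' := fun (t : ℝ) (ht : 0 ≤ t) (x : ℝ) =>
    S.hasDerivWithinAt_time C hg S'.cont.snd ht x
  have hu' := fun (t : ℝ) (ht : 0 ≤ t) (x : ℝ) => hX.hasDerivAt_solVel D he.continuous ht x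
  have hU : ∀ t : ℝ, 0 ≤ t → UniqueDiffWithinAt ℝ (Ici 0) t := fun t ht => uniqueDiffOn_Ici 0 t ht
  have hρx : ∀ t : ℝ, 0 ≤ t → ∀ x, HasDerivAt (solDens φ ρ₀ e₀ X t) (g t x).1 x := fun t ht x =>
    hasDerivAt_fst_comp (hg t ht x)
  have hux : ∀ t : ℝ, 0 ≤ t → ∀ x, (g t x).2.2.1 =
      solSlope φ ρ₀ e₀ X t x - flowConv φ ρ₀ X (fun _ _ => 1) t x := fun t ht x =>
    (hasDerivAt_fst_comp (hasDerivAt_snd_comp (hasDerivAt_snd_comp (hg t ht x)))).unique (hu' t ht x)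
  -- The spatial derivative of the redundant component must agree with the product rule.
  have hmx : ∀ t : ℝ, 0 ≤ t → ∀ x, (g t x).2.2.2 = (g t x).1 * solVel φ ρ₀ u₀ X t x +
      solDens φ ρ₀ e₀ X t x *
        (solSlope φ ρ₀ e₀ X t x - flowConv φ ρ₀ X (fun _ _ => 1) t x) := fun t ht x =>
    (hasDerivAt_snd_comp (hasDerivAt_snd_comp (hasDerivAt_snd_comp (hg t ht x)))).unique ((hρx t ht x).mul (hu' t ht x))
  refine ⟨fun t ht => ⟨hX.solDens_periodic D ht, hX.solVel_periodic D ht⟩, hs.fst,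
    hs.snd.snd.fst, fun t ht x => solDens_nonneg D ht x,
    fun x => ⟨hX.solDens_zero D x, hX.solVel_zero D x⟩, fun t ht x => ?_, fun t ht x => ?_,
    fun t ht x => ?_⟩
  · have h := hasDerivWithinAt_fst_comp (ht' t ht x)
    rw [hX.tconv_solState D hρ.continuous he.continuous ht] at h
    have h1 : derivWithin (fun s => solDens φ ρ₀ e₀ X s x) (Ici 0) t = _ := h.derivWithin (hU t ht)
    rw [h1, ((hρx t ht x).fun_mul (hu' t ht x)).deriv]
    simp only [stateRhs, solState, Prod.fst_sub, Prod.smul_fst, smul_eq_mul]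
    ring
  · have h := hasDerivWithinAt_snd_comp
      (hasDerivWithinAt_snd_comp (hasDerivWithinAt_snd_comp (ht' t ht x)))
    rw [hX.tconv_solState D hρ.continuous he.continuous ht] at h
    have h1 : derivWithin (fun s => solDens φ ρ₀ e₀ X s x * solVel φ ρ₀ u₀ X s x) (Ici 0) t = _ :=
      h.derivWithin (hU t ht)
    rw [h1, ((hρx t ht x).fun_mul ((hu' t ht x).fun_pow 2)).deriv, hX.force_eq D ht]
    simp only [stateRhs, solState, Prod.snd_sub, Prod.smul_snd, smul_eq_mul, hmx t ht x]
    push_cast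
    ring
  · have h := hasDerivWithinAt_fst_comp
      (hasDerivWithinAt_snd_comp (hasDerivWithinAt_snd_comp (ht' t ht x)))
    rw [hX.tconv_solState D hρ.continuous he.continuous ht] at h
    have h1 : derivWithin (fun s => solVel φ ρ₀ u₀ X s x) (Ici 0) t = _ := h.derivWithin (hU t ht)
    rw [h1, (hu' t ht x).deriv, hX.force_eq D ht]
    simp only [stateRhs, solState, Prod.snd_sub, Prod.smul_snd, Prod.fst_sub, Prod.smul_fst,
      smul_eq_mul, hux t ht x]
    ring

end IsFlow

/-! ### Representatives of functions on the torus -/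

theorem exists_measurable_periodic {f : ℝ → ℝ} (hf : AEStronglyMeasurable f torus) :
    ∃ g : ℝ → ℝ, Measurable g ∧ IsPeriodic g ∧ f =ᵐ[torus] g := by
  have hpi := two_pi_pos
  refine ⟨fun x => hf.mk f (2 * Real.pi * Int.fract (x / (2 * Real.pi))),
    hf.stronglyMeasurable_mk.measurable.comp
      (measurable_const.mul (measurable_fract.comp (measurable_id.div_const _))), fun x => ?_, ?_⟩
  · simp only [add_div, div_self hpi.ne', Int.fract_add_one]
  -- The fractional part sends `2π` to 0, so at this endpoint of the fundamental domain the
  -- representative may differ from f.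
  · have hne : ∀ᵐ x ∂torus, x ≠ 2 * Real.pi := ae_restrict_of_ae (by simp [ae_iff])
    filter_upwards [hf.ae_eq_mk, ae_restrict_mem measurableSet_Ioc, hne] with x h1 h2 h3
    have h4 : Int.fract (x / (2 * Real.pi)) = x / (2 * Real.pi) :=
      Int.fract_eq_self.2 ⟨div_nonneg h2.1.le hpi.le,
        (div_lt_one hpi).2 (lt_of_le_of_ne h2.2 h3)⟩
    rw [h4, mul_div_cancel₀ _ hpi.ne', h1]

theorem exists_bounded_periodic {f : ℝ → ℝ} (hf : MemLp f ⊤ torus) :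
    ∃ (g : ℝ → ℝ) (C : ℝ), Measurable g ∧ IsPeriodic g ∧ (∀ x, |g x| ≤ C) ∧ f =ᵐ[torus] g := by
  obtain ⟨g, hgm, hgp, hfg⟩ := exists_measurable_periodic hf.aestronglyMeasurable
  set C := (eLpNormEssSup f torus).toReal with hC
  have hC0 : 0 ≤ C := ENNReal.toReal_nonneg
  have hfin : eLpNormEssSup f torus ≠ ⊤ := by
    have := hf.eLpNorm_ne_top
    rwa [eLpNorm_exponent_top] at this
  refine ⟨fun x => max (-C) (min C (g x)), C, measurable_const.max (measurable_const.min hgm),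
    fun x => by simp only [hgp x], fun x => ?_, ?_⟩
  · exact abs_le.2 ⟨le_max_left _ _, max_le (by linarith) (min_le_left _ _)⟩
  · filter_upwards [hfg, ae_le_eLpNormEssSup (f := f) (μ := torus)] with x h1 h2
    have h3 : |f x| ≤ C := by
      have := ENNReal.toReal_mono hfin h2
      rwa [toReal_enorm, Real.norm_eq_abs] at this
    rw [h1] at h3 ⊢
    rw [min_eq_right (abs_le.1 h3).2, max_eq_right (abs_le.1 h3).1]

/-- The support stays away from the ends of the period, so near every point the periodization is, up
to a period shift, a sum of two translates of g. -/
theorem exists_periodic_extension {g : ℝ → ℝ} (hg : ContDiff ℝ ∞ g)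
    (hs : tsupport g ⊆ Ioo 0 (2 * Real.pi)) :
    ∃ η : ℝ → ℝ, ContDiff ℝ ∞ η ∧ IsPeriodic η ∧ ∀ x ∈ Ioc 0 (2 * Real.pi), η x = g x := by
  have hpi := two_pi_pos
  have hz : ∀ x, x ∉ Ioo 0 (2 * Real.pi) → g x = 0 := fun x hx =>
    image_eq_zero_of_notMem_tsupport fun h => hx (hs h)
  set η : ℝ → ℝ := fun x => g (2 * Real.pi * Int.fract (x / (2 * Real.pi))) with hη
  have hp : IsPeriodic η := fun x => by
    simp only [hη, add_div, div_self hpi.ne', Int.fract_add_one]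
  have h0 : ∀ x ∈ Ico 0 (2 * Real.pi), η x = g x := fun x hx => by
    have h4 : Int.fract (x / (2 * Real.pi)) = x / (2 * Real.pi) :=
      Int.fract_eq_self.2 ⟨div_nonneg hx.1 hpi.le, (div_lt_one hpi).2 hx.2⟩
    simp only [hη]
    rw [h4, mul_div_cancel₀ _ hpi.ne']
  have h1 : ∀ x ∈ Ioo (-(2 * Real.pi)) (2 * Real.pi), g x + g (x + 2 * Real.pi) = η x := by
    intro x hx
    rcases lt_or_ge x 0 with hx0 | hx0
    · rw [hz x fun h => absurd h.1 (not_lt.2 hx0.le), zero_add, ← hp x,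
        h0 _ ⟨by linarith [hx.1], by linarith⟩]
    · rw [hz (x + 2 * Real.pi) fun h => absurd h.2 (not_lt.2 (by linarith)), add_zero,
        h0 x ⟨hx0, hx.2⟩]
  refine ⟨η, contDiff_iff_contDiffAt.2 fun x => ?_, hp, fun x hx => ?_⟩
  · set n : ℤ := ⌊x / (2 * Real.pi)⌋ with hn
    set c : ℝ := n • (2 * Real.pi) with hc
    have hmem : x - c ∈ Ioo (-(2 * Real.pi)) (2 * Real.pi) := by
      have e : x - c = 2 * Real.pi * Int.fract (x / (2 * Real.pi)) := by
        rw [Int.fract, mul_sub, mul_div_cancel₀ _ hpi.ne', hc, zsmul_eq_mul]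
        ring
      have e1 := Int.fract_nonneg (x / (2 * Real.pi))
      have e2 := Int.fract_lt_one (x / (2 * Real.pi))
      rw [e]
      constructor <;> nlinarith
    have hd : ContDiff ℝ ∞ fun y => g (y - c) + g (y - c + 2 * Real.pi) := by fun_prop
    refine hd.contDiffAt.congr_of_eventuallyEq ?_
    have hopen : IsOpen ((fun y => y - c) ⁻¹' Ioo (-(2 * Real.pi)) (2 * Real.pi)) :=
      isOpen_Ioo.preimage (by fun_prop)
    filter_upwards [hopen.mem_nhds hmem] with y hy
    rw [h1 (y - c) hy, hc, hp.sub_zsmul_eq]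
  · rcases eq_or_lt_of_le hx.2 with h | h
    · have h2 := hp 0
      rw [zero_add] at h2
      rw [h, h2, h0 0 ⟨le_rfl, hpi⟩, hz 0 (by simp), hz _ (by simp)]
    · exact h0 x ⟨hx.1.le, h⟩

theorem ae_eq_zero_of_integral_mul_eq_zero {f : ℝ → ℝ} (hf : Integrable f torus)
    (h : ∀ η : ℝ → ℝ, ContDiff ℝ ∞ η → IsPeriodic η → ∫ x, f x * η x ∂torus = 0) :
    ∀ᵐ x ∂torus, f x = 0 := by
  have hU : IntegrableOn f (Ioo 0 (2 * Real.pi)) := IntegrableOn.mono_set hf Ioo_subset_Ioc_self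
  have key := isOpen_Ioo.ae_eq_zero_of_integral_contDiff_smul_eq_zero (μ := volume) (f := f)
    hU.locallyIntegrableOn fun g hg _ hgs => by
      obtain ⟨η, hη, hηp, hηg⟩ := exists_periodic_extension hg hgs
      rw [← h η hη hηp, ← setIntegral_eq_integral_of_forall_compl_eq_zero
        (s := Ioc 0 (2 * Real.pi)) fun x hx => by
          rw [image_eq_zero_of_notMem_tsupport fun hx' => hx (Ioo_subset_Ioc_self (hgs hx')),
            zero_smul]]
      refine setIntegral_congr_fun measurableSet_Ioc fun x hx => ?_
      simp only [hηg x hx, smul_eq_mul, mul_comm]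
  have hne : ∀ᵐ x ∂torus, x ≠ 2 * Real.pi := ae_restrict_of_ae (by simp [ae_iff])
  filter_upwards [ae_restrict_of_ae key, ae_restrict_mem measurableSet_Ioc, hne] with x h1 h2 h3
  exact h1 ⟨h2.1, lt_of_le_of_ne h2.2 h3⟩

theorem integrable_mul_of_continuous {f η : ℝ → ℝ} (hf : Integrable f torus) (hη : Continuous η) :
    Integrable (fun x => f x * η x) torus :=
  (integrable_continuousOn_mul hη.continuousOn hf).congr
    (Eventually.of_forall fun _ => mul_comm _ _)

/-- A function on the torus whose weak derivative vanishes is almost everywhere constant. -/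
theorem exists_ae_eq_const_of_hasWeakDeriv_zero {f : ℝ → ℝ} (hf : Integrable f torus)
    (h : HasWeakDeriv f 0) : ∃ c, ∀ᵐ x ∂torus, f x = c := by
  have hpi := two_pi_pos
  set c := (2 * Real.pi)⁻¹ * ∫ x, f x ∂torus with hc
  refine ⟨c, ?_⟩
  have hfc : Integrable (fun x => f x - c) torus := hf.sub (integrable_const c)
  refine (ae_eq_zero_of_integral_mul_eq_zero hfc fun η hη hηp => ?_).mono
    fun x hx => sub_eq_zero.1 hx
  -- Removing the mean makes the primitive of η periodic, hence a legitimate test function.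
  set m := (2 * Real.pi)⁻¹ * ∫ x, η x ∂torus with hm
  have hηc := hη.continuous
  have hηi : Integrable η torus := integrable_torus_of_continuousOn hηc.continuousOn
  have hcont : Continuous fun x => η x - m := hηc.sub continuous_const
  set ψ : ℝ → ℝ := fun x => ∫ y in (0 : ℝ)..x, (η y - m) with hψ
  have hψd : ∀ x, HasDerivAt ψ (η x - m) x := fun x =>
    (hcont.integral_hasStrictDerivAt 0 x).hasDerivAt
  have hψ' : deriv ψ = fun x => η x - m := funext fun x => (hψd x).deriv
  have hψs : ContDiff ℝ ∞ ψ := by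
    rw [contDiff_infty_iff_deriv]
    refine ⟨fun x => (hψd x).differentiableAt, ?_⟩
    rw [hψ']
    exact hη.sub contDiff_const
  have hvol : ∫ _ : ℝ, m ∂torus = 2 * Real.pi * m := by
    rw [integral_torus_eq_intervalIntegral, intervalIntegral.integral_const, sub_zero, smul_eq_mul]
  have hψp : IsPeriodic ψ := fun x => by
    have e1 : ψ (x + 2 * Real.pi) - ψ x = ∫ y in x..(x + 2 * Real.pi), (η y - m) := by
      simp only [hψ]
      rw [intervalIntegral.integral_interval_sub_left (hcont.intervalIntegrable _ _)
        (hcont.intervalIntegrable _ _)]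
    have hper : Function.Periodic (fun y => η y - m) (2 * Real.pi) := fun y => by
      simp only [hηp y]
    rw [← integral_torus_eq_shift hper x, integral_sub hηi (integrable_const m), hvol, hm,
      ← mul_assoc, mul_inv_cancel₀ hpi.ne', one_mul, sub_self] at e1
    linarith
  have h1 := h ψ hψs hψp
  rw [hψ'] at h1
  simp only [Pi.zero_apply, zero_mul, integral_zero, neg_zero, mul_sub] at h1
  rw [integral_sub (integrable_mul_of_continuous hf hηc) (hf.mul_const m), integral_mul_const] at h1
  simp only [sub_mul]
  rw [integral_sub (integrable_mul_of_continuous hf hηc) (hηi.const_mul c), integral_const_mul]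
  have e : c * ∫ x, η x ∂torus = (∫ x, f x ∂torus) * m := by
    rw [hc, hm]; ring
  linarith

theorem hasWeakDeriv_unique {f g g' : ℝ → ℝ} (hg : Integrable g torus) (hg' : Integrable g' torus)
    (h : HasWeakDeriv f g) (h' : HasWeakDeriv f g') : g =ᵐ[torus] g' := by
  have := ae_eq_zero_of_integral_mul_eq_zero (hg.sub hg') fun η hη hηp => by
    simp only [Pi.sub_apply, sub_mul]
    rw [integral_sub (integrable_mul_of_continuous hg hη.continuous)
      (integrable_mul_of_continuous hg' hη.continuous)]
    have h1 := h η hη hηp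
    have h2 := h' η hη hηp
    linarith
  exact this.mono fun x hx => sub_eq_zero.1 hx

/-- Functions of class `W^{1,∞}` have a representative that is the primitive of a bounded
function. -/
theorem exists_primitive_representative {u u' : ℝ → ℝ} (hu : MemW1Infty u u') :
    ∃ (w v : ℝ → ℝ) (C : ℝ), Continuous w ∧ IsPeriodic w ∧ Measurable v ∧ IsPeriodic v ∧
      (∀ x, |v x| ≤ C) ∧ (∀ a b, w b - w a = ∫ x in a..b, v x) ∧ u =ᵐ[torus] w ∧
      u' =ᵐ[torus] v := by
  obtain ⟨v, C, hvm, hvp, hvC, huv⟩ := exists_bounded_periodic hu.memLp_deriv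
  have hvi := intervalIntegrable_of_measurable_of_le hvm hvC
  have hC0 : 0 ≤ C := (abs_nonneg _).trans (hvC 0)
  set W : ℝ → ℝ := fun x => ∫ y in (0 : ℝ)..x, v y with hW
  have hWsub : ∀ a b, W b - W a = ∫ x in a..b, v x := fun a b =>
    intervalIntegral.integral_interval_sub_left (hvi _ _) (hvi _ _)
  -- Testing with the constant 1: a weak derivative has mean zero, so its primitive is periodic.
  have hv0 : ∫ x, v x ∂torus = 0 := by
    have h := hu.weakDeriv (fun _ => 1) contDiff_const fun _ => rfl
    simp only [deriv_const, mul_zero, integral_zero, mul_one] at h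
    rw [← integral_congr_ae huv]
    linarith
  have hWp : IsPeriodic W := fun x => by
    have h := hWsub x (x + 2 * Real.pi)
    rw [← integral_torus_eq_shift hvp x, hv0] at h
    linarith
  have hWL : LipschitzWith C.toNNReal W := LipschitzWith.of_dist_le_mul fun x y => by
    rw [Real.coe_toNNReal _ hC0, Real.dist_eq, Real.dist_eq, hWsub]
    exact intervalIntegral.norm_integral_le_of_norm_le_const (f := v) fun z _ => hvC z
  have hWW := memW1Infty_of_lipschitz hWp hWL
  have hWd : ∀ᵐ x ∂torus, deriv W x = v x := by
    have hl : LocallyIntegrable v volume :=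
      (locallyIntegrable_const C).mono hvm.aestronglyMeasurable
        (Eventually.of_forall fun x => (hvC x).trans (le_abs_self C))
    refine ae_restrict_of_ae ?_
    filter_upwards [LocallyIntegrable.ae_hasDerivAt_integral hl] with x hx
    exact (hx 0).deriv
  have hui : Integrable u torus := hu.memLp.integrable le_top
  have hWi : Integrable W torus := integrable_torus_of_continuousOn hWL.continuous.continuousOn
  obtain ⟨c, hc⟩ := exists_ae_eq_const_of_hasWeakDeriv_zero (hui.sub hWi) fun ψ hψ hψp => by
    have hψ' : Continuous (deriv ψ) := hψ.continuous_deriv (by simp)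
    simp only [Pi.sub_apply, sub_mul, Pi.zero_apply, zero_mul, integral_zero, neg_zero]
    rw [integral_sub (integrable_mul_of_continuous hui hψ')
      (integrable_mul_of_continuous hWi hψ'), hu.weakDeriv ψ hψ hψp, hWW.weakDeriv ψ hψ hψp]
    have : ∫ x, u' x * ψ x ∂torus = ∫ x, deriv W x * ψ x ∂torus := by
      refine integral_congr_ae ?_
      filter_upwards [huv, hWd] with x h1 h2
      rw [h1, h2]
    linarith
  refine ⟨fun x => W x + c, v, C, hWL.continuous.add continuous_const, fun x => by
    simp only [hWp x], hvm, hvp, hvC, fun a b => by rw [← hWsub]; ring, ?_, huv⟩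
  filter_upwards [hc] with x hx
  simp only [Pi.sub_apply] at hx
  linarith

/-! ### Normal form of the data -/

section Conv

variable {φ ρ₀ : ℝ → ℝ} {K : ℝ}

theorem measurable_conv (hφ : Measurable φ) (hρ : Measurable ρ₀) : Measurable (conv φ ρ₀) :=
  (StronglyMeasurable.integral_prod_right (ν := torus) (f := fun x y => φ (x - y) * ρ₀ y)
    ((hφ.comp (measurable_fst.sub measurable_snd)).mul
      (hρ.comp measurable_snd)).stronglyMeasurable).measurable

theorem abs_conv_le (hφK : ∀ z, |φ z| ≤ K) (hρ : Integrable ρ₀ torus) (x : ℝ) :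
    |conv φ ρ₀ x| ≤ K * ∫ y, |ρ₀ y| ∂torus := by
  rw [← integral_const_mul, ← Real.norm_eq_abs]
  refine norm_integral_le_of_norm_le (hρ.abs.const_mul K) (Eventually.of_forall fun y => ?_)
  rw [norm_mul, Real.norm_eq_abs, Real.norm_eq_abs]
  exact mul_le_mul_of_nonneg_right (hφK _) (abs_nonneg _)

theorem conv_periodic (hφ : IsPeriodic φ) : IsPeriodic (conv φ ρ₀) := fun x => by
  unfold conv
  congr 1 with y
  rw [add_sub_right_comm, hφ]

theorem potential_sub_eq_integral_conv (hφ : Measurable φ) (hφK : ∀ z, |φ z| ≤ K)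
    (hρ : Integrable ρ₀ torus) (a b : ℝ) :
    potential φ ρ₀ id b - potential φ ρ₀ id a = ∫ x in a..b, conv φ ρ₀ x := by
  have hφi := intervalIntegrable_of_measurable_of_le hφ hφK
  have hc : Continuous (prim φ) := intervalIntegral.continuous_primitive hφi 0
  have hi : ∀ x, Integrable (fun y => prim φ (x - id y) * ρ₀ y) torus := fun x =>
    integrable_continuousOn_mul (hc.comp (continuous_const.sub continuous_id)).continuousOn hρ
  have hfin : IsFiniteMeasure (volume.restrict (uIoc a b)) := by
    unfold uIoc
    infer_instance
  have hprod : Integrable (Function.uncurry fun x y => φ (x - y) * ρ₀ y)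
      ((volume.restrict (uIoc a b)).prod torus) := by
    have h1 : Integrable (fun z : ℝ × ℝ => K * |ρ₀ z.2|)
      ((volume.restrict (uIoc a b)).prod torus) := (integrable_const K).mul_prod hρ.abs
    refine h1.mono' ((hφ.comp (measurable_fst.sub measurable_snd)).aestronglyMeasurable.mul
      hρ.aestronglyMeasurable.comp_snd) (Eventually.of_forall fun z => ?_)
    simp only [Function.uncurry, norm_mul, Real.norm_eq_abs]
    exact mul_le_mul_of_nonneg_right (hφK _) (abs_nonneg _)
  unfold conv potential
  rw [intervalIntegral_integral_swap hprod, ← integral_sub (hi b) (hi a)]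
  congr 1 with y
  rw [intervalIntegral.integral_mul_const, ← sub_mul, prim_sub_prim hφi, id,
    intervalIntegral.integral_comp_sub_right]

theorem contDiff_conv (hφ : IsPeriodic φ) (hφi : Integrable φ torus) (hρp : IsPeriodic ρ₀)
    (hρ : ContDiff ℝ ∞ ρ₀) : ContDiff ℝ ∞ (conv φ ρ₀) := by
  have e : conv φ ρ₀ = tconv φ ρ₀ := funext (conv_eq_tconv hφ hρp)
  rw [e, contDiff_infty]
  intro n
  have h := contDiffOn_tconv hφi n (f := fun _ => ρ₀)
    ((hρ.of_le (by exact_mod_cast le_top)).comp contDiff_snd).contDiffOn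
  exact h.comp_contDiff (f := fun x : ℝ => ((0 : ℝ), x)) (by fun_prop)
    fun x => ⟨mem_Ici.2 le_rfl, trivial⟩

/-- The map `y ↦ x - y` preserves null sets, so the value at every single x is unaffected by the
choice of representatives. -/
theorem conv_congr_ae {φ' ρ₀' : ℝ → ℝ} (hφ : φ =ᵐ[volume] φ') (hρ : ρ₀ =ᵐ[torus] ρ₀') (x : ℝ) :
    conv φ ρ₀ x = conv φ' ρ₀' x := by
  refine integral_congr_ae ?_
  filter_upwards [hρ, ae_restrict_of_ae
    ((Measure.measurePreserving_sub_left volume x).quasiMeasurePreserving.ae hφ)] with y h1 h2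
  rw [h1, h2]

theorem force_congr_ae {φ' ρ u : ℝ → ℝ} (hφ : φ =ᵐ[volume] φ') :
    force φ ρ u = force φ' ρ u := by
  funext x
  refine integral_congr_ae ?_
  filter_upwards [ae_restrict_of_ae
    ((Measure.measurePreserving_sub_left volume x).quasiMeasurePreserving.ae hφ)] with y h2
  rw [h2]

end Conv

/-- Truncating the slope at 0 changes it only on a null set, by subcriticality, so the primitive
relation survives while nonnegativity becomes valid everywhere. -/
theorem exists_normalData {φ ρ₀ u₀ v : ℝ → ℝ} {K C : ℝ} (hφm : Measurable φ) (hφp : IsPeriodic φ)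
    (hφK : ∀ z, |φ z| ≤ K) (hρm : Measurable ρ₀) (hρp : IsPeriodic ρ₀) (hρ0 : ∀ x, 0 ≤ ρ₀ x)
    (hρi : Integrable ρ₀ torus) (huc : Continuous u₀) (hup : IsPeriodic u₀) (hvm : Measurable v)
    (hvp : IsPeriodic v) (hvC : ∀ x, |v x| ≤ C) (huv : ∀ a b, u₀ b - u₀ a = ∫ x in a..b, v x)
    (hpos : ∀ᵐ x ∂torus, 0 ≤ v x + conv φ ρ₀ x) :
    ∃ M, NormalData φ ρ₀ u₀ (fun x => max 0 (v x + conv φ ρ₀ x)) M := by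
  have hcm := measurable_conv hφm hρm
  have hcp : IsPeriodic (conv φ ρ₀) := conv_periodic hφp
  have hK0 : 0 ≤ K := (abs_nonneg _).trans (hφK 0)
  have hC0 : 0 ≤ C := (abs_nonneg _).trans (hvC 0)
  set m := ∫ y, |ρ₀ y| ∂torus with hm
  have hm0 : 0 ≤ m := integral_nonneg fun _ => abs_nonneg _
  have hcK : ∀ x, |conv φ ρ₀ x| ≤ K * m := abs_conv_le hφK hρi
  have hKm : 0 ≤ K * m := by positivity
  have hpos' : ∀ᵐ x, 0 ≤ v x + conv φ ρ₀ x :=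
    (ae_torus_iff fun x => by rw [hvp x, hcp x]).1 hpos
  -- One constant must bound both the kernel, by `K`, and the slope, by `C + K * m`.
  refine ⟨K + C + K * m, hφm, hφp, fun z => (hφK z).trans (by linarith), hρm, hρp, hρ0, hρi, huc,
    hup, measurable_const.max (hvm.add hcm), fun x => by simp only [hvp x, hcp x],
    fun x => le_max_left _ _, fun x => max_le (by linarith) ?_, fun a b => ?_⟩
  · linarith [(abs_le.1 (hvC x)).2, (abs_le.1 (hcK x)).2]
  · have e : ∫ x in a..b, max 0 (v x + conv φ ρ₀ x) = ∫ x in a..b, (v x + conv φ ρ₀ x) :=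
      intervalIntegral.integral_congr_ae (hpos'.mono fun x hx _ => max_eq_right hx)
    rw [e, intervalIntegral.integral_add (intervalIntegrable_of_measurable_of_le hvm hvC a b)
      (intervalIntegrable_of_measurable_of_le hcm hcK a b), ← huv,
      ← potential_sub_eq_integral_conv hφm hφK hρi]
    ring

theorem IsGlobalSolution.congr_data {φ φ' ρ₀ ρ₀' u₀ u₀' : ℝ → ℝ} {ρ u : ℝ → ℝ → ℝ}
    (h : IsGlobalSolution φ' ρ₀' u₀' ρ u) (hφ : φ =ᵐ[volume] φ') (hρ : ρ₀ =ᵐ[torus] ρ₀')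
    (hu : u₀ =ᵐ[torus] u₀') : IsGlobalSolution φ ρ₀ u₀ ρ u where
  density_mem := h.density_mem
  density_continuous := h.density_continuous
  velocity_continuous := h.velocity_continuous
  velocity_mem := h.velocity_mem
  initial_density := h.initial_density.trans hρ.symm
  initial_velocity := h.initial_velocity.trans hu.symm
  mass ψ hψ t ht := by
    rw [← h.mass ψ hψ t ht]
    congr 1
    exact integral_congr_ae (hρ.mono fun x hx => by simp only [hx])
  momentum ψ hψ t ht := by
    simp only [force_congr_ae hφ]
    rw [← h.momentum ψ hψ t ht]
    congr 1
    refine integral_congr_ae ?_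
    filter_upwards [hρ, hu] with x h1 h2
    rw [h1, h2]
  velocity ψ hψ t ht := by
    simp only [force_congr_ae hφ]
    rw [← h.velocity ψ hψ t ht]
    congr 1
    exact integral_congr_ae (hu.mono fun x hx => by simp only [hx])

theorem IsSmoothSolution.congr_kernel {φ φ' ρ₀ u₀ : ℝ → ℝ} {ρ u : ℝ → ℝ → ℝ}
    (h : IsSmoothSolution φ' ρ₀ u₀ ρ u) (hφ : φ =ᵐ[volume] φ') :
    IsSmoothSolution φ ρ₀ u₀ ρ u where
  periodic := h.periodic
  density_smooth := h.density_smooth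
  velocity_smooth := h.velocity_smooth
  density_nonneg := h.density_nonneg
  initial := h.initial
  mass := h.mass
  momentum t ht x := by rw [force_congr_ae hφ]; exact h.momentum t ht x
  velocity t ht x := by rw [force_congr_ae hφ]; exact h.velocity t ht x

theorem nonneg_of_ae_torus {f : ℝ → ℝ} (hf : Continuous f) (hp : IsPeriodic f)
    (h : ∀ᵐ x ∂torus, 0 ≤ f x) (x : ℝ) : 0 ≤ f x := by
  have h' : ∀ᵐ x, 0 ≤ f x := (ae_torus_iff fun x => by rw [hp x]).1 h
  have hd : Dense {x | 0 ≤ f x} := Measure.dense_of_ae h'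
  have hc : IsClosed {x | 0 ≤ f x} := isClosed_le continuous_const hf
  have : x ∈ closure {x | 0 ≤ f x} := hd x
  rwa [hc.closure_eq] at this

/-! ### Existence for rough and for smooth data -/

theorem exists_global_solution {φ ρ₀ u₀ u₀' : ℝ → ℝ} (hφ : IsBoundedKernel φ)
    (hρ₀ : MemL1Plus ρ₀) (hu₀ : MemW1Infty u₀ u₀')
    (hsub : ∀ᵐ x ∂torus, 0 < u₀' x + conv φ ρ₀ x) :
    ∃ ρ u : ℝ → ℝ → ℝ, IsGlobalSolution φ ρ₀ u₀ ρ u := by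
  obtain ⟨η, K, hηm, hηp, hηK, hη⟩ := exists_bounded_periodic hφ.bounded
  have hη' : φ =ᵐ[volume] η := (ae_torus_iff fun x => by rw [hφ.periodic x, hηp x]).1 hη
  obtain ⟨r, hrm, hrp, hr⟩ := exists_measurable_periodic hρ₀.integrable.aestronglyMeasurable
  have hr' : ρ₀ =ᵐ[torus] fun x => max 0 (r x) := by
    filter_upwards [hr, hρ₀.nonneg] with x h1 h2
    rw [h1] at h2 ⊢
    rw [max_eq_right h2]
  obtain ⟨w, v, C, hwc, hwp, hvm, hvp, hvC, hwv, huw, huv⟩ := exists_primitive_representative hu₀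
  obtain ⟨M, D⟩ := exists_normalData (ρ₀ := fun x => max 0 (r x)) hηm hηp hηK
    (measurable_const.max hrm)
    (fun x => by simp only [hrp x]) (fun x => le_max_left _ _) (hρ₀.integrable.congr hr') hwc hwp
    hvm hvp hvC hwv (by
      filter_upwards [hsub, huv] with x h1 h2
      rw [← conv_congr_ae hη' hr', ← h2]
      exact h1.le)
  obtain ⟨X, hX⟩ := D.exists_flow
  exact ⟨_, _, (hX.isGlobalSolution D).congr_data hη' hr' huw⟩

/-- Here the data themselves are kept and only the kernel is replaced by a representative. The weak
derivative of `u₀` is the classical one, and by continuity the slope is nonnegative everywhere, so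
the truncation disappears and the slope is smooth. -/
theorem exists_smooth_solution {φ ρ₀ u₀ u₀' : ℝ → ℝ} (hφ : IsBoundedKernel φ)
    (hρ₀ : MemL1Plus ρ₀) (hu₀ : MemW1Infty u₀ u₀')
    (hsub : ∀ᵐ x ∂torus, 0 < u₀' x + conv φ ρ₀ x) (hρs : ContDiff ℝ ∞ ρ₀)
    (hus : ContDiff ℝ ∞ u₀) :
    ∃ ρ u : ℝ → ℝ → ℝ, IsGlobalSolution φ ρ₀ u₀ ρ u ∧ IsSmoothSolution φ ρ₀ u₀ ρ u := by
  obtain ⟨η, K, hηm, hηp, hηK, hη⟩ := exists_bounded_periodic hφ.bounded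
  have hη' : φ =ᵐ[volume] η := (ae_torus_iff fun x => by rw [hφ.periodic x, hηp x]).1 hη
  have hηi : Integrable η torus :=
    integrable_torus_iff.2 (intervalIntegrable_of_measurable_of_le hηm hηK _ _)
  obtain ⟨L, hL0, hL⟩ := exists_lipschitz_of_periodic (hus.of_le (by exact_mod_cast le_top))
    hu₀.periodic
  have hLip : LipschitzWith L.toNNReal u₀ := LipschitzWith.of_dist_le_mul fun x y => by
    rw [Real.coe_toNNReal _ hL0.le, dist_eq_norm, Real.dist_eq]
    exact hL x y
  have hds : ContDiff ℝ ∞ (deriv u₀) := (contDiff_infty_iff_deriv.1 hus).2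
  have hW := memW1Infty_of_lipschitz hu₀.periodic hLip
  have hdp : IsPeriodic (deriv u₀) := fun x => by
    have h : u₀ = fun y => u₀ (y + 2 * Real.pi) := funext fun y => (hu₀.periodic y).symm
    conv_rhs => rw [h]
    rw [deriv_comp_add_const]
  have huv : u₀' =ᵐ[torus] deriv u₀ :=
    hasWeakDeriv_unique (hu₀.memLp_deriv.integrable le_top) (hW.memLp_deriv.integrable le_top)
      hu₀.weakDeriv hW.weakDeriv
  have hpos : ∀ᵐ x ∂torus, 0 ≤ deriv u₀ x + conv η ρ₀ x := by
    filter_upwards [hsub, huv] with x h1 h2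
    rw [← conv_congr_ae hη' (ae_eq_refl ρ₀), ← h2]
    exact h1.le
  obtain ⟨M, D⟩ := exists_normalData hηm hηp hηK hρs.continuous.measurable hρ₀.periodic
    (nonneg_of_ae_torus hρs.continuous hρ₀.periodic hρ₀.nonneg) hρ₀.integrable hus.continuous
    hu₀.periodic hds.continuous.measurable hdp (C := L.toNNReal)
    (fun x => norm_deriv_le_of_lipschitz hLip)
    (fun a b => (intervalIntegral.integral_deriv_eq_sub (fun x _ => hus.differentiable (by simp) x)
      (hds.continuous.intervalIntegrable _ _)).symm) hpos
  have hes : ContDiff ℝ ∞ fun x => deriv u₀ x + conv η ρ₀ x :=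
    hds.add (contDiff_conv hηp hηi hρ₀.periodic hρs)
  have hep : IsPeriodic fun x => deriv u₀ x + conv η ρ₀ x := fun x => by
    have h : IsPeriodic (conv η ρ₀) := conv_periodic hηp
    simp only [hdp x, h x]
  have he : (fun x => max 0 (deriv u₀ x + conv η ρ₀ x)) = fun x => deriv u₀ x + conv η ρ₀ x :=
    funext fun x => max_eq_right (nonneg_of_ae_torus hes.continuous hep hpos x)
  rw [he] at D
  obtain ⟨X, hX⟩ := D.exists_flow
  exact ⟨_, _, (hX.isGlobalSolution D).congr_data hη' (ae_eq_refl _) (ae_eq_refl _),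
    (hX.isSmoothSolution D hρs hus hes).congr_kernel hη'⟩

end CuckerSmale

end

theorem theorem1p1 (φ ρ₀ u₀ u₀' : ℝ → ℝ)
    (hφ : CuckerSmale.IsBoundedKernel φ)
    (hρ₀ : CuckerSmale.MemL1Plus ρ₀)
    (hu₀ : CuckerSmale.MemW1Infty u₀ u₀')
    (hsub : ∀ᵐ x ∂CuckerSmale.torus, 0 < u₀' x + CuckerSmale.conv φ ρ₀ x) :
    ∃ ρ u : ℝ → ℝ → ℝ,
      CuckerSmale.IsGlobalSolution φ ρ₀ u₀ ρ u ∧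
      (ContDiff ℝ ∞ ρ₀ → ContDiff ℝ ∞ u₀ →
        CuckerSmale.IsSmoothSolution φ ρ₀ u₀ ρ u) := by
  -- The pair is chosen before the smoothness implication, and the two constructions use different
  -- representatives of the data; hence the case distinction.
  by_cases h : ContDiff ℝ ∞ ρ₀ ∧ ContDiff ℝ ∞ u₀
  · obtain ⟨ρ, u, h1, h2⟩ := CuckerSmale.exists_smooth_solution hφ hρ₀ hu₀ hsub h.1 h.2
    exact ⟨ρ, u, h1, fun _ _ => h2⟩
  · obtain ⟨ρ, u, h1⟩ := CuckerSmale.exists_global_solution hφ hρ₀ hu₀ hsub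
    exact ⟨ρ, u, h1, fun h2 h3 => absurd ⟨h2, h3⟩ h⟩
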